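/- \textbf{Setting.} Fix $\Lambda<0$, $l=\sqrt{-3/\Lambda}$. For $\mathfrak p=(\mathfrak m,\mathfrak a)\in\mathbb R^2_{>0}$ put $M=\mathfrak m l/\sqrt3$, $a=\mathfrak a l/\sqrt 3$, $\Delta(r)=(a^2+r^2)(1+r^2/l^2)-2Mr$, $\Xi=1-a^2/l^2$. Let $\mathscr P$ be the set of all such $\mathfrak p$ with $0<a<l$ for which $\Delta$ has two real roots $0<r_-<r_+$ and $r_+^2>al$. Put $\omega_r=a\Xi/(r^2+a^2)$, $\omega_\pm=\omega_{r_\pm}$, and let $r^*$ be given by $dr^*/dr=(r^2+a^2)/\Delta$ on $(r_+,\infty)$, $r^*(\infty)=\frac\pi2l$; a prime is $d/dr^*$. With $\vartheta=a\omega_-$, use the coordinates $(\vartheta,\mathfrak a)$ on $\mathscr P$; let $\Gamma=\partial_\vartheta$ in these coordinates and let $\Phi^\Gamma_\tau:(\vartheta,\mathfrak a)\mapsto(\vartheta+\tau,\mathfrak a)$ be its flow. \textbf{Angular eigenvalues.} For $\xi\in\mathbb R$, $m\in\mathbb Z$ let $\lambda_{m\ell}(\xi)$, $\ell=|m|,|m|+1,\dots$,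 be the eigenvalues in ascending order of the operator on $L^2(-1,1)$ (with $\Delta_x=1-\frac{a^2}{l^2}x^2$) $$-\tfrac{d}{dx}\Big(\Delta_x(1-x^2)\tfrac{d}{dx}\,\cdot\Big)+\tfrac{\Xi^2m^2}{\Delta_x(1-x^2)}-\Xi\xi^2\tfrac{x^2}{\Delta_x}-2m\xi\tfrac{\Xi}{\Delta_x}\tfrac{a^2}{l^2}x^2+\tfrac{2a^2}{l^2}(1-x^2),$$ with boundary condition $(1-x^2)f'(x)\to0$ as $x\to\pm1$ if $m=0$. Write $\lambda_{m\ell}=\lambda_{m\ell}(a\omega_-m)$. \textbf{Radial equation.} Let $-u''+(V_0+V_1-\omega^2)u=0$ with $\omega=\omega_-m$ and $$V_0=\frac{\Delta(\lambda_{m\ell}+\omega^2a^2)-\Xi^2a^2m^2-2m\omega a\Xi(\Delta-(r^2+a^2))}{(r^2+a^2)^2},$$ $$V_1=-\frac{3r^2\Delta^2}{(r^2+a^2)^4}+\Delta\frac{5r^4/l^2+3r^2(1+a^2/l^2)-4Mr+a^2}{(r^2+a^2)^3}-\frac{2\Delta}{l^2(r^2+a^2)}.$$ Let $u_\infty$ be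 the solution with $u_\infty(\frac\pi2l)=0$, $u_\infty'(\frac\pi2l)=1$, and $u_{\mathcal H^+}$ the solution with $u_{\mathcal H^+}-e^{-i(\omega-\omega_+m)r^*}\to0$ as $r^*\to-\infty$. For $\mu\in\mathbb R$ put $$V_{\rm main}=\frac{\Delta}{(r^2+a^2)^2}\left(\mu+\omega_-^2a^2-2a\omega_-\Xi\right)-(\omega_--\omega_r)^2,$$ and let $r_1(\mu,\mathfrak p)<r_2(\mu,\mathfrak p)$ be its two largest roots in $(r_+,\infty)$. Let $\mu_{\rm top}=\omega_-^2(l^2-a^2)+2a\omega_-\Xi$ and let $E_{\mathfrak p}$ be the set of $\tilde\mu\in(\Xi^2,\mu_{\rm top})$ such that every $\mu\in[\tilde\mu,\mu_{\rm top})$ satisfies $$\Big(l^{-2}+\tfrac{3M^2}{\Xi}\big(\tfrac{9M^2}{\Xi^2}+a^2\big)^{-2}\Big)(\mu+\omega_-^2a^2-2a\omega_-\Xi)-\omega_-^2>0$$ and, for all fixed $r\ge r_2(\mu,\mathfrak p)$, $$\Gamma(\Delta^{-1})\,(\mu+a^2\omega_-^2-2a\omega_-\Xi)-\Gamma\Big(\tfrac{(r^2+a^2)^2}{\Delta^2}(\omega_--\omega_r)^2\Big)<0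 .$$ Put $\mu_0=\inf E_{\mathfrak p}$, $\mu_1=\sup E_{\mathfrak p}$, $\sigma_1=\mu_0+\frac12(\mu_1-\mu_0)$, $\sigma_2=\mu_0+\frac34(\mu_1-\mu_0)$. \textbf{The Airy-type solution.} Fix a continuous $\epsilon:\mathscr P\to(0,\infty)$ with $r_1^*+\epsilon(\mathfrak p)<r_2^*$ for all $\mu\in[\sigma_1(\mathfrak p),\sigma_2(\mathfrak p)]$, where $r_i^*=r^*(r_i)$. Let $m\ge1$ and $\mu=\lambda_{m\ell}m^{-2}\in[\sigma_1,\sigma_2]$. Put $\xi_2=(\frac32\int_{r^*}^{r_2^*}V_{\rm main}^{1/2}\,dy)^{2/3}$ for $r_1^*<r^*<r_2^*$, $\xi_2=-(\frac32\int_{r_2^*}^{r^*}|V_{\rm main}|^{1/2}\,dy)^{2/3}$ for $r^*\ge r_2^*$, and $\hat f_2=V_{\rm main}/\xi_2$ (extended by continuity to $r_2^*$). Let $u_{\rm Ai2}$ be the solution of the radial equation which has at $r^*=r_1^*+\epsilon$ the same value and first derivative as $\hat f_2^{1/4}(r_2^*)\hat f_2^{-1/4}\,{\rm Ai}(m^{2/3}\xi_2)$,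 where ${\rm Ai}$ is the Airy function. \textbf{The set.} With $\mathfrak W[u,v]=uv'-u'v$ put $\mathfrak W_1(\mathfrak p,m,\ell)=\mathfrak W[u_{\mathcal H^+},u_\infty]$ and, if $\sigma_1\le\lambda_{m\ell}m^{-2}\le\sigma_2$, $\mathfrak W_2(\mathfrak p,m,\ell)=\mathfrak W[u_{\rm Ai2},u_\infty]$. Let $U(m,\ell)$ be the set of $\mathfrak p\in\mathscr P$ with $|\mathfrak W_1|<e^{-\sqrt m}$, $\sigma_1<\lambda_{m\ell}m^{-2}<\sigma_2$, $|\mathfrak W_2|<e^{-\ell}e^{-m}$, $|\Gamma\mathfrak W_2|>1$ and $|\mathfrak W_2(\Phi_\tau^\Gamma(\mathfrak p),m,\ell)|>e^{-\ell}e^{-m}$ for all $|\tau|\in[e^{-\ell}e^{-m},m^{-2}]$ for which $\Phi_\tau^\Gamma(\mathfrak p)$ exists in $\mathscr P$ and lies in the domain of $\mathfrak W_2(\cdot,m,\ell)$. Let $$\mathscr P_{\text{Blow-up}}=\bigcap_{m_0\in\mathbb N}\ \bigcup_{m\ge m_0}\ \bigcup_{m\le\ell\le m^2}U(m,\ell).$$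 \textbf{Proposition.} $\mathscr P_{\text{Blow-up}}\subset\mathbb R^2$ has Lebesgue measure zero. Moreover, for every closed square $C\subset\mathscr P$ with sides parallel to the axes there is a constant $K$ such that for all integers $\ell\ge m\ge1$: for every $\tilde{\mathfrak a}$, the set $U(m,\ell)\cap C\cap\{\mathfrak a=\tilde{\mathfrak a}\}$ is a union of at most $Km^2$ sets of diameter at most $Ke^{-\ell-m}$; and the Lebesgue (outer) measure satisfies $|U(m,\ell)\cap C|\le Km^2e^{-\ell-m}$. -/

import Mathlib

open Set Filter Topology MeasureTheory

noncomputable section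

namespace KerrAdS

/-! ### Parameters

Throughout, `l > 0` is the AdS radius, and a point `p = (𝔪, 𝔞)` of `ℝ × ℝ` is a pair of
dimensionless Kerr–AdS parameters. -/

/-- The AdS radius `l = √(-3/Λ)`. -/
def adsRadius (Λ : ℝ) : ℝ := Real.sqrt (-3 / Λ)

/-- The mass `M = 𝔪 l / √3`. -/
def mass (l : ℝ) (p : ℝ × ℝ) : ℝ := p.1 * l / Real.sqrt 3

/-- The specific angular momentum `a = 𝔞 l / √3`. -/
def spin (l : ℝ) (p : ℝ × ℝ) : ℝ := p.2 * l / Real.sqrt 3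

/-- `Δ(r) = (a² + r²)(1 + r²/l²) - 2 M r`. -/
def Delta (l : ℝ) (p : ℝ × ℝ) (r : ℝ) : ℝ :=
  ((spin l p) ^ 2 + r ^ 2) * (1 + r ^ 2 / l ^ 2) - 2 * mass l p * r

/-- `Ξ = 1 - a²/l²`. -/
def Xi (l : ℝ) (p : ℝ × ℝ) : ℝ := 1 - (spin l p) ^ 2 / l ^ 2

/-- The smallest real root of `Δ` (which is convex, so that it has at most two). -/
def rMinus (l : ℝ) (p : ℝ × ℝ) : ℝ := sInf {r : ℝ | Delta l p r = 0}

/-- The largest real root of `Δ`. -/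
def rPlus (l : ℝ) (p : ℝ × ℝ) : ℝ := sSup {r : ℝ | Delta l p r = 0}

/-- `(M, a)` is non-degenerate: `0 < a < l` and `Δ` has two roots `0 < r₋ < r₊`. -/
def NonDegenerate (l : ℝ) (p : ℝ × ℝ) : Prop :=
  0 < spin l p ∧ spin l p < l ∧
    ∃ r₁ r₂ : ℝ, 0 < r₁ ∧ r₁ < r₂ ∧ Delta l p r₁ = 0 ∧ Delta l p r₂ = 0

/-- The parameter space `𝒫`: positive, non-degenerate parameters which satisfy the
Hawking–Reall bound `r₊² > a l`. -/
def paramSpace (l : ℝ) : Set (ℝ × ℝ) :=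
  {p | 0 < p.1 ∧ 0 < p.2 ∧ NonDegenerate l p ∧ spin l p * l < (rPlus l p) ^ 2}

/-- `ω_r = a Ξ / (r² + a²)`. -/
def omegaAt (l : ℝ) (p : ℝ × ℝ) (r : ℝ) : ℝ :=
  spin l p * Xi l p / (r ^ 2 + (spin l p) ^ 2)

/-- `ω₋`, the value of `ω_r` at the Cauchy horizon. -/
def omegaMinus (l : ℝ) (p : ℝ × ℝ) : ℝ := omegaAt l p (rMinus l p)

/-- `ω₊`, the value of `ω_r` at the event horizon. -/
def omegaPlus (l : ℝ) (p : ℝ × ℝ) : ℝ := omegaAt l p (rPlus l p)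

/-! ### The coordinates `(ϑ, 𝔞)` on `𝒫`, the vector field `Γ = ∂/∂ϑ` and its flow -/

/-- `ϑ = (1 - a²/l²) / (1 + r₋²/a²)`, which is `a ω₋`. -/
def theta (l : ℝ) (p : ℝ × ℝ) : ℝ :=
  (1 - (spin l p) ^ 2 / l ^ 2) / (1 + (rMinus l p) ^ 2 / (spin l p) ^ 2)

/-- The coordinate map `(𝔪, 𝔞) ↦ (ϑ, 𝔞)` (it is injective on `𝒫`). -/
def coord (l : ℝ) (p : ℝ × ℝ) : ℝ × ℝ := (theta l p, p.2)

/-- The inverse of the coordinate map: the point of `𝒫` with coordinates `(s, 𝔞)`. -/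
def coordInv (l : ℝ) (s 𝔞 : ℝ) : ℝ × ℝ :=
  Function.invFunOn (coord l) (paramSpace l) (s, 𝔞)

/-- `Γ F`, the derivative of `F` in `ϑ` in the coordinates `(ϑ, 𝔞)`. -/
def gammaDeriv {E : Type*} [NormedAddCommGroup E] [NormedSpace ℝ E]
    (l : ℝ) (F : ℝ × ℝ → E) (p : ℝ × ℝ) : E :=
  deriv (fun s : ℝ => F (coordInv l s p.2)) (theta l p)

/-- The flow `Φ_τ` of `Γ` is defined at `p` (it has not left `𝒫`). -/
def FlowDefined (l τ : ℝ) (p : ℝ × ℝ) : Prop :=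
  (theta l p + τ, p.2) ∈ coord l '' paramSpace l

/-- The flow `Φ_τ` of `Γ`, which is `(ϑ, 𝔞) ↦ (ϑ + τ, 𝔞)`. -/
def flow (l τ : ℝ) (p : ℝ × ℝ) : ℝ × ℝ := coordInv l (theta l p + τ) p.2

/-! ### The angular o.d.e. -/

/-- `Δ_x = 1 - (a²/l²) x²`. -/
def DeltaX (l : ℝ) (p : ℝ × ℝ) (x : ℝ) : ℝ := 1 - (spin l p) ^ 2 / l ^ 2 * x ^ 2

/-- The zeroth order coefficient of the operator `P_x(ξ)` with azimuthal number `m`. -/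
def angularPotential (l : ℝ) (p : ℝ × ℝ) (m : ℤ) (ξ x : ℝ) : ℝ :=
  (Xi l p) ^ 2 * (m : ℝ) ^ 2 / (DeltaX l p x * (1 - x ^ 2))
    - Xi l p * ξ ^ 2 * (x ^ 2 / DeltaX l p x)
    - 2 * (m : ℝ) * ξ * (Xi l p / DeltaX l p x) * ((spin l p) ^ 2 / l ^ 2) * x ^ 2
    + 2 / l ^ 2 * (spin l p) ^ 2 * (1 - x ^ 2)

/-- `f` is an eigenfunction, with eigenvalue `lam`, of
`P_x(ξ) = - d/dx (Δ_x (1 - x²) d/dx ·) + (angular potential)` on `L²(-1, 1)`, with the boundary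
condition `(1 - x²) f'(x) → 0` as `x → ±1` in the case `m = 0`. -/
structure IsAngularEigenfunction (l : ℝ) (p : ℝ × ℝ) (m : ℤ) (ξ lam : ℝ) (f : ℝ → ℝ) :
    Prop where
  ne_zero : ∃ x ∈ Ioo (-1 : ℝ) 1, f x ≠ 0
  memLp : MemLp f 2 (volume.restrict (Ioo (-1 : ℝ) 1))
  diff : ∀ x ∈ Ioo (-1 : ℝ) 1, DifferentiableAt ℝ f x
  ode : ∀ x ∈ Ioo (-1 : ℝ) 1,
    HasDerivAt (fun y : ℝ => DeltaX l p y * (1 - y ^ 2) * deriv f y)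
      (angularPotential l p m ξ x * f x - lam * f x) x
  bdry_right : m = 0 → Tendsto (fun x : ℝ => (1 - x ^ 2) * deriv f x) (𝓝[<] 1) (𝓝 0)
  bdry_left : m = 0 → Tendsto (fun x : ℝ => (1 - x ^ 2) * deriv f x) (𝓝[>] (-1)) (𝓝 0)

/-- The set of eigenvalues of `P_x(ξ)`. -/
def angularSpectrum (l : ℝ) (p : ℝ × ℝ) (m : ℤ) (ξ : ℝ) : Set ℝ :=
  {lam | ∃ f : ℝ → ℝ, IsAngularEigenfunction l p m ξ lam f}

/-- The eigenvalue `λ_{mℓ}(ξ)`: the (simple) eigenvalues are labelled in ascending order by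
`ℓ = |m|, |m| + 1, …`, so this is the smallest `c` for which there are at least `ℓ - |m| + 1`
eigenvalues `≤ c`. -/
def angularEigenvalue (l : ℝ) (p : ℝ × ℝ) (m : ℤ) (ℓ : ℕ) (ξ : ℝ) : ℝ :=
  sInf {c : ℝ | ((ℓ - m.natAbs + 1 : ℕ) : ℕ∞) ≤ (angularSpectrum l p m ξ ∩ Iic c).encard}

/-- `λ_{mℓ}(a ω₋ m)`, the eigenvalue at the interior scattering pole `ω = ω₋ m`. -/
def lamMinus (l : ℝ) (p : ℝ × ℝ) (m : ℤ) (ℓ : ℕ) : ℝ :=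
  angularEigenvalue l p m ℓ (spin l p * omegaMinus l p * m)

/-! ### The radial o.d.e.

Functions on the exterior are written as functions of `r ∈ (r₊, ∞)`; a prime denotes the
derivative with respect to the tortoise coordinate `r*`. -/

/-- The tortoise coordinate: `dr*/dr = (r² + a²)/Δ` and `r*(+∞) = (π/2) l`. -/
def rStar (l : ℝ) (p : ℝ × ℝ) (r : ℝ) : ℝ :=
  Real.pi / 2 * l - ∫ s in Ioi r, (s ^ 2 + (spin l p) ^ 2) / Delta l p s

/-- `u' = du/dr* = Δ/(r² + a²) · du/dr`. -/
def dStar (l : ℝ) (p : ℝ × ℝ) (u : ℝ → ℂ) (r : ℝ) : ℂ :=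
  ((Delta l p r / (r ^ 2 + (spin l p) ^ 2) : ℝ) : ℂ) * deriv u r

/-- The purely radial part `V₁` of the potential. -/
def potentialOne (l : ℝ) (p : ℝ × ℝ) (r : ℝ) : ℝ :=
  - (Delta l p r) ^ 2 * (3 * r ^ 2) / (r ^ 2 + (spin l p) ^ 2) ^ 4
    + Delta l p r *
      (5 * r ^ 4 / l ^ 2 + 3 * r ^ 2 * (1 + (spin l p) ^ 2 / l ^ 2) - 4 * mass l p * r
        + (spin l p) ^ 2) / (r ^ 2 + (spin l p) ^ 2) ^ 3
    - 2 * Delta l p r / l ^ 2 * (1 / (r ^ 2 + (spin l p) ^ 2))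

/-- The frequency dependent part `V₀` of the potential, where `lam` is the angular eigenvalue. -/
def potentialZero (l : ℝ) (p : ℝ × ℝ) (ω : ℝ) (m : ℤ) (lam r : ℝ) : ℝ :=
  (Delta l p r * (lam + ω ^ 2 * (spin l p) ^ 2)
      - (Xi l p) ^ 2 * (spin l p) ^ 2 * (m : ℝ) ^ 2
      - 2 * (m : ℝ) * ω * spin l p * Xi l p * (Delta l p r - (r ^ 2 + (spin l p) ^ 2)))
    / (r ^ 2 + (spin l p) ^ 2) ^ 2

/-- `u` solves the radial o.d.e. `-u'' + (V - ω²) u = 0`, `V = V₀ + V₁`, on `(r₊, ∞)`. -/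
def IsRadialSolution (l : ℝ) (p : ℝ × ℝ) (ω : ℝ) (m : ℤ) (lam : ℝ) (u : ℝ → ℂ) : Prop :=
  ∀ r : ℝ, rPlus l p < r →
    DifferentiableAt ℝ u r ∧ DifferentiableAt ℝ (dStar l p u) r ∧
      - dStar l p (dStar l p u) r
        + ((potentialZero l p ω m lam r + potentialOne l p r - ω ^ 2 : ℝ) : ℂ) * u r = 0

/-- `u_∞`: the solution with `u = 0` and `u' = 1` at `r* = (π/2) l`, i.e. at `r = ∞`. -/
def IsUInfty (l : ℝ) (p : ℝ × ℝ) (ω : ℝ) (m : ℤ) (lam : ℝ) (u : ℝ → ℂ) : Prop :=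
  IsRadialSolution l p ω m lam u ∧ Tendsto u atTop (𝓝 0) ∧
    Tendsto (dStar l p u) atTop (𝓝 1)

/-- `u_{ℋ⁺}`: the solution with `u = e^{-i (ω - ω₊ m) r*}` as `r* → -∞`, i.e. as `r → r₊`. -/
def IsUHorizon (l : ℝ) (p : ℝ × ℝ) (ω : ℝ) (m : ℤ) (lam : ℝ) (u : ℝ → ℂ) : Prop :=
  IsRadialSolution l p ω m lam u ∧
    Tendsto (fun r : ℝ =>
        u r - Complex.exp (-Complex.I * (((ω - omegaPlus l p * m) * rStar l p r : ℝ) : ℂ)))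
      (𝓝[>] (rPlus l p)) (𝓝 0)

/-! ### The leading part of the potential at `ω = ω₋ m`, and its turning points -/

/-- `V_main`, where `μ` stands for `λ_{mℓ}(a ω₋ m) / m²`. -/
def potentialMain (l : ℝ) (p : ℝ × ℝ) (μ r : ℝ) : ℝ :=
  Delta l p r / (r ^ 2 + (spin l p) ^ 2) ^ 2
      * (μ + (omegaMinus l p) ^ 2 * (spin l p) ^ 2 - 2 * spin l p * omegaMinus l p * Xi l p)
    - (omegaMinus l p - omegaAt l p r) ^ 2

/-- The larger turning point `r₂(μ, p)`, the largest root of `V_main` in `(r₊, ∞)`. -/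
def turnTwo (l : ℝ) (p : ℝ × ℝ) (μ : ℝ) : ℝ :=
  sSup {r : ℝ | rPlus l p < r ∧ potentialMain l p μ r = 0}

/-- The smaller turning point `r₁(μ, p)`, the second largest root of `V_main` in `(r₊, ∞)`. -/
def turnOne (l : ℝ) (p : ℝ × ℝ) (μ : ℝ) : ℝ :=
  sSup {r : ℝ | rPlus l p < r ∧ r < turnTwo l p μ ∧ potentialMain l p μ r = 0}

/-- `ω₋² (l² - a²) + 2 a ω₋ Ξ`: below this value of `μ`, `V_main` is negative at `r = ∞`. -/
def muTop (l : ℝ) (p : ℝ × ℝ) : ℝ :=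
  (omegaMinus l p) ^ 2 * (l ^ 2 - (spin l p) ^ 2) + 2 * spin l p * omegaMinus l p * Xi l p

/-- The interval `E_p` of (rescaled) angular eigenvalues. -/
def trappingRange (l : ℝ) (p : ℝ × ℝ) : Set ℝ :=
  {μ' | (Xi l p) ^ 2 < μ' ∧ μ' < muTop l p ∧ ∀ μ ∈ Ico μ' (muTop l p),
    0 < ((l ^ 2)⁻¹ + 3 * ((mass l p) ^ 2 / Xi l p)
            * ((9 * (mass l p) ^ 2 / (Xi l p) ^ 2 + (spin l p) ^ 2) ^ 2)⁻¹)
          * (μ + (omegaMinus l p) ^ 2 * (spin l p) ^ 2 - 2 * spin l p * omegaMinus l p * Xi l p)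
        - (omegaMinus l p) ^ 2 ∧
    ∀ r : ℝ, turnTwo l p μ ≤ r →
      gammaDeriv l (fun q => (Delta l q r)⁻¹) p
          * (μ + (spin l p) ^ 2 * (omegaMinus l p) ^ 2 - 2 * spin l p * omegaMinus l p * Xi l p)
        - gammaDeriv l (fun q => (r ^ 2 + (spin l q) ^ 2) ^ 2 / (Delta l q r) ^ 2
            * (omegaMinus l q - omegaAt l q r) ^ 2) p < 0}

/-- `μ₀ = inf E_p`. -/
def muZero (l : ℝ) (p : ℝ × ℝ) : ℝ := sInf (trappingRange l p)

/-- `μ₁ = sup E_p`. -/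
def muOne (l : ℝ) (p : ℝ × ℝ) : ℝ := sSup (trappingRange l p)

/-- `σ₁ = μ₀ + (μ₁ - μ₀)/2`. -/
def sigmaOne (l : ℝ) (p : ℝ × ℝ) : ℝ := muZero l p + 1 / 2 * (muOne l p - muZero l p)

/-- `σ₂ = μ₀ + 3(μ₁ - μ₀)/4`. -/
def sigmaTwo (l : ℝ) (p : ℝ × ℝ) : ℝ := muZero l p + 3 / 4 * (muOne l p - muZero l p)

/-! ### The solution `u_{Ai2}` attached to the turning point `r₂` -/

/-- `y` solves Airy's equation `y'' = x y` with the initial values of `Ai` at `0`. -/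
def IsAiry (y : ℝ → ℝ) : Prop :=
  Differentiable ℝ y ∧ (∀ x : ℝ, HasDerivAt (deriv y) (x * y x) x) ∧
    y 0 = 1 / ((3 : ℝ) ^ (2 / 3 : ℝ) * Real.Gamma (2 / 3)) ∧
    deriv y 0 = -1 / ((3 : ℝ) ^ (1 / 3 : ℝ) * Real.Gamma (1 / 3))

/-- The Airy function `Ai` of the first kind. -/
def airyAi : ℝ → ℝ := Classical.epsilon IsAiry

/-- `ξ₂`; note `dr* = (r² + a²)/Δ dr`. -/
def xiTwo (l : ℝ) (p : ℝ × ℝ) (μ r : ℝ) : ℝ :=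
  if r < turnTwo l p μ then
    (3 / 2 * ∫ s in r..turnTwo l p μ, Real.sqrt (potentialMain l p μ s)
      * ((s ^ 2 + (spin l p) ^ 2) / Delta l p s)) ^ (2 / 3 : ℝ)
  else
    -(3 / 2 * ∫ s in turnTwo l p μ..r, Real.sqrt |potentialMain l p μ s|
      * ((s ^ 2 + (spin l p) ^ 2) / Delta l p s)) ^ (2 / 3 : ℝ)

/-- `f̂₂ = V_main / ξ₂`, extended by continuity to the turning point `r₂`. -/
def fHatTwo (l : ℝ) (p : ℝ × ℝ) (μ r : ℝ) : ℝ :=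
  if r = turnTwo l p μ then
    limUnder (𝓝[≠] (turnTwo l p μ)) (fun s : ℝ => potentialMain l p μ s / xiTwo l p μ s)
  else potentialMain l p μ r / xiTwo l p μ r

/-- The leading part `f̂₂^{1/4}(r₂) f̂₂^{-1/4} Ai(m^{2/3} ξ₂)` of `u_{Ai2}`. -/
def airyApprox (l : ℝ) (p : ℝ × ℝ) (m : ℤ) (μ r : ℝ) : ℂ :=
  (((fHatTwo l p μ (turnTwo l p μ)) ^ (1 / 4 : ℝ) * (fHatTwo l p μ r) ^ (-(1 / 4) : ℝ)
    * airyAi ((m : ℝ) ^ (2 / 3 : ℝ) * xiTwo l p μ r) : ℝ) : ℂ)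

/-- `u_{Ai2}`: the solution of the radial o.d.e. at `ω = ω₋ m` which equals
`f̂₂^{1/4}(r₂) f̂₂^{-1/4} (Ai(m^{2/3} ξ₂) + ε_{Ai2})`, where the error term is initialized by
`ε_{Ai2} = ε_{Ai2}' = 0` at `r* = r₁* + ε`. -/
def IsUAiryTwo (l : ℝ) (ε : ℝ × ℝ → ℝ) (p : ℝ × ℝ) (m : ℤ) (lam : ℝ) (u : ℝ → ℂ) : Prop :=
  IsRadialSolution l p (omegaMinus l p * m) m lam u ∧
    ∃ r₀ : ℝ, turnOne l p (lam / (m : ℝ) ^ 2) < r₀ ∧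
      rStar l p r₀ = rStar l p (turnOne l p (lam / (m : ℝ) ^ 2)) + ε p ∧
      u r₀ = airyApprox l p m (lam / (m : ℝ) ^ 2) r₀ ∧
      dStar l p u r₀ = dStar l p (airyApprox l p m (lam / (m : ℝ) ^ 2)) r₀

/-- The offset `ε(p) > 0` is so small that `r₁* + ε < r₂*` for all `μ ∈ [σ₁, σ₂]`. -/
def AdmissibleOffset (l : ℝ) (ε : ℝ × ℝ → ℝ) : Prop :=
  ∀ p ∈ paramSpace l, 0 < ε p ∧ ∀ μ ∈ Icc (sigmaOne l p) (sigmaTwo l p),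
    rStar l p (turnOne l p μ) + ε p < rStar l p (turnTwo l p μ)

/-! ### The Wronskians and the set `𝒫_Blow-up` -/

/-- The Wronskian `u v' - u' v` of two solutions of the radial o.d.e. It does not depend on
the point of `(r₊, ∞)` where it is evaluated, for which we take `r₊ + 1`. -/
def wronskian (l : ℝ) (p : ℝ × ℝ) (u v : ℝ → ℂ) : ℂ :=
  u (rPlus l p + 1) * dStar l p v (rPlus l p + 1)
    - dStar l p u (rPlus l p + 1) * v (rPlus l p + 1)

/-- `u_∞` at `ω = ω₋ m`. -/
def uInfty (l : ℝ) (p : ℝ × ℝ) (m : ℤ) (ℓ : ℕ) : ℝ → ℂ :=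
  Classical.epsilon (IsUInfty l p (omegaMinus l p * m) m (lamMinus l p m ℓ))

/-- `u_{ℋ⁺}` at `ω = ω₋ m`. -/
def uHorizon (l : ℝ) (p : ℝ × ℝ) (m : ℤ) (ℓ : ℕ) : ℝ → ℂ :=
  Classical.epsilon (IsUHorizon l p (omegaMinus l p * m) m (lamMinus l p m ℓ))

/-- `u_{Ai2}`. -/
def uAiryTwo (l : ℝ) (ε : ℝ × ℝ → ℝ) (p : ℝ × ℝ) (m : ℤ) (ℓ : ℕ) : ℝ → ℂ :=
  Classical.epsilon (IsUAiryTwo l ε p m (lamMinus l p m ℓ))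

/-- `𝔚₁ = 𝔚[u_{ℋ⁺}, u_∞]` at `ω = ω₋ m`. -/
def wOne (l : ℝ) (p : ℝ × ℝ) (m : ℤ) (ℓ : ℕ) : ℂ :=
  wronskian l p (uHorizon l p m ℓ) (uInfty l p m ℓ)

/-- `𝔚₂ = 𝔚[u_{Ai2}, u_∞]` at `ω = ω₋ m`; it is meaningful on `wTwoDomain`. -/
def wTwo (l : ℝ) (ε : ℝ × ℝ → ℝ) (m : ℤ) (ℓ : ℕ) (p : ℝ × ℝ) : ℂ :=
  wronskian l p (uAiryTwo l ε p m ℓ) (uInfty l p m ℓ)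

/-- The domain of `𝔚₂(·, m, ℓ)`. -/
def wTwoDomain (l : ℝ) (m : ℤ) (ℓ : ℕ) : Set (ℝ × ℝ) :=
  {p | p ∈ paramSpace l ∧ sigmaOne l p ≤ lamMinus l p m ℓ / (m : ℝ) ^ 2 ∧
    lamMinus l p m ℓ / (m : ℝ) ^ 2 ≤ sigmaTwo l p}

/-- The set `U(m, ℓ)`. The last condition is imposed for those `τ` for which its left-hand
side is defined. -/
def resonantSet (l : ℝ) (ε : ℝ × ℝ → ℝ) (m ℓ : ℕ) : Set (ℝ × ℝ) :=
  {p | p ∈ paramSpace l ∧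
    ‖wOne l p m ℓ‖ < Real.exp (-Real.sqrt m) ∧
    sigmaOne l p < lamMinus l p m ℓ / (m : ℝ) ^ 2 ∧
    lamMinus l p m ℓ / (m : ℝ) ^ 2 < sigmaTwo l p ∧
    ‖wTwo l ε m ℓ p‖ < Real.exp (-(ℓ : ℝ)) * Real.exp (-(m : ℝ)) ∧
    1 < ‖gammaDeriv l (wTwo l ε m ℓ) p‖ ∧
    ∀ τ : ℝ, |τ| ∈ Icc (Real.exp (-(ℓ : ℝ)) * Real.exp (-(m : ℝ))) (1 / (m : ℝ) ^ 2) →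
      FlowDefined l τ p → flow l τ p ∈ wTwoDomain l m ℓ →
      Real.exp (-(ℓ : ℝ)) * Real.exp (-(m : ℝ)) < ‖wTwo l ε m ℓ (flow l τ p)‖}

/-- `U_{m₀} = ⋃_{m ≥ m₀} ⋃_{m ≤ ℓ ≤ m²} U(m, ℓ)`. -/
def resonantUnion (l : ℝ) (ε : ℝ × ℝ → ℝ) (m₀ : ℕ) : Set (ℝ × ℝ) :=
  {p | ∃ m ℓ : ℕ, m₀ ≤ m ∧ m ≤ ℓ ∧ ℓ ≤ m ^ 2 ∧ p ∈ resonantSet l ε m ℓ}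

/-- `𝒫_Blow-up = ⋂_{m₀} U_{m₀}`. -/
def blowUpSet (l : ℝ) (ε : ℝ × ℝ → ℝ) : Set (ℝ × ℝ) :=
  ⋂ m₀ : ℕ, resonantUnion l ε m₀

end KerrAdS

end

noncomputable section

namespace KerrAdS

/-! ### The horizons -/

/-! The geometric heart is short. Put δ = e^{-ℓ-m}. On a line of constant 𝔞 the flow of Γ is
translation in ϑ, so the last condition in U(m, ℓ) says the following: if p is in U(m, ℓ) and q is
any point of the same line at which 𝔚₂ is defined, has its eigenvalue strictly between σ₁ and σ₂ and
satisfies |𝔚₂| < δ, then |ϑ(q) - ϑ(p)| ≤ m⁻² already forces |ϑ(q) - ϑ(p)| < δ (`resonant_gap`).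
Since 0 < ϑ < 1, the line is cut into m² cells of ϑ-length m⁻², and inside each cell U(m, ℓ) has
ϑ-diameter at most δ. On a closed square 𝔪 is a Lipschitz function of ϑ along these lines, uniformly
in 𝔞 (`exists_inverse_lipschitz`), so each slice is covered by m² pieces of length O(δ)
(`resonant_slices`).

Thin slices do not bound the planar outer measure of a set that may fail to be measurable. Therefore
U(m, ℓ) is enclosed in a measurable set with equally thin slices (`volume_resonant_le`): start from
the points B where 𝔚₂ is small, and keep those whose line carries only a null set of points of B at
ϑ-distance between δ and m⁻². By the gap property every point of U(m, ℓ) is kept, and Tonelli gives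
the area. Summing over m ≤ ℓ ≤ m² leaves a bound O(m⁴ e^{-m}), which is summable, so Borel–Cantelli
on countably many rational squares gives measure zero (`volume_blowUpSet`).

The bulk of the work is the measurability of B = `smallSet`, that is, of every quantity in its
definition as a function of p. The angular and radial solutions with prescribed behaviour at a
singular endpoint are Neumann series of iterated integrals (`VolterraBound`), hence pointwise limits
of measurable functions. The eigenvalues are the zeros of a function continuous in λ, namely
φ(0)φ'(0) up to a nonzero factor, where φ is recessive at x = 1 (`mem_angularSpectrum_iff`), and
zeros can be counted measurably (`measurableSet_zero_count`). The endpoints σ₁, σ₂ are handled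
through projections of σ-compact sets (`measurableSet_image_fst`). The turning points are controlled
because (r² + a²)² V_main is a quartic without cubic term which also vanishes at r₋
(`turningPoints`). Finally 𝔚₂ is evaluated at the point where u_Ai2 has explicit initial data
(`wTwo_eq`). -/

lemma adsRadius_pos {Λ : ℝ} (hΛ : Λ < 0) : 0 < adsRadius Λ :=
  Real.sqrt_pos.2 (div_pos_of_neg_of_neg (by norm_num) hΛ)

lemma continuous_spin (l : ℝ) : Continuous (spin l) := by unfold spin; fun_prop

lemma continuous_mass (l : ℝ) : Continuous (mass l) := by unfold mass; fun_prop

lemma continuous_Xi (l : ℝ) : Continuous (Xi l) := by unfold Xi spin; fun_prop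

lemma continuous_Delta (l : ℝ) : Continuous fun x : (ℝ × ℝ) × ℝ => Delta l x.1 x.2 := by
  unfold Delta mass spin; fun_prop

lemma continuous_Delta_right (l : ℝ) (p : ℝ × ℝ) : Continuous (Delta l p) := by
  unfold Delta; fun_prop

/-- Since l²Δ is a monic quartic without cubic term, the cofactor of (r - r₁)(r - r₂) has linear
coefficient r₁ + r₂. The relation `h3` is the difference of the two root equations divided by r₁ -
r₂. -/
lemma Delta_factor {l : ℝ} (hl : 0 < l) {p : ℝ × ℝ} {r₁ r₂ : ℝ} (hne : r₁ ≠ r₂)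
    (h₁ : Delta l p r₁ = 0) (h₂ : Delta l p r₂ = 0) (r : ℝ) :
    Delta l p r = (r - r₁) * (r - r₂) *
      (r ^ 2 + (r₁ + r₂) * r + (l ^ 2 + spin l p ^ 2 + r₁ ^ 2 + r₂ ^ 2 + r₁ * r₂)) / l ^ 2 := by
  unfold Delta at *
  generalize mass l p = M at *
  generalize spin l p = a at *
  have e : ∀ x : ℝ, (a ^ 2 + x ^ 2) * (1 + x ^ 2 / l ^ 2) - 2 * M * x =
      ((a ^ 2 + x ^ 2) * (l ^ 2 + x ^ 2) - 2 * M * l ^ 2 * x) / l ^ 2 := by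
    intro x; field_simp
  rw [e] at *
  have hl2 : l ^ 2 ≠ 0 := by positivity
  rw [div_eq_zero_iff, or_iff_left hl2] at h₁ h₂
  congr 1
  have h3 : (r₁ + r₂) * (r₁ ^ 2 + r₂ ^ 2) + (l ^ 2 + a ^ 2) * (r₁ + r₂) = 2 * M * l ^ 2 := by
    apply mul_left_cancel₀ (sub_ne_zero.2 hne)
    linear_combination h₁ - h₂
  linear_combination h₁ + (r - r₁) * h3

/-- Completing the square leaves l² + a² + (r₁² + r₂²)/2 + (r₁ + r₂)²/4, so `Delta` has no further
real roots. -/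
lemma Delta_factor_pos {l a r₁ r₂ : ℝ} (hl : 0 < l) (r : ℝ) :
    0 < (r ^ 2 + (r₁ + r₂) * r + (l ^ 2 + a ^ 2 + r₁ ^ 2 + r₂ ^ 2 + r₁ * r₂)) := by
  nlinarith [sq_nonneg (r + (r₁ + r₂) / 2), sq_nonneg (r₁ + r₂), sq_nonneg a, sq_pos_of_pos hl,
    sq_nonneg r₁, sq_nonneg r₂]

lemma Delta_zeros {l : ℝ} (hl : 0 < l) {p : ℝ × ℝ} {r₁ r₂ : ℝ} (hlt : r₁ < r₂)
    (h₁ : Delta l p r₁ = 0) (h₂ : Delta l p r₂ = 0) :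
    {r : ℝ | Delta l p r = 0} = {r₁, r₂} := by
  ext r
  simp only [mem_ofPred_eq, mem_insert_iff, mem_singleton_iff]
  constructor
  · intro h
    rw [Delta_factor hl hlt.ne h₁ h₂ r, div_eq_zero_iff, or_iff_left (by positivity),
      mul_eq_zero, or_iff_left (Delta_factor_pos hl r).ne', mul_eq_zero, sub_eq_zero,
      sub_eq_zero] at h
    exact h
  · rintro (rfl | rfl) <;> assumption

lemma rMinus_eq {l : ℝ} (hl : 0 < l) {p : ℝ × ℝ} {r₁ r₂ : ℝ} (hlt : r₁ < r₂)
    (h₁ : Delta l p r₁ = 0) (h₂ : Delta l p r₂ = 0) : rMinus l p = r₁ := by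
  rw [rMinus, Delta_zeros hl hlt h₁ h₂, csInf_pair]; exact min_eq_left hlt.le

lemma rPlus_eq {l : ℝ} (hl : 0 < l) {p : ℝ × ℝ} {r₁ r₂ : ℝ} (hlt : r₁ < r₂)
    (h₁ : Delta l p r₁ = 0) (h₂ : Delta l p r₂ = 0) : rPlus l p = r₂ := by
  rw [rPlus, Delta_zeros hl hlt h₁ h₂, csSup_pair]; exact max_eq_right hlt.le

section
variable {l : ℝ} {p : ℝ × ℝ}

lemma spin_pos (hp : p ∈ paramSpace l) : 0 < spin l p := hp.2.2.1.1
lemma spin_lt (hp : p ∈ paramSpace l) : spin l p < l := hp.2.2.1.2.1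
lemma mass_pos (hl : 0 < l) (hp : p ∈ paramSpace l) : 0 < mass l p := by
  have := hp.1; unfold mass; positivity
lemma Xi_pos (hp : p ∈ paramSpace l) : 0 < Xi l p := by
  have h1 := spin_pos hp
  have h2 := spin_lt hp
  unfold Xi
  rw [sub_pos, div_lt_one (by nlinarith)]
  nlinarith

lemma horizons (hl : 0 < l) (hp : p ∈ paramSpace l) :
    0 < rMinus l p ∧ rMinus l p < rPlus l p ∧ Delta l p (rMinus l p) = 0 ∧
      Delta l p (rPlus l p) = 0 := by
  obtain ⟨-, -, ⟨-, -, r₁, r₂, h0, hlt, h₁, h₂⟩, -⟩ := hp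
  rw [rMinus_eq hl hlt h₁ h₂, rPlus_eq hl hlt h₁ h₂]
  exact ⟨h0, hlt, h₁, h₂⟩

lemma rMinus_pos (hl : 0 < l) (hp : p ∈ paramSpace l) : 0 < rMinus l p := (horizons hl hp).1
lemma rMinus_lt_rPlus (hl : 0 < l) (hp : p ∈ paramSpace l) : rMinus l p < rPlus l p :=
  (horizons hl hp).2.1
lemma rPlus_pos (hl : 0 < l) (hp : p ∈ paramSpace l) : 0 < rPlus l p :=
  (rMinus_pos hl hp).trans (rMinus_lt_rPlus hl hp)
lemma Delta_rMinus (hl : 0 < l) (hp : p ∈ paramSpace l) : Delta l p (rMinus l p) = 0 :=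
  (horizons hl hp).2.2.1
lemma Delta_rPlus (hl : 0 < l) (hp : p ∈ paramSpace l) : Delta l p (rPlus l p) = 0 :=
  (horizons hl hp).2.2.2

lemma Delta_neg_iff (hl : 0 < l) (hp : p ∈ paramSpace l) (r : ℝ) :
    Delta l p r < 0 ↔ rMinus l p < r ∧ r < rPlus l p := by
  have hlt := rMinus_lt_rPlus hl hp
  rw [Delta_factor hl hlt.ne (Delta_rMinus hl hp) (Delta_rPlus hl hp) r]
  rw [div_lt_iff₀ (by positivity), zero_mul, mul_comm, mul_neg_iff]
  have := Delta_factor_pos (a := spin l p) (r₁ := rMinus l p) (r₂ := rPlus l p) hl r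
  constructor
  · rintro (⟨-, h⟩ | ⟨h, -⟩)
    · rw [mul_neg_iff] at h
      rcases h with h | h
      · exact ⟨by linarith [h.1], by linarith [h.2]⟩
      · linarith [h.1, h.2]
    · linarith
  · rintro ⟨h1, h2⟩
    exact Or.inl ⟨this, mul_neg_of_pos_of_neg (by linarith) (by linarith)⟩

lemma Delta_pos (hl : 0 < l) (hp : p ∈ paramSpace l) {r : ℝ} (hr : rPlus l p < r) :
    0 < Delta l p r := by
  have hlt := rMinus_lt_rPlus hl hp
  rw [Delta_factor hl hlt.ne (Delta_rMinus hl hp) (Delta_rPlus hl hp) r]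
  have := Delta_factor_pos (a := spin l p) (r₁ := rMinus l p) (r₂ := rPlus l p) hl r
  have h1 : 0 < r - rMinus l p := by linarith
  have h2 : 0 < r - rPlus l p := by linarith
  positivity

lemma Delta_zero (l : ℝ) (p : ℝ × ℝ) : Delta l p 0 = spin l p ^ 2 := by simp [Delta]

lemma exists_Delta_pos (hl : 0 < l) (p : ℝ × ℝ) (c : ℝ) : ∃ r, c < r ∧ 0 < Delta l p r := by
  set N := max c (max 1 (2 * |mass l p| * l ^ 2)) + 1 with hN
  have h1 : 1 ≤ N := by have := le_max_left 1 (2 * |mass l p| * l ^ 2)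
                        have := le_max_right c (max 1 (2 * |mass l p| * l ^ 2)); linarith
  have h2 : 2 * |mass l p| * l ^ 2 < N := by
    have := le_max_right 1 (2 * |mass l p| * l ^ 2)
    have := le_max_right c (max 1 (2 * |mass l p| * l ^ 2)); linarith
  refine ⟨N, by have := le_max_left c (max 1 (2 * |mass l p| * l ^ 2)); linarith, ?_⟩
  unfold Delta
  have h3 : 2 * |mass l p| < N / l ^ 2 := by rwa [lt_div_iff₀ (by positivity)]
  have h4 : N ^ 2 * (N ^ 2 / l ^ 2) ≤ (spin l p ^ 2 + N ^ 2) * (1 + N ^ 2 / l ^ 2) := by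
    gcongr <;> nlinarith [sq_nonneg (spin l p)]
  have h5 : N * N ≤ N ^ 2 * N := by nlinarith
  have h6 : N ^ 2 * (N ^ 2 / l ^ 2) = N ^ 2 * N * (N / l ^ 2) := by ring
  have h7 : 2 * mass l p * N ≤ 2 * |mass l p| * N := by gcongr; exact le_abs_self _
  have h8 : 2 * |mass l p| * N < N / l ^ 2 * N := by gcongr
  have h9 : N * (N / l^2) ≤ N ^ 2 * N * (N / l ^ 2) := by
    have : N ≤ N ^ 2 * N := by nlinarith
    gcongr
  linarith

/-- The conditions on the roots become the existence of one radius at which strict inequalities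
hold, which makes openness of 𝒫 immediate. Conversely, Δ(0) = a² > 0 > Δ(r) together with Δ > 0 far
out produces a root on each side of r. -/
lemma mem_paramSpace_iff (hl : 0 < l) : p ∈ paramSpace l ↔
    0 < p.1 ∧ 0 < p.2 ∧ spin l p < l ∧ ∃ r, 0 < r ∧ spin l p * l < r ^ 2 ∧ Delta l p r < 0 := by
  constructor
  · intro hp
    refine ⟨hp.1, hp.2.1, spin_lt hp, ?_⟩
    have h1 := hp.2.2.2
    have h2 := rMinus_lt_rPlus hl hp
    have h3 : Real.sqrt (spin l p * l) < rPlus l p := by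
      rw [Real.sqrt_lt' (rPlus_pos hl hp)]; exact h1
    obtain ⟨r, hr1, hr2⟩ := exists_between (max_lt h2 h3)
    have h4 : rMinus l p < r := lt_of_le_of_lt (le_max_left _ _) hr1
    have h5 : Real.sqrt (spin l p * l) < r := lt_of_le_of_lt (le_max_right _ _) hr1
    have h6 : 0 < r := (rMinus_pos hl hp).trans h4
    exact ⟨r, h6, (Real.sqrt_lt' h6).1 h5, (Delta_neg_iff hl hp r).2 ⟨h4, hr2⟩⟩
  · rintro ⟨h1, h2, h3, r, hr, har, hD⟩
    have ha : 0 < spin l p := by unfold spin; positivity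
    have hc := continuous_Delta_right l p
    obtain ⟨r₁, hr₁, hz₁⟩ := intermediate_value_Icc' hr.le hc.continuousOn
      (show (0 : ℝ) ∈ Icc (Delta l p r) (Delta l p 0) by
        rw [Delta_zero]; exact ⟨hD.le, by positivity⟩)
    obtain ⟨N, hN, hNp⟩ := exists_Delta_pos hl p r
    obtain ⟨r₂, hr₂, hz₂⟩ := intermediate_value_Icc hN.le hc.continuousOn
      (show (0 : ℝ) ∈ Icc (Delta l p r) (Delta l p N) from ⟨hD.le, hNp.le⟩)
    have h01 : 0 < r₁ := lt_of_le_of_ne hr₁.1 (by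
      rintro rfl; rw [Delta_zero] at hz₁; exact ha.ne' (pow_eq_zero_iff two_ne_zero |>.1 hz₁))
    have h1r : r₁ < r := lt_of_le_of_ne hr₁.2 (by rintro rfl; exact hD.ne hz₁)
    have h2r : r < r₂ := lt_of_le_of_ne hr₂.1 (by rintro rfl; exact hD.ne hz₂)
    refine ⟨h1, h2, ⟨ha, h3, r₁, r₂, h01, h1r.trans h2r, hz₁, hz₂⟩, ?_⟩
    rw [rPlus_eq hl (h1r.trans h2r) hz₁ hz₂]
    nlinarith

lemma isOpen_paramSpace (hl : 0 < l) : IsOpen (paramSpace l) := by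
  have h : paramSpace l = ⋃ r : ℝ, {p : ℝ × ℝ | 0 < p.1 ∧ 0 < p.2 ∧ spin l p < l ∧ 0 < r ∧
      spin l p * l < r ^ 2 ∧ Delta l p r < 0} := by
    ext p; rw [mem_paramSpace_iff hl]; simp only [mem_iUnion, mem_ofPred_eq]
    tauto
  rw [h]
  refine isOpen_iUnion fun r => ?_
  have hs := continuous_spin l
  have hD : Continuous fun p => Delta l p r := by unfold Delta mass spin; fun_prop
  exact (isOpen_lt continuous_const continuous_fst).and <|
    (isOpen_lt continuous_const continuous_snd).and <|
    (isOpen_lt hs continuous_const).and <|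
    (isOpen_const (p := 0 < r)).and <|
    (isOpen_lt (hs.mul continuous_const) continuous_const).and (isOpen_lt hD continuous_const)

lemma Delta_pos_iff (hl : 0 < l) (hp : p ∈ paramSpace l) (r : ℝ) :
    0 < Delta l p r ↔ r < rMinus l p ∨ rPlus l p < r := by
  constructor
  · intro h
    by_contra! h'
    rcases h'.1.lt_or_eq with h1 | h1
    · rcases h'.2.lt_or_eq with h2 | h2
      · exact absurd ((Delta_neg_iff hl hp r).2 ⟨h1, h2⟩) (by linarith)
      · rw [h2, Delta_rPlus hl hp] at h; exact h.false
    · rw [← h1, Delta_rMinus hl hp] at h; exact h.false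
  · rintro (h | h)
    · rw [Delta_factor hl (rMinus_lt_rPlus hl hp).ne (Delta_rMinus hl hp) (Delta_rPlus hl hp) r]
      have := Delta_factor_pos (a := spin l p) (r₁ := rMinus l p) (r₂ := rPlus l p) hl r
      have h2 := rMinus_lt_rPlus hl hp
      exact div_pos (mul_pos (mul_pos_of_neg_of_neg (by linarith) (by linarith)) this)
        (by positivity)
    · exact Delta_pos hl hp h

/-- At a fixed radius the strict sign of Δ persists under perturbation of the parameters, and this
sign locates the radius relative to the two horizons. An intermediate t between the horizons
excludes that c > r₊ falls to the left of r₋ for nearby parameters. -/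
lemma continuousOn_rPlus (hl : 0 < l) : ContinuousOn (rPlus l) (paramSpace l) := by
  intro p hp
  refine ContinuousAt.continuousWithinAt ?_
  have hev : ∀ᶠ q in 𝓝 p, q ∈ paramSpace l := (isOpen_paramSpace hl).mem_nhds hp
  have hD : ∀ r, Continuous fun p => Delta l p r := fun r => by unfold Delta mass spin; fun_prop
  have key : ∀ r, rMinus l p < r → r < rPlus l p →
      ∀ᶠ q in 𝓝 p, rMinus l q < r ∧ r < rPlus l q := by
    intro r h1 h2
    filter_upwards [hev, (hD r).continuousAt.eventually_lt_const
      ((Delta_neg_iff hl hp r).2 ⟨h1, h2⟩)] with q hq h3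
    exact (Delta_neg_iff hl hq r).1 h3
  obtain ⟨t, ht1, ht2⟩ := exists_between (rMinus_lt_rPlus hl hp)
  refine tendsto_order.2 ⟨fun c hc => ?_, fun c hc => ?_⟩
  · obtain ⟨r, hr1, hr2⟩ := exists_between (max_lt hc (rMinus_lt_rPlus hl hp))
    filter_upwards [key r (lt_of_le_of_lt (le_max_right _ _) hr1) hr2] with q hq
    exact (lt_of_le_of_lt (le_max_left _ _) hr1).trans hq.2
  · filter_upwards [hev, key t ht1 ht2, (hD c).continuousAt.eventually_const_lt
      (Delta_pos hl hp hc)] with q hq h1 h2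
    rcases (Delta_pos_iff hl hq c).1 h2 with h | h
    · linarith [h1.1]
    · exact h

lemma continuousOn_rMinus (hl : 0 < l) : ContinuousOn (rMinus l) (paramSpace l) := by
  intro p hp
  refine ContinuousAt.continuousWithinAt ?_
  have hev : ∀ᶠ q in 𝓝 p, q ∈ paramSpace l := (isOpen_paramSpace hl).mem_nhds hp
  have hD : ∀ r, Continuous fun p => Delta l p r := fun r => by unfold Delta mass spin; fun_prop
  have key : ∀ r, rMinus l p < r → r < rPlus l p →
      ∀ᶠ q in 𝓝 p, rMinus l q < r ∧ r < rPlus l q := by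
    intro r h1 h2
    filter_upwards [hev, (hD r).continuousAt.eventually_lt_const
      ((Delta_neg_iff hl hp r).2 ⟨h1, h2⟩)] with q hq h3
    exact (Delta_neg_iff hl hq r).1 h3
  obtain ⟨t, ht1, ht2⟩ := exists_between (rMinus_lt_rPlus hl hp)
  refine tendsto_order.2 ⟨fun c hc => ?_, fun c hc => ?_⟩
  · filter_upwards [hev, key t ht1 ht2, (hD c).continuousAt.eventually_const_lt
      ((Delta_pos_iff hl hp c).2 (Or.inl hc))] with q hq h1 h2
    rcases (Delta_pos_iff hl hq c).1 h2 with h | h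
    · exact h
    · linarith [h1.2]
  · obtain ⟨r, hr1, hr2⟩ := exists_between (lt_min hc (rMinus_lt_rPlus hl hp))
    filter_upwards [key r hr1 (lt_of_lt_of_le hr2 (min_le_right _ _))] with q hq
    exact hq.1.trans (lt_of_lt_of_le hr2 (min_le_left _ _))

/-! ### The coordinates -/

lemma theta_eq_div (hp : p ∈ paramSpace l) :
    theta l p = Xi l p * spin l p ^ 2 / (rMinus l p ^ 2 + spin l p ^ 2) := by
  have := spin_pos hp
  unfold theta Xi; field_simp; ring

lemma theta_eq (hp : p ∈ paramSpace l) : theta l p = spin l p * omegaMinus l p := by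
  rw [theta_eq_div hp, omegaMinus, omegaAt]; ring

lemma theta_pos (hp : p ∈ paramSpace l) : 0 < theta l p := by
  have := spin_pos hp
  have := Xi_pos hp
  rw [theta_eq_div hp]; positivity

lemma omegaMinus_pos (hp : p ∈ paramSpace l) : 0 < omegaMinus l p := by
  have := spin_pos hp
  have := Xi_pos hp
  rw [omegaMinus, omegaAt]; positivity

lemma theta_lt_one (hl : 0 < l) (hp : p ∈ paramSpace l) : theta l p < 1 := by
  have h1 := spin_pos hp
  have h2 := Xi_pos hp
  have h3 := rMinus_pos hl hp
  have h4 : Xi l p ≤ 1 := by unfold Xi; linarith [show 0 ≤ spin l p ^ 2 / l ^ 2 by positivity]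
  rw [theta_eq_div hp, div_lt_one (by positivity)]
  nlinarith [sq_nonneg (rMinus l p), pow_pos h1 2, pow_pos h3 2]

/-- The mass for which `t` is a root of `Δ`. -/
def massOfRoot (l a t : ℝ) : ℝ := (a ^ 2 + t ^ 2) * (1 + t ^ 2 / l ^ 2) / (2 * t)

lemma Delta_eq_zero_iff {t : ℝ} (ht : t ≠ 0) :
    Delta l p t = 0 ↔ mass l p = massOfRoot l (spin l p) t := by
  unfold Delta massOfRoot
  rw [eq_div_iff (by simpa using ht)]
  constructor <;> intro h <;> linear_combination -h

lemma mass_eq (hl : 0 < l) (hp : p ∈ paramSpace l) :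
    mass l p = massOfRoot l (spin l p) (rMinus l p) :=
  (Delta_eq_zero_iff (rMinus_pos hl hp).ne').1 (Delta_rMinus hl hp)

lemma mass_inj (hl : 0 < l) {p q : ℝ × ℝ} : mass l p = mass l q ↔ p.1 = q.1 := by
  unfold mass
  have : (0:ℝ) < Real.sqrt 3 := by positivity
  rw [div_left_inj' this.ne', mul_left_inj' hl.ne']

lemma spin_eq_of_snd {p q : ℝ × ℝ} (h : p.2 = q.2) : spin l p = spin l q := by
  unfold spin; rw [h]

lemma Xi_eq_of_snd {p q : ℝ × ℝ} (h : p.2 = q.2) : Xi l p = Xi l q := by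
  unfold Xi; rw [spin_eq_of_snd h]

/-- At fixed 𝔞 the value of ϑ determines r₋² and hence r₋ > 0. The mass is then read off from Δ(r₋)
= 0. -/
lemma coord_injOn (hl : 0 < l) : InjOn (coord l) (paramSpace l) := by
  intro p hp q hq h
  have h2 : p.2 = q.2 := (Prod.ext_iff.1 h).2
  have h1 : theta l p = theta l q := (Prod.ext_iff.1 h).1
  have ha := spin_pos hp
  have hX := Xi_pos hp
  have hs := spin_eq_of_snd (l := l) h2
  have hr : rMinus l p = rMinus l q := by
    rw [theta_eq_div hp, theta_eq_div hq, ← Xi_eq_of_snd h2, ← hs] at h1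
    rw [div_eq_div_iff (by positivity) (by positivity)] at h1
    have := mul_left_cancel₀ (by positivity) h1
    have h3 : rMinus l p ^ 2 = rMinus l q ^ 2 := by linarith
    exact (pow_left_inj₀ (rMinus_pos hl hp).le (rMinus_pos hl hq).le two_ne_zero).1 h3
  refine Prod.ext ((mass_inj hl).1 ?_) h2
  rw [mass_eq hl hp, mass_eq hl hq, hr, hs]

lemma coordInv_eq (hl : 0 < l) {s 𝔞 : ℝ} (hp : p ∈ paramSpace l) (h : coord l p = (s, 𝔞)) :
    coordInv l s 𝔞 = p := by
  have hex : ∃ q ∈ paramSpace l, coord l q = (s, 𝔞) := ⟨p, hp, h⟩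
  exact coord_injOn hl (Function.invFunOn_mem hex) hp ((Function.invFunOn_eq hex).trans h.symm)

lemma flow_eq (hl : 0 < l) {τ : ℝ} {q : ℝ × ℝ} (hq : q ∈ paramSpace l) (h2 : q.2 = p.2)
    (h1 : theta l q = theta l p + τ) : flow l τ p = q :=
  coordInv_eq hl hq (by rw [coord, h1, h2])

end

section
variable {l : ℝ}

/-! ### Lines of constant spin in a closed square -/

lemma massOfRoot_sub {a t t' : ℝ} (hl : 0 < l) (ht : 0 < t) (ht' : 0 < t') :
    massOfRoot l a t - massOfRoot l a t' =
      (t - t') * (((t ^ 2 + t * t' + t' ^ 2) / l ^ 2 + (1 + a ^ 2 / l ^ 2) - a ^ 2 / (t * t')) / 2)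
      := by
  unfold massOfRoot; field_simp; ring

/-- In 2 M r₋ = (a² + r₋²)(1 + r₋²/l²), bounding the right side below by r₋² gives this upper bound.
Bounding it below by a² gives the lower bound of the next lemma. -/
lemma rMinus_le {p : ℝ × ℝ} (hl : 0 < l) (hp : p ∈ paramSpace l) : rMinus l p ≤ 2 * mass l p := by
  have h := rMinus_pos hl hp
  rw [mass_eq hl hp, massOfRoot, mul_div_assoc', le_div_iff₀ (by positivity)]
  have : rMinus l p ^ 2 * 1 ≤
      (spin l p ^ 2 + rMinus l p ^ 2) * (1 + rMinus l p ^ 2 / l ^ 2) := by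
    gcongr
    · nlinarith [sq_nonneg (spin l p)]
    · linarith [show 0 ≤ rMinus l p ^ 2 / l ^ 2 by positivity]
  nlinarith

lemma le_rMinus {p : ℝ × ℝ} (hl : 0 < l) (hp : p ∈ paramSpace l) :
    spin l p ^ 2 / (2 * mass l p) ≤ rMinus l p := by
  have h := rMinus_pos hl hp
  have hM := mass_pos hl hp
  rw [div_le_iff₀ (by positivity), ]
  have h1 := mass_eq hl hp
  rw [massOfRoot, eq_div_iff (by positivity)] at h1
  have : spin l p ^ 2 * 1 ≤ (spin l p ^ 2 + rMinus l p ^ 2) * (1 + rMinus l p ^ 2 / l ^ 2) := by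
    gcongr
    · nlinarith [sq_nonneg (spin l p)]
    · linarith [show 0 ≤ rMinus l p ^ 2 / l ^ 2 by positivity]
  nlinarith

/-- The radius r₋ is the intermediate variable at fixed 𝔞: the difference quotient of M in r₋ is
bounded above and that of ϑ in r₋ is bounded away from zero. No lower bound on the former is needed.
-/
lemma exists_inverse_lipschitz (hl : 0 < l) {𝔪₁ 𝔞₁ s : ℝ} (hs : 0 < s)
    (hC : Icc 𝔪₁ (𝔪₁ + s) ×ˢ Icc 𝔞₁ (𝔞₁ + s) ⊆ paramSpace l) :
    ∃ K : ℝ, 0 < K ∧ ∀ p ∈ Icc 𝔪₁ (𝔪₁ + s) ×ˢ Icc 𝔞₁ (𝔞₁ + s),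
      ∀ q ∈ Icc 𝔪₁ (𝔪₁ + s) ×ˢ Icc 𝔞₁ (𝔞₁ + s), p.2 = q.2 →
        |p.1 - q.1| ≤ K * |theta l p - theta l q| := by
  -- Spin is smallest at the lower left corner, while mass and spin are largest (so Ξ is smallest)
  -- at the upper right corner. These extremes confine r₋ to [t₀, 2M₁] on the whole square.
  set pl : ℝ × ℝ := (𝔪₁, 𝔞₁)
  set pr : ℝ × ℝ := (𝔪₁ + s, 𝔞₁ + s)
  have hpl : pl ∈ paramSpace l := hC ⟨⟨le_rfl, by simp [pl, hs.le]⟩, ⟨le_rfl, by simp [pl, hs.le]⟩⟩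
  have hpr : pr ∈ paramSpace l := hC ⟨⟨by simp [pr, hs.le], le_rfl⟩, ⟨by simp [pr, hs.le], le_rfl⟩⟩
  set a₀ := spin l pl
  set M₁ := mass l pr
  set t₀ := a₀ ^ 2 / (2 * M₁)
  set Ξ₁ := Xi l pr
  have ha₀ : 0 < a₀ := spin_pos hpl
  have hM₁ : 0 < M₁ := mass_pos hl hpr
  have hΞ₁ : 0 < Ξ₁ := Xi_pos hpr
  have ht₀ : 0 < t₀ := by positivity
  set c := Ξ₁ * a₀ ^ 2 * (2 * t₀) / ((2 * M₁) ^ 2 + l ^ 2) ^ 2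
  set K₁ := (3 * (2 * M₁) ^ 2 / l ^ 2 + 2 + l ^ 2 / t₀ ^ 2) / 2
  have hc : 0 < c := by positivity
  have hK₁ : 0 < K₁ := by positivity
  have h3 : (0 : ℝ) < Real.sqrt 3 := by positivity
  have hsp : ∀ p ∈ Icc 𝔪₁ (𝔪₁ + s) ×ˢ Icc 𝔞₁ (𝔞₁ + s), a₀ ≤ spin l p ∧ spin l p < l ∧
      Ξ₁ ≤ Xi l p ∧ t₀ ≤ rMinus l p ∧ rMinus l p ≤ 2 * M₁ := by
    intro p hp
    have hpP := hC hp
    have h1 : a₀ ≤ spin l p := by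
      simp only [a₀, spin, pl]; gcongr; exact hp.2.1
    have h2 : spin l p ≤ spin l pr := by
      simp only [spin, pr]; gcongr; exact hp.2.2
    have h4 : mass l p ≤ M₁ := by
      simp only [M₁, mass, pr]; gcongr; exact hp.1.2
    have h5 := spin_pos hpP
    refine ⟨h1, spin_lt hpP, ?_, ?_, ?_⟩
    · simp only [Ξ₁, Xi]; gcongr
    · refine le_trans ?_ (le_rMinus hl hpP)
      have := mass_pos hl hpP
      simp only [t₀]; gcongr
    · exact (rMinus_le hl hpP).trans (by linarith)
  refine ⟨Real.sqrt 3 / l * (K₁ / c), by positivity, fun p hp q hq h => ?_⟩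
  obtain ⟨h1, h2, h4, h5, h6⟩ := hsp p hp
  obtain ⟨-, -, -, h5', h6'⟩ := hsp q hq
  have ha : spin l p = spin l q := spin_eq_of_snd h
  have hX : Xi l p = Xi l q := Xi_eq_of_snd h
  set t := rMinus l p
  set t' := rMinus l q
  set a := spin l p
  have ht : 0 < t := by linarith
  have ht' : 0 < t' := by linarith
  have ha0 : 0 < a := by linarith
  have e1 : |mass l p - mass l q| ≤ |t - t'| * K₁ := by
    rw [mass_eq hl (hC hp), mass_eq hl (hC hq), ← ha, massOfRoot_sub hl ht ht', abs_mul]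
    gcongr
    rw [abs_div, abs_two]
    refine div_le_div_of_nonneg_right ?_ zero_le_two
    have b1 : (t ^ 2 + t * t' + t' ^ 2) / l ^ 2 ≤ 3 * (2 * M₁) ^ 2 / l ^ 2 := by
      gcongr
      nlinarith
    have b2 : a ^ 2 / l ^ 2 ≤ 1 := by rw [div_le_one (by positivity)]; nlinarith
    have b3 : a ^ 2 / (t * t') ≤ l ^ 2 / t₀ ^ 2 := by
      gcongr
      rw [sq]; gcongr
    have b4 : 0 ≤ (t ^ 2 + t * t' + t' ^ 2) / l ^ 2 := by positivity
    have b5 : 0 ≤ a ^ 2 / l ^ 2 := by positivity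
    have b6 : 0 ≤ a ^ 2 / (t * t') := by positivity
    rw [abs_le]; constructor <;> linarith
  have e2 : c * |t - t'| ≤ |theta l p - theta l q| := by
    have : theta l p - theta l q =
        (t' - t) * (Xi l p * a ^ 2 * (t + t') / ((t ^ 2 + a ^ 2) * (t' ^ 2 + a ^ 2))) := by
      rw [theta_eq_div (hC hp), theta_eq_div (hC hq), ← ha, ← hX]
      change Xi l p * a ^ 2 / (t ^ 2 + a ^ 2) - Xi l p * a ^ 2 / (t' ^ 2 + a ^ 2) = _
      field_simp; ring
    rw [this, abs_mul, abs_sub_comm t', mul_comm]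
    gcongr
    refine le_trans ?_ (le_abs_self _)
    simp only [c]
    have := Xi_pos (hC hp)
    rw [sq (_ + l ^ 2)]
    gcongr
    linarith
  have e3 : p.1 - q.1 = Real.sqrt 3 / l * (mass l p - mass l q) := by
    unfold mass; field_simp
  rw [e3, abs_mul, abs_of_pos (by positivity), mul_assoc]
  gcongr
  have : |t - t'| ≤ |theta l p - theta l q| / c := by rw [le_div_iff₀ hc]; linarith
  calc _ ≤ |t - t'| * K₁ := e1
    _ ≤ |theta l p - theta l q| / c * K₁ := by gcongr
    _ = _ := by ring

/-! ### Clustering along lines of constant spin -/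

/-- The points of the domain of `𝔚₂` where it is small; the resonant set selects isolated
clusters of it. -/
def smallSet (l : ℝ) (ε : ℝ × ℝ → ℝ) (m ℓ : ℕ) : Set (ℝ × ℝ) :=
  {p | p ∈ paramSpace l ∧ sigmaOne l p < lamMinus l p m ℓ / (m : ℝ) ^ 2 ∧
    lamMinus l p m ℓ / (m : ℝ) ^ 2 < sigmaTwo l p ∧
    ‖wTwo l ε m ℓ p‖ < Real.exp (-(ℓ : ℝ)) * Real.exp (-(m : ℝ))}

lemma resonantSet_subset_smallSet (l : ℝ) (ε : ℝ × ℝ → ℝ) (m ℓ : ℕ) :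
    resonantSet l ε m ℓ ⊆ smallSet l ε m ℓ := fun _ hp =>
  ⟨hp.1, hp.2.2.1, hp.2.2.2.1, hp.2.2.2.2.1⟩

/-- The flow for time τ = ϑ(q) - ϑ(p) carries p to q. If |τ| were at least the threshold, the last
condition defining the resonant set at p would make 𝔚₂ large at q. Only smallness at q is used, not
resonance; this is what lets a measurable superset inherit the estimate. -/
lemma resonant_gap (hl : 0 < l) {ε : ℝ × ℝ → ℝ} {m ℓ : ℕ} {p q : ℝ × ℝ}
    (hp : p ∈ resonantSet l ε m ℓ) (hq : q ∈ smallSet l ε m ℓ) (h : p.2 = q.2)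
    (hd : |theta l q - theta l p| ≤ 1 / (m : ℝ) ^ 2) :
    |theta l q - theta l p| < Real.exp (-(ℓ : ℝ)) * Real.exp (-(m : ℝ)) := by
  by_contra! hcon
  have hfl : flow l (theta l q - theta l p) p = q :=
    flow_eq hl hq.1 h.symm (by ring)
  have := hp.2.2.2.2.2.2 (theta l q - theta l p) ⟨hcon, hd⟩
    ⟨q, hq.1, by simp [coord, h]⟩ (by rw [hfl]; exact ⟨hq.1, hq.2.1.le, hq.2.2.1.le⟩)
  rw [hfl] at this
  exact absurd hq.2.2.2 (not_lt.2 this.le)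

lemma abs_sub_le_of_floor_eq {x y : ℝ} {m : ℕ} (hm : 1 ≤ m)
    (h : ⌊x * (m : ℝ) ^ 2⌋₊ = ⌊y * (m : ℝ) ^ 2⌋₊) (hx : 0 < x) (hy : 0 < y) :
    |x - y| ≤ 1 / (m : ℝ) ^ 2 := by
  have hm' : (0 : ℝ) < (m : ℝ) ^ 2 := by
    have : (1 : ℝ) ≤ m := by exact_mod_cast hm
    positivity
  have h1 := Nat.floor_le (show 0 ≤ x * (m : ℝ) ^ 2 by positivity)
  have h2 := Nat.floor_le (show 0 ≤ y * (m : ℝ) ^ 2 by positivity)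
  have h3 := Nat.lt_floor_add_one (x * (m : ℝ) ^ 2)
  have h4 := Nat.lt_floor_add_one (y * (m : ℝ) ^ 2)
  rw [h] at h1 h3
  rw [le_div_iff₀ hm', show |x - y| * (m : ℝ) ^ 2 = |(x - y) * (m : ℝ) ^ 2| by
    rw [abs_mul, abs_of_pos hm'], abs_le]
  constructor <;> nlinarith

lemma floor_theta_lt (hl : 0 < l) {p : ℝ × ℝ} (hp : p ∈ paramSpace l) {m : ℕ} (hm : 1 ≤ m) :
    ⌊theta l p * (m : ℝ) ^ 2⌋₊ < m ^ 2 := by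
  have hm' : (0 : ℝ) < (m : ℝ) ^ 2 := by
    have : (1 : ℝ) ≤ m := by exact_mod_cast hm
    positivity
  rw [Nat.floor_lt (by have := theta_pos hp; positivity)]
  push_cast
  nlinarith [theta_lt_one hl hp]

/-- Points of one line in the same ϑ-cell of length m⁻² fall under `resonant_gap`, so they are
exponentially close in ϑ and, by the Lipschitz bound, in 𝔪. The range 0 < ϑ < 1 allows only m²
cells. -/
lemma resonant_slices (hl : 0 < l) {ε : ℝ × ℝ → ℝ} {C : Set (ℝ × ℝ)} {K : ℝ} (hK : 0 < K)
    (hLip : ∀ p ∈ C, ∀ q ∈ C, p.2 = q.2 → |p.1 - q.1| ≤ K * |theta l p - theta l q|)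
    {m ℓ : ℕ} (hm : 1 ≤ m) (𝔞 : ℝ) :
    ∃ 𝒮 : Finset (Set (ℝ × ℝ)), 𝒮.card ≤ m ^ 2 ∧
      (∀ S ∈ 𝒮, Bornology.IsBounded S ∧ Metric.diam S ≤ K * Real.exp (-(ℓ : ℝ) - (m : ℝ))) ∧
      resonantSet l ε m ℓ ∩ C ∩ {p : ℝ × ℝ | p.2 = 𝔞} = ⋃ S ∈ 𝒮, S := by
  classical
  set A := resonantSet l ε m ℓ ∩ C ∩ {p : ℝ × ℝ | p.2 = 𝔞} with hA
  set cell : ℕ → Set (ℝ × ℝ) := fun i => {p ∈ A | ⌊theta l p * (m : ℝ) ^ 2⌋₊ = i}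
  refine ⟨(Finset.range (m ^ 2)).image cell, ?_, ?_, ?_⟩
  · exact Finset.card_image_le.trans (by simp)
  · intro S hS
    obtain ⟨i, -, rfl⟩ := Finset.mem_image.1 hS
    have hd : ∀ p ∈ cell i, ∀ q ∈ cell i,
        dist p q ≤ K * Real.exp (-(ℓ : ℝ) - (m : ℝ)) := by
      rintro p ⟨⟨⟨hpU, hpC⟩, hp2⟩, hpi⟩ q ⟨⟨⟨hqU, hqC⟩, hq2⟩, hqi⟩
      have h2 : p.2 = q.2 := Eq.trans hp2 (Eq.symm hq2)
      have h1 := hLip p hpC q hqC h2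
      have h3 := resonant_gap hl hqU (resonantSet_subset_smallSet _ _ _ _ hpU) h2.symm
        (abs_sub_le_of_floor_eq hm (hpi.trans hqi.symm) (theta_pos hpU.1) (theta_pos hqU.1))
      rw [Prod.dist_eq, h2, dist_self, Real.dist_eq, max_eq_left (abs_nonneg _),
        sub_eq_add_neg (-(ℓ : ℝ)), Real.exp_add]
      exact h1.trans (by gcongr)
    exact ⟨Metric.isBounded_iff.2 ⟨_, fun p hp q hq => hd p hp q hq⟩,
      Metric.diam_le_of_forall_dist_le (by positivity) hd⟩
  · ext p
    simp only [Finset.mem_image, Finset.mem_range, iUnion_exists, biUnion_and', iUnion_iUnion_eq_right,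
      mem_iUnion, exists_prop]
    constructor
    · intro hp
      exact ⟨_, floor_theta_lt hl hp.1.1.1 hm, hp, rfl⟩
    · rintro ⟨i, -, hp⟩
      exact hp.1

/-! ### The area of the resonant sets and the measure of the blow-up set -/

lemma measurable_indicator_theta (hl : 0 < l) :
    Measurable ((paramSpace l).indicator (theta l)) := by
  have hc : ContinuousOn (theta l) (paramSpace l) := by
    have h1 := continuousOn_rMinus hl
    have h2 := continuous_spin l
    unfold theta
    refine ContinuousOn.div (by fun_prop) ?_ ?_
    · refine continuousOn_const.add (ContinuousOn.div (h1.pow 2) (by fun_prop) ?_)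
      intro p hp; have := spin_pos hp; positivity
    · intro p hp; have := spin_pos hp; positivity
  classical
  rw [← piecewise_eq_indicator]
  exact hc.measurable_piecewise continuousOn_const (isOpen_paramSpace hl).measurableSet

/-- Tonelli is applied to a measurable superset, because no measurability of the resonant set itself
is available. Measurability is required only of `smallSet`. -/
lemma volume_resonant_le (hl : 0 < l) {ε : ℝ × ℝ → ℝ} {𝔪₁ 𝔞₁ s : ℝ} {K : ℝ}
    (hK : 0 < K)
    (hLip : ∀ p ∈ Icc 𝔪₁ (𝔪₁ + s) ×ˢ Icc 𝔞₁ (𝔞₁ + s),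
      ∀ q ∈ Icc 𝔪₁ (𝔪₁ + s) ×ˢ Icc 𝔞₁ (𝔞₁ + s), p.2 = q.2 →
        |p.1 - q.1| ≤ K * |theta l p - theta l q|)
    {m ℓ : ℕ} (hm : 1 ≤ m) (hB : MeasurableSet (smallSet l ε m ℓ)) :
    volume (resonantSet l ε m ℓ ∩ Icc 𝔪₁ (𝔪₁ + s) ×ˢ Icc 𝔞₁ (𝔞₁ + s)) ≤
      ENNReal.ofReal (s * (2 * K) * (m : ℝ) ^ 2 * Real.exp (-(ℓ : ℝ) - (m : ℝ))) := by
  set C := Icc 𝔪₁ (𝔪₁ + s) ×ˢ Icc 𝔞₁ (𝔞₁ + s)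
  set δ := Real.exp (-(ℓ : ℝ) - (m : ℝ)) with hδ
  have hδ' : Real.exp (-(ℓ : ℝ)) * Real.exp (-(m : ℝ)) = δ := by
    rw [hδ, ← Real.exp_add]; rfl
  have hδ0 : 0 < δ := Real.exp_pos _
  set B := smallSet l ε m ℓ ∩ C with hBdef
  have hBm : MeasurableSet B := hB.inter (measurableSet_Icc.prod measurableSet_Icc)
  set θ := (paramSpace l).indicator (theta l) with hθ
  have hθm : Measurable θ := measurable_indicator_theta hl
  have hθB : ∀ p ∈ B, θ p = theta l p := fun p hp => indicator_of_mem hp.1.1 _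
  -- The forbidden pairs: a point p, and a point of B on its line at ϑ-distance between δ and m⁻².
  -- For resonant p the fibre is empty.
  set G : Set ((ℝ × ℝ) × ℝ) := {x | (x.2, x.1.2) ∈ B ∧ δ ≤ |θ (x.2, x.1.2) - θ x.1| ∧
    |θ (x.2, x.1.2) - θ x.1| ≤ 1 / (m : ℝ) ^ 2} with hG
  have hsw : Measurable fun x : (ℝ × ℝ) × ℝ => (x.2, x.1.2) := by fun_prop
  have hab : Measurable fun x : (ℝ × ℝ) × ℝ => |θ (x.2, x.1.2) - θ x.1| :=
    ((hθm.comp hsw).sub (hθm.comp measurable_fst)).abs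
  have hGm : MeasurableSet G := (hsw hBm).inter
    ((measurableSet_le measurable_const hab).inter (measurableSet_le hab measurable_const))
  -- Demanding a null fibre rather than an empty one keeps the condition measurable, since fibre
  -- measures of a measurable set depend measurably on the base point.
  set U := B ∩ {p | volume (Prod.mk p ⁻¹' G) = 0}
  have hUm : MeasurableSet U :=
    hBm.inter (measurable_measure_prodMk_left hGm (measurableSet_singleton 0))
  have hsub : resonantSet l ε m ℓ ∩ C ⊆ U := by
    intro p hp
    refine ⟨⟨resonantSet_subset_smallSet _ _ _ _ hp.1, hp.2⟩, ?_⟩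
    change volume _ = 0
    convert measure_empty (μ := (volume : Measure ℝ))
    refine eq_empty_of_forall_notMem fun x hx => ?_
    obtain ⟨h1, h2, h3⟩ : (x, p.2) ∈ B ∧ δ ≤ |θ (x, p.2) - θ p| ∧
      |θ (x, p.2) - θ p| ≤ 1 / (m : ℝ) ^ 2 := hx
    rw [hθB _ h1, hθ, indicator_of_mem hp.1.1] at h2 h3
    exact absurd (resonant_gap hl hp.1 h1.1 rfl h3) (by rw [hδ']; exact not_lt.2 h2)
  have hcell : ∀ (y : ℝ) (i : ℕ),
      volume {x : ℝ | (x, y) ∈ U ∧ ⌊theta l (x, y) * (m : ℝ) ^ 2⌋₊ = i} ≤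
        ENNReal.ofReal (2 * K * δ) := by
    intro y i
    rcases eq_empty_or_nonempty {x : ℝ | (x, y) ∈ U ∧ ⌊theta l (x, y) * (m : ℝ) ^ 2⌋₊ = i} with
      he | ⟨x₀, hx₀, hi₀⟩
    · rw [he]; simp
    -- Points of the cell closer than δ to x₀ in ϑ lie within Kδ of it in 𝔪. All others belong to
    -- the fibre of G over (x₀, y), which is null because (x₀, y) is in U.
    · have hss : {x : ℝ | (x, y) ∈ U ∧ ⌊theta l (x, y) * (m : ℝ) ^ 2⌋₊ = i} ⊆
          Icc (x₀ - K * δ) (x₀ + K * δ) ∪ Prod.mk (x₀, y) ⁻¹' G := by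
        rintro x ⟨hx, hi⟩
        have hd := abs_sub_le_of_floor_eq hm (hi.trans hi₀.symm) (theta_pos hx.1.1.1)
          (theta_pos hx₀.1.1.1)
        by_cases hlt : |theta l (x, y) - theta l (x₀, y)| < δ
        · left
          have h1 := hLip _ hx.1.2 _ hx₀.1.2 rfl
          have h2 : |x - x₀| ≤ K * δ := h1.trans (by gcongr)
          rw [abs_le] at h2
          exact ⟨by linarith [h2.1], by linarith [h2.2]⟩
        · right
          refine ⟨hx.1, ?_⟩
          change δ ≤ |θ (x, y) - θ (x₀, y)| ∧ |θ (x, y) - θ (x₀, y)| ≤ 1 / (m : ℝ) ^ 2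
          rw [hθB _ hx.1, hθB _ hx₀.1]
          exact ⟨not_lt.1 hlt, hd⟩
      calc _ ≤ volume (Icc (x₀ - K * δ) (x₀ + K * δ) ∪ Prod.mk (x₀, y) ⁻¹' G) := measure_mono hss
        _ ≤ volume (Icc (x₀ - K * δ) (x₀ + K * δ)) + volume (Prod.mk (x₀, y) ⁻¹' G) :=
          measure_union_le _ _
        _ = ENNReal.ofReal (2 * K * δ) := by
          rw [show volume (Prod.mk (x₀, y) ⁻¹' G) = 0 from hx₀.2, add_zero, Real.volume_Icc]
          congr 1; ring
  have hslice : ∀ y, volume ((fun x => (x, y)) ⁻¹' U) ≤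
      (Icc 𝔞₁ (𝔞₁ + s)).indicator
        (fun _ => ENNReal.ofReal (2 * K * (m : ℝ) ^ 2 * δ)) y := by
    intro y
    by_cases hy : y ∈ Icc 𝔞₁ (𝔞₁ + s)
    · rw [indicator_of_mem hy]
      have hss : (fun x => (x, y)) ⁻¹' U ⊆ ⋃ i ∈ Finset.range (m ^ 2),
          {x : ℝ | (x, y) ∈ U ∧ ⌊theta l (x, y) * (m : ℝ) ^ 2⌋₊ = i} := by
        intro x hx
        have hx' : (x, y) ∈ U := hx
        simp only [mem_iUnion, Finset.mem_range]
        exact ⟨_, floor_theta_lt hl hx'.1.1.1 hm, hx', rfl⟩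
      calc _ ≤ _ := measure_mono hss
        _ ≤ _ := measure_biUnion_finset_le _ _
        _ ≤ ∑ i ∈ Finset.range (m ^ 2), ENNReal.ofReal (2 * K * δ) :=
          Finset.sum_le_sum fun i _ => hcell y i
        _ = _ := by
          rw [Finset.sum_const, Finset.card_range, nsmul_eq_mul,
            ← ENNReal.ofReal_natCast, ← ENNReal.ofReal_mul (by positivity)]
          congr 1; push_cast; ring
    · have : (fun x => (x, y)) ⁻¹' U = ∅ :=
        eq_empty_of_forall_notMem fun x hx => hy (show (x, y) ∈ U from hx).1.2.2
      rw [this]; simp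
  calc _ ≤ volume U := measure_mono hsub
    _ = ∫⁻ y, volume ((fun x => (x, y)) ⁻¹' U) := by
      rw [Measure.volume_eq_prod, Measure.prod_apply_symm hUm]
    _ ≤ ∫⁻ y, (Icc 𝔞₁ (𝔞₁ + s)).indicator
        (fun _ => ENNReal.ofReal (2 * K * (m : ℝ) ^ 2 * δ)) y := lintegral_mono hslice
    _ = _ := by
      rw [lintegral_indicator_const measurableSet_Icc, Real.volume_Icc,
        ← ENNReal.ofReal_mul (by positivity)]
      congr 1; ring

lemma exists_square_nhds {p : ℝ × ℝ} {O : Set (ℝ × ℝ)} (hO : IsOpen O) (hp : p ∈ O) :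
    ∃ x y s : ℚ, 0 < s ∧ p ∈ Icc (x : ℝ) (x + s) ×ˢ Icc (y : ℝ) (y + s) ∧
      Icc (x : ℝ) (x + s) ×ˢ Icc (y : ℝ) (y + s) ⊆ O := by
  obtain ⟨r, hr, hball⟩ := Metric.isOpen_iff.1 hO p hp
  obtain ⟨s, hs0, hsr⟩ := exists_rat_btwn hr
  obtain ⟨x, hx1, hx2⟩ := exists_rat_btwn (show p.1 - s < p.1 by linarith)
  obtain ⟨y, hy1, hy2⟩ := exists_rat_btwn (show p.2 - s < p.2 by linarith)
  refine ⟨x, y, s, by exact_mod_cast hs0,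
    ⟨⟨hx2.le, by linarith⟩, ⟨hy2.le, by linarith⟩⟩, fun q hq => hball ?_⟩
  rw [Metric.mem_ball, Prod.dist_eq, max_lt_iff, Real.dist_eq, Real.dist_eq, abs_lt, abs_lt]
  obtain ⟨⟨h1, h2⟩, ⟨h3, h4⟩⟩ := hq
  refine ⟨⟨?_, ?_⟩, ⟨?_, ?_⟩⟩ <;> linarith

/-- Borel–Cantelli on each square: the union over m ≤ ℓ ≤ m² has area O(m⁴ e^{-m}), which is
summable. Squares with rational data cover the open set 𝒫, and there are countably many. -/
lemma volume_blowUpSet (hl : 0 < l) {ε : ℝ × ℝ → ℝ}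
    (hB : ∀ m ℓ : ℕ, 1 ≤ m → MeasurableSet (smallSet l ε m ℓ)) :
    volume (blowUpSet l ε) = 0 := by
  have hsq : ∀ x y s : ℝ, 0 < s → Icc x (x + s) ×ˢ Icc y (y + s) ⊆ paramSpace l →
      volume (blowUpSet l ε ∩ Icc x (x + s) ×ˢ Icc y (y + s)) = 0 := by
    intro x y s hs hC
    obtain ⟨K, hK, hLip⟩ := exists_inverse_lipschitz hl hs hC
    set C := Icc x (x + s) ×ˢ Icc y (y + s)
    set V : ℕ → Set (ℝ × ℝ) := fun m => ⋃ ℓ ∈ Finset.Icc m (m ^ 2), resonantSet l ε m ℓ ∩ C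
    have hV : ∀ m, 1 ≤ m → volume (V m) ≤
        ENNReal.ofReal (s * (2 * K) * ((m : ℝ) ^ 4 * Real.exp (-1 * (m : ℝ)))) := by
      intro m hm
      calc _ ≤ _ := measure_biUnion_finset_le _ _
        _ ≤ ∑ ℓ ∈ Finset.Icc m (m ^ 2),
            ENNReal.ofReal (s * (2 * K) * (m : ℝ) ^ 2 * Real.exp (-1 * (m : ℝ))) := by
          refine Finset.sum_le_sum fun ℓ _ =>
            (volume_resonant_le hl hK hLip hm (hB m ℓ hm)).trans ?_
          gcongr
          linarith [show (0 : ℝ) ≤ ℓ by positivity]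
        _ ≤ ((m ^ 2 : ℕ) : ENNReal) *
            ENNReal.ofReal (s * (2 * K) * (m : ℝ) ^ 2 * Real.exp (-1 * (m : ℝ))) := by
          rw [Finset.sum_const, nsmul_eq_mul]
          gcongr
          -- The number of admissible ℓ is m² + 1 - m, at most m² because m ≥ 1.
          simp only [Nat.card_Icc]
          omega
        _ = _ := by
          rw [← ENNReal.ofReal_natCast, ← ENNReal.ofReal_mul (by positivity)]
          congr 1; push_cast; ring
    have hsum : Summable fun m : ℕ => s * (2 * K) * ((m : ℝ) ^ 4 * Real.exp (-1 * (m : ℝ))) :=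
      (Real.summable_pow_mul_exp_neg_nat_mul 4 one_pos).mul_left _
    -- The index is shifted by one since the area bound is available only for m ≥ 1.
    have hfin : ∑' m, volume (V (m + 1)) ≠ ⊤ := by
      refine ne_top_of_le_ne_top ?_ (ENNReal.tsum_le_tsum fun m => hV (m + 1) (by omega))
      exact ((summable_nat_add_iff 1).2 hsum).tsum_ofReal_ne_top
    have h0 := measure_setOfPred_frequently_eq_zero (p := fun m x => x ∈ V (m + 1)) hfin
    refine measure_mono_null ?_ h0
    rintro p ⟨hp, hpC⟩
    refine frequently_atTop.2 fun n => ?_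
    obtain ⟨m, ℓ, h1, h2, h3, h4⟩ := mem_iInter.1 hp (n + 1)
    refine ⟨m - 1, by omega, ?_⟩
    rw [show m - 1 + 1 = m by omega]
    simp only [V, mem_iUnion, Finset.mem_Icc]
    exact ⟨ℓ, ⟨h2, h3⟩, h4, hpC⟩
  have hcov : blowUpSet l ε ⊆ ⋃ c : {c : ℚ × ℚ × ℚ // 0 < c.2.2 ∧
      Icc (c.1 : ℝ) (c.1 + c.2.2) ×ˢ Icc (c.2.1 : ℝ) (c.2.1 + c.2.2) ⊆ paramSpace l},
      blowUpSet l ε ∩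
        Icc (c.1.1 : ℝ) (c.1.1 + c.1.2.2) ×ˢ Icc (c.1.2.1 : ℝ) (c.1.2.1 + c.1.2.2) := by
    intro p hp
    obtain ⟨m, ℓ, -, -, -, h4⟩ := mem_iInter.1 hp 0
    obtain ⟨x, y, s, hs, hps, hsub⟩ := exists_square_nhds (isOpen_paramSpace hl) h4.1
    exact mem_iUnion.2 ⟨⟨(x, y, s), hs, hsub⟩, hp, hps⟩
  refine measure_mono_null hcov (measure_iUnion_null fun c => ?_)
  exact hsq _ _ _ (by exact_mod_cast c.2.1) c.2.2

end

/-! ### Iterated integrals from a singular endpoint -/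

/-- The operator `g ↦ ∫_{y > x} α(y) ∫_{z > y} β(z) g(z)`. -/
def volterra (α β g : ℝ → ℝ) (x : ℝ) : ℝ := ∫ y in Ioi x, α y * ∫ z in Ioi y, β z * g z

/-- The Neumann series of the equation `u = g + T u`, `T` being the operator `volterra α β`. -/
def volterraSol (α β g : ℝ → ℝ) (x : ℝ) : ℝ := ∑' n : ℕ, (volterra α β)^[n] g x

/-- Bounds for which the Neumann series converges on `(c, ∞)`: `b` dominates `β`, `γ` dominates
the kernel, and `G` behaves like `∫_x^∞ γ`. -/
structure VolterraBound (c : ℝ) (α β b γ G : ℝ → ℝ) (A : ℝ) : Prop where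
  meas_α : Measurable α
  meas_β : Measurable β
  b_int : IntegrableOn b (Ioi c)
  β_le : ∀ y, c < y → |β y| ≤ b y
  kernel : ∀ y, c < y → |α y| * ∫ z in Ioi y, b z ≤ γ y
  γ_int : IntegrableOn γ (Ioi c)
  G_meas : Measurable G
  G_nonneg : ∀ y, 0 ≤ G y
  G_le : ∀ y, c < y → G y ≤ A
  G_anti : AntitoneOn G (Ioi c)
  G_int : ∀ n : ℕ, ∀ x, c < x → ∫ y in Ioi x, γ y * G y ^ n ≤ G x ^ (n + 1) / (n + 1)

/-- The moving endpoint is absorbed into the indicator of {x < y}, which leaves a parametric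
integral of a jointly measurable function. No integrability is needed. -/
lemma measurable_integral_Ioi {Z : Type*} [MeasurableSpace Z] {f : Z → ℝ → ℝ}
    (hf : Measurable (Function.uncurry f)) :
    Measurable fun x : Z × ℝ => ∫ y in Ioi x.2, f x.1 y := by
  have h : (fun x : Z × ℝ => ∫ y in Ioi x.2, f x.1 y) =
      fun x : Z × ℝ => ∫ y, ({q : (Z × ℝ) × ℝ | q.1.2 < q.2}.indicator
        (fun q => f q.1.1 q.2)) (x, y) := by
    funext x
    rw [← integral_indicator measurableSet_Ioi]
    rfl
  rw [h]
  refine (StronglyMeasurable.integral_prod_right' (ν := (volume : Measure ℝ)) ?_).measurable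
  refine (Measurable.indicator ?_ ?_).stronglyMeasurable
  · exact hf.comp ((measurable_fst.comp measurable_fst).prodMk measurable_snd)
  · exact measurableSet_lt (measurable_snd.comp measurable_fst) measurable_snd

lemma measurable_volterra {Z : Type*} [MeasurableSpace Z] {α β g : Z → ℝ → ℝ}
    (hα : Measurable (Function.uncurry α)) (hβ : Measurable (Function.uncurry β))
    (hg : Measurable (Function.uncurry g)) :
    Measurable (Function.uncurry fun z => volterra (α z) (β z) (g z)) := by
  have h1 : Measurable fun x : Z × ℝ => ∫ y in Ioi x.2, β x.1 y * g x.1 y :=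
    measurable_integral_Ioi (f := fun z y => β z y * g z y) (hβ.mul hg)
  exact measurable_integral_Ioi (f := fun z y => α z y * ∫ t in Ioi y, β z t * g z t) (hα.mul h1)

lemma measurable_volterra_iterate {Z : Type*} [MeasurableSpace Z] {α β g : Z → ℝ → ℝ}
    (hα : Measurable (Function.uncurry α)) (hβ : Measurable (Function.uncurry β))
    (hg : Measurable (Function.uncurry g)) (n : ℕ) :
    Measurable (Function.uncurry fun z => (volterra (α z) (β z))^[n] (g z)) := by
  induction n with
  | zero => exact hg
  | succ n ih =>
    simp only [Function.iterate_succ', Function.comp]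
    exact measurable_volterra hα hβ ih

lemma measurable_volterra_iterate_single {α β g : ℝ → ℝ} (hα : Measurable α) (hβ : Measurable β)
    (hg : Measurable g) (n : ℕ) : Measurable ((volterra α β)^[n] g) := by
  have := measurable_volterra_iterate (Z := Unit) (α := fun _ => α) (β := fun _ => β)
    (g := fun _ => g) (hα.comp measurable_snd) (hβ.comp measurable_snd) (hg.comp measurable_snd) n
  exact this.comp (measurable_const.prodMk measurable_id : Measurable fun x : ℝ => ((), x))

namespace VolterraBound

variable {c : ℝ} {α β b γ G : ℝ → ℝ} {A : ℝ} (h : VolterraBound c α β b γ G A)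
include h

lemma b_nonneg {y : ℝ} (hy : c < y) : 0 ≤ b y := (abs_nonneg _).trans (h.β_le y hy)

lemma integrableOn_mul {g : ℝ → ℝ} (hg : Measurable g) {D : ℝ} (hD : ∀ y, c < y → |g y| ≤ D) :
    IntegrableOn (fun z => β z * g z) (Ioi c) := by
  refine Integrable.mono' (h.b_int.mul_const D) (h.meas_β.mul hg).aestronglyMeasurable ?_
  filter_upwards [ae_restrict_mem measurableSet_Ioi] with y hy
  rw [norm_mul]
  exact mul_le_mul (h.β_le y hy) (hD y hy) (norm_nonneg _) (h.b_nonneg hy)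

lemma abs_inner_le {g : ℝ → ℝ} {D y : ℝ} (hy : c < y) (hD : ∀ z, y < z → |g z| ≤ D) :
    |∫ z in Ioi y, β z * g z| ≤ (∫ z in Ioi y, b z) * D := by
  rw [← integral_mul_const, ← Real.norm_eq_abs]
  refine norm_integral_le_of_norm_le
    ((h.b_int.mono_set (Ioi_subset_Ioi hy.le)).mul_const D) ?_
  filter_upwards [ae_restrict_mem measurableSet_Ioi] with z hz
  rw [norm_mul]
  have hz' : c < z := hy.trans hz
  exact mul_le_mul (h.β_le z hz') (hD z hz) (norm_nonneg _) (h.b_nonneg hz')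

lemma abs_kernel_le {g : ℝ → ℝ} {D y : ℝ} (hy : c < y) (hD : ∀ z, y < z → |g z| ≤ D)
    (hD0 : 0 ≤ D) : |α y * ∫ z in Ioi y, β z * g z| ≤ γ y * D := by
  rw [abs_mul]
  calc _ ≤ |α y| * ((∫ z in Ioi y, b z) * D) := by gcongr; exact h.abs_inner_le hy hD
    _ = |α y| * (∫ z in Ioi y, b z) * D := by ring
    _ ≤ γ y * D := by gcongr; exact h.kernel y hy

lemma γ_nonneg {y : ℝ} (hy : c < y) : 0 ≤ γ y :=
  le_trans (mul_nonneg (abs_nonneg _) (setIntegral_nonneg measurableSet_Ioi fun _ hz =>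
    h.b_nonneg (hy.trans hz))) (h.kernel y hy)

lemma integrableOn_kernel {g : ℝ → ℝ} (hg : Measurable g) {D : ℝ}
    (hD : ∀ y, c < y → |g y| ≤ D) (hD0 : 0 ≤ D) :
    IntegrableOn (fun y => α y * ∫ z in Ioi y, β z * g z) (Ioi c) := by
  have hm : Measurable fun y => ∫ z in Ioi y, β z * g z := by
    have := measurable_integral_Ioi (Z := Unit) (f := fun _ z => β z * g z)
      ((h.meas_β.mul hg).comp measurable_snd)
    exact this.comp (measurable_const.prodMk measurable_id : Measurable fun x : ℝ => ((), x))
  refine Integrable.mono' (h.γ_int.mul_const D) (h.meas_α.mul hm).aestronglyMeasurable ?_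
  filter_upwards [ae_restrict_mem measurableSet_Ioi] with y hy
  exact h.abs_kernel_le hy (fun z hz => hD z (lt_trans hy hz)) hD0

lemma integrableOn_γG (n : ℕ) : IntegrableOn (fun y => γ y * G y ^ n) (Ioi c) := by
  refine Integrable.mono' (h.γ_int.mul_const (A ^ n))
    (h.γ_int.aestronglyMeasurable.mul (h.G_meas.pow_const n).aestronglyMeasurable) ?_
  filter_upwards [ae_restrict_mem measurableSet_Ioi] with y hy
  rw [Real.norm_of_nonneg (mul_nonneg (h.γ_nonneg hy) (pow_nonneg (h.G_nonneg y) n))]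
  exact mul_le_mul_of_nonneg_left (pow_le_pow_left₀ (h.G_nonneg y) (h.G_le y hy) n)
    (h.γ_nonneg hy)

/-- This is the step producing factorials. As G is antitone, the inner integral at y sees at most D
G(y)ⁿ/n!; then γ, acting as -G', integrates Gⁿ to Gⁿ⁺¹/(n+1). -/
lemma abs_volterra_le {g : ℝ → ℝ} {D : ℝ} (hD0 : 0 ≤ D) (n : ℕ)
    (hD : ∀ y, c < y → |g y| ≤ D * (G y ^ n / n.factorial)) {x : ℝ} (hx : c < x) :
    |volterra α β g x| ≤ D * (G x ^ (n + 1) / (n + 1).factorial) := by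
  have h1 : |volterra α β g x| ≤ ∫ y in Ioi x, γ y * G y ^ n * (D / n.factorial) := by
    rw [← Real.norm_eq_abs]
    refine norm_integral_le_of_norm_le
      (((h.integrableOn_γG n).mono_set (Ioi_subset_Ioi hx.le)).mul_const _) ?_
    filter_upwards [ae_restrict_mem measurableSet_Ioi] with y hy
    have hy' : c < y := hx.trans hy
    refine (h.abs_kernel_le hy' (D := D * (G y ^ n / n.factorial)) (fun z hz => ?_) ?_).trans
      (le_of_eq ?_)
    · refine (hD z (hy'.trans hz)).trans ?_
      have := h.G_nonneg z
      have := h.G_anti (mem_Ioi.2 hy') (mem_Ioi.2 (hy'.trans hz)) hz.le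
      gcongr
    · have := h.G_nonneg y; positivity
    · ring
  refine h1.trans ?_
  rw [integral_mul_const]
  calc _ ≤ G x ^ (n + 1) / (n + 1) * (D / n.factorial) := by
        gcongr; exact h.G_int n x hx
    _ = _ := by rw [Nat.factorial_succ]; push_cast; field_simp

lemma abs_iterate_le {g : ℝ → ℝ} {D : ℝ} (hD0 : 0 ≤ D) (hD : ∀ y, c < y → |g y| ≤ D)
    (n : ℕ) : ∀ x, c < x → |(volterra α β)^[n] g x| ≤ D * (G x ^ n / n.factorial) := by
  induction n with
  | zero => simpa using hD
  | succ n ih =>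
    intro x hx
    simp only [Function.iterate_succ', Function.comp]
    exact h.abs_volterra_le hD0 n ih hx

lemma abs_iterate_le' {g : ℝ → ℝ} {D : ℝ} (hD0 : 0 ≤ D) (hD : ∀ y, c < y → |g y| ≤ D)
    (n : ℕ) {x : ℝ} (hx : c < x) :
    |(volterra α β)^[n] g x| ≤ D * (A ^ n / n.factorial) := by
  refine (h.abs_iterate_le hD0 hD n x hx).trans ?_
  have := h.G_nonneg x
  have := h.G_le x hx
  gcongr

omit h in
lemma summable_bound (A D : ℝ) : Summable fun n : ℕ => D * (A ^ n / n.factorial) :=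
  (Real.summable_pow_div_factorial A).mul_left D

lemma hasSum_sol {g : ℝ → ℝ} {D : ℝ} (hD0 : 0 ≤ D) (hD : ∀ y, c < y → |g y| ≤ D) {x : ℝ}
    (hx : c < x) : HasSum (fun n => (volterra α β)^[n] g x) (volterraSol α β g x) :=
  (Summable.of_norm_bounded (summable_bound A D)
    (fun n => h.abs_iterate_le' hD0 hD n hx)).hasSum

lemma tendsto_sol {g : ℝ → ℝ} {D : ℝ} (hD0 : 0 ≤ D) (hD : ∀ y, c < y → |g y| ≤ D) {x : ℝ}
    (hx : c < x) : Tendsto (fun N => ∑ n ∈ Finset.range N, (volterra α β)^[n] g x) atTop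
      (𝓝 (volterraSol α β g x)) := (h.hasSum_sol hD0 hD hx).tendsto_sum_nat

lemma abs_partial_le {g : ℝ → ℝ} {D : ℝ} (hD0 : 0 ≤ D) (hD : ∀ y, c < y → |g y| ≤ D) {x : ℝ}
    (hx : c < x) (N : ℕ) :
    |∑ n ∈ Finset.range N, (volterra α β)^[n] g x| ≤ D * Real.exp A := by
  have hA : 0 ≤ A := (h.G_nonneg _).trans (h.G_le _ hx)
  refine (Finset.abs_sum_le_sum_abs _ _).trans ?_
  refine (Finset.sum_le_sum fun n _ => h.abs_iterate_le' hD0 hD n hx).trans ?_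
  rw [← Finset.mul_sum]
  gcongr
  exact Real.sum_le_exp_of_nonneg hA N

lemma abs_sol_le {g : ℝ → ℝ} {D : ℝ} (hD0 : 0 ≤ D) (hD : ∀ y, c < y → |g y| ≤ D) {x : ℝ}
    (hx : c < x) : |volterraSol α β g x| ≤ D * Real.exp A :=
  le_of_tendsto (h.tendsto_sol hD0 hD hx).abs
    (Eventually.of_forall fun N => h.abs_partial_le hD0 hD hx N)

lemma volterra_partial {g : ℝ → ℝ} (hg : Measurable g) {D : ℝ} (hD0 : 0 ≤ D)
    (hD : ∀ y, c < y → |g y| ≤ D) {x : ℝ} (hx : c < x) (N : ℕ) :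
    volterra α β (fun z => ∑ n ∈ Finset.range N, (volterra α β)^[n] g z) x =
      ∑ n ∈ Finset.range N, (volterra α β)^[n + 1] g x := by
  have hm := fun n => measurable_volterra_iterate_single h.meas_α h.meas_β hg n
  have hb : ∀ n y, c < y → |(volterra α β)^[n] g y| ≤ D * (A ^ n / n.factorial) :=
    fun n y hy => h.abs_iterate_le' hD0 hD n hy
  have h0 : ∀ n, 0 ≤ D * (A ^ n / n.factorial) := fun n => (abs_nonneg _).trans (hb n x hx)
  simp only [Function.iterate_succ', Function.comp]
  unfold volterra
  rw [← integral_finsetSum]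
  · refine setIntegral_congr_fun measurableSet_Ioi fun y hy => ?_
    simp only
    rw [← Finset.mul_sum, ← integral_finsetSum]
    · simp only [Finset.mul_sum]
    · intro n _
      exact (h.integrableOn_mul (hm n) (hb n)).mono_set (Ioi_subset_Ioi (hx.trans hy).le)
  · intro n _
    exact (h.integrableOn_kernel (hm n) (hb n) (h0 n)).mono_set (Ioi_subset_Ioi hx.le)

lemma sol_measurableOn {g : ℝ → ℝ} (hg : Measurable g) {D : ℝ} (hD0 : 0 ≤ D)
    (hD : ∀ y, c < y → |g y| ≤ D) :
    Measurable ((Ioi c).indicator (volterraSol α β g)) := by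
  refine measurable_of_tendsto_metrizable (f := fun (N : ℕ) => (Ioi c).indicator
    (fun z => ∑ n ∈ Finset.range N, (volterra α β)^[n] g z)) (fun N => ?_) ?_
  · exact (Finset.measurable_sum _ fun n _ =>
      measurable_volterra_iterate_single h.meas_α h.meas_β hg n).indicator measurableSet_Ioi
  · rw [tendsto_pi_nhds]
    intro x
    by_cases hx : x ∈ Ioi c
    · simp only [indicator_of_mem hx]
      exact h.tendsto_sol hD0 hD hx
    · simp [indicator_of_notMem hx]

/-- The partial sums satisfy S_{N+1} = g + T S_N and are bounded by D e^A uniformly in N. Dominated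
convergence, with majorant b inside and γ outside, passes to the limit under both integrals. -/
lemma sol_eq {g : ℝ → ℝ} (hg : Measurable g) {D : ℝ} (hD0 : 0 ≤ D)
    (hD : ∀ y, c < y → |g y| ≤ D) {x : ℝ} (hx : c < x) :
    volterraSol α β g x = g x + volterra α β (volterraSol α β g) x := by
  set S : ℕ → ℝ → ℝ := fun N z => ∑ n ∈ Finset.range N, (volterra α β)^[n] g z with hS
  have hSm : ∀ N, Measurable (S N) := fun N => Finset.measurable_sum _ fun n _ =>
    measurable_volterra_iterate_single h.meas_α h.meas_β hg n
  have hSb : ∀ N y, c < y → |S N y| ≤ D * Real.exp A := fun N y hy => h.abs_partial_le hD0 hD hy N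
  have hE0 : 0 ≤ D * Real.exp A := by positivity
  have h1 : Tendsto (fun N => volterra α β (S N) x) atTop
      (𝓝 (volterra α β (volterraSol α β g) x)) := by
    refine tendsto_integral_of_dominated_convergence (fun y => γ y * (D * Real.exp A))
      (fun N => ?_) ((h.γ_int.mono_set (Ioi_subset_Ioi hx.le)).mul_const _) (fun N => ?_) ?_
    · exact ((h.integrableOn_kernel (hSm N) (hSb N) hE0).mono_set
        (Ioi_subset_Ioi hx.le)).aestronglyMeasurable
    · filter_upwards [ae_restrict_mem measurableSet_Ioi] with y hy
      have hy' : c < y := hx.trans hy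
      exact h.abs_kernel_le hy' (fun z hz => hSb N z (hy'.trans hz)) hE0
    · filter_upwards [ae_restrict_mem measurableSet_Ioi] with y hy
      have hy' : c < y := hx.trans hy
      refine Tendsto.const_mul _ ?_
      refine tendsto_integral_of_dominated_convergence (fun z => b z * (D * Real.exp A))
        (fun N => (h.meas_β.mul (hSm N)).aestronglyMeasurable)
        ((h.b_int.mono_set (Ioi_subset_Ioi hy'.le)).mul_const _) (fun N => ?_) ?_
      · filter_upwards [ae_restrict_mem measurableSet_Ioi] with z hz
        have hz' : c < z := hy'.trans hz
        rw [norm_mul]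
        exact mul_le_mul (h.β_le z hz') (hSb N z hz') (norm_nonneg _) (h.b_nonneg hz')
      · filter_upwards [ae_restrict_mem measurableSet_Ioi] with z hz
        exact (h.tendsto_sol hD0 hD (hy'.trans hz)).const_mul _
  have h2 : Tendsto (fun N => S (N + 1) x) atTop (𝓝 (volterraSol α β g x)) :=
    (tendsto_add_atTop_iff_nat 1).2 (h.tendsto_sol hD0 hD hx)
  have h3 : ∀ N, S (N + 1) x = g x + volterra α β (S N) x := by
    intro N
    rw [hS, h.volterra_partial hg hD0 hD hx N]
    simp only [Finset.sum_range_succ']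
    rw [add_comm]; rfl
  simp only [h3] at h2
  exact tendsto_nhds_unique h2 (h1.const_add _)

lemma abs_sol_sub_le {g : ℝ → ℝ} (hg : Measurable g) {D : ℝ} (hD0 : 0 ≤ D)
    (hD : ∀ y, c < y → |g y| ≤ D) {x : ℝ} (hx : c < x) :
    |volterraSol α β g x - g x| ≤ D * Real.exp A * G x := by
  rw [h.sol_eq hg hD0 hD hx, add_sub_cancel_left]
  have := h.abs_volterra_le (g := volterraSol α β g) (D := D * Real.exp A) (by positivity) 0
    (fun y hy => by simpa using h.abs_sol_le hD0 hD hy) hx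
  simpa using this

lemma integrableOn_mul_sol {g : ℝ → ℝ} (hg : Measurable g) {D : ℝ} (hD0 : 0 ≤ D)
    (hD : ∀ y, c < y → |g y| ≤ D) :
    IntegrableOn (fun z => β z * volterraSol α β g z) (Ioi c) := by
  have := h.integrableOn_mul (h.sol_measurableOn hg hD0 hD) (D := D * Real.exp A)
    (fun y hy => by rw [indicator_of_mem (mem_Ioi.2 hy)]; exact h.abs_sol_le hD0 hD hy)
  refine this.congr_fun (fun z hz => ?_) measurableSet_Ioi
  simp only [indicator_of_mem hz]

lemma integrableOn_kernel_sol {g : ℝ → ℝ} (hg : Measurable g) {D : ℝ} (hD0 : 0 ≤ D)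
    (hD : ∀ y, c < y → |g y| ≤ D) :
    IntegrableOn (fun y => α y * ∫ z in Ioi y, β z * volterraSol α β g z) (Ioi c) := by
  have := h.integrableOn_kernel (h.sol_measurableOn hg hD0 hD) (D := D * Real.exp A)
    (fun y hy => by rw [indicator_of_mem (mem_Ioi.2 hy)]; exact h.abs_sol_le hD0 hD hy)
    (by positivity)
  refine this.congr_fun (fun y hy => ?_) measurableSet_Ioi
  refine congrArg (α y * ·) (setIntegral_congr_fun measurableSet_Ioi fun z hz => ?_)
  rw [indicator_of_mem (mem_Ioi.2 (lt_trans hy hz))]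

omit h in
lemma _root_.KerrAdS.hasDerivAt_integral_Ioi {f : ℝ → ℝ} {c x : ℝ} (hf : IntegrableOn f (Ioi c))
    (hx : c < x) (hc : ContinuousAt f x) :
    HasDerivAt (fun y => ∫ z in Ioi y, f z) (-f x) x := by
  obtain ⟨d, hcd, hdx⟩ := exists_between hx
  have hd : IntegrableOn f (Ioi d) := hf.mono_set (Ioi_subset_Ioi hcd.le)
  have hmem : Ioi d ∈ 𝓝 x := Ioi_mem_nhds hdx
  have h1 : HasDerivAt (fun y => (∫ z in Ioi d, f z) - ∫ z in d..y, f z) (0 - f x) x := by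
    refine (hasDerivAt_const _ _).sub (intervalIntegral.integral_hasDerivAt_right ?_ ?_ hc)
    · rw [intervalIntegrable_iff_integrableOn_Ioc_of_le hdx.le]
      exact hd.mono_set Ioc_subset_Ioi_self
    · exact ⟨Ioi d, hmem, hd.aestronglyMeasurable⟩
  rw [zero_sub] at h1
  refine h1.congr_of_eventuallyEq ?_
  filter_upwards [hmem] with y hy
  rw [← intervalIntegral.integral_Ioi_sub_Ioi hd (le_of_lt hy)]
  ring

/-- First rung of a bootstrap: the solution is g plus a primitive of a merely integrable function,
hence continuous. Continuity then allows the fundamental theorem of calculus for the inner and next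
the outer integral. -/
lemma continuousAt_sol {g : ℝ → ℝ} (hg : Measurable g) {D : ℝ} (hD0 : 0 ≤ D)
    (hD : ∀ y, c < y → |g y| ≤ D) {x : ℝ} (hx : c < x) (hgx : ContinuousAt g x) :
    ContinuousAt (volterraSol α β g) x := by
  have hi := h.integrableOn_kernel_sol hg hD0 hD
  obtain ⟨d, hcd, hdx⟩ := exists_between hx
  have hd := hi.mono_set (Ioi_subset_Ioi hcd.le)
  have hcont : ContinuousAt (fun y => g y + ((∫ z in Ioi d, α z * ∫ t in Ioi z, β t *
      volterraSol α β g t) - ∫ z in d..y, α z * ∫ t in Ioi z, β t * volterraSol α β g t)) x := by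
    refine hgx.add (continuousAt_const.sub ?_)
    have h2 : IntegrableOn (fun y => α y * ∫ z in Ioi y, β z * volterraSol α β g z)
        (Icc d (x + 1)) := hi.mono_set fun y hy => lt_of_lt_of_le hcd hy.1
    have h1 := intervalIntegral.continuousOn_primitive_interval
      (μ := volume) (b := x + 1) (a := d) (f := fun y => α y * ∫ z in Ioi y, β z *
        volterraSol α β g z) (by rwa [uIcc_of_le (by linarith)])
    refine h1.continuousAt ?_
    rw [uIcc_of_le (by linarith)]
    exact Icc_mem_nhds hdx (by linarith)
  refine hcont.congr ?_
  filter_upwards [Ioi_mem_nhds hdx] with y hy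
  rw [← intervalIntegral.integral_Ioi_sub_Ioi hd (le_of_lt hy), sub_sub_cancel]
  exact (h.sol_eq hg hD0 hD (hcd.trans hy)).symm

lemma hasDerivAt_inner {g : ℝ → ℝ} (hg : Measurable g) {D : ℝ} (hD0 : 0 ≤ D)
    (hD : ∀ y, c < y → |g y| ≤ D) {x : ℝ} (hx : c < x) (hgx : ContinuousAt g x)
    (hβ : ContinuousAt β x) :
    HasDerivAt (fun y => ∫ z in Ioi y, β z * volterraSol α β g z)
      (-(β x * volterraSol α β g x)) x :=
  hasDerivAt_integral_Ioi (h.integrableOn_mul_sol hg hD0 hD) hx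
    (hβ.mul (h.continuousAt_sol hg hD0 hD hx hgx))

lemma hasDerivAt_sol {g : ℝ → ℝ} (hg : Measurable g) {D : ℝ} (hD0 : 0 ≤ D)
    (hD : ∀ y, c < y → |g y| ≤ D) {x g' : ℝ} (hx : c < x) (hgx : HasDerivAt g g' x)
    (hα : ContinuousAt α x) (hβ : ContinuousAt β x) :
    HasDerivAt (volterraSol α β g)
      (g' - α x * ∫ z in Ioi x, β z * volterraSol α β g z) x := by
  have h1 := (h.hasDerivAt_inner hg hD0 hD hx hgx.continuousAt hβ).continuousAt
  have h2 := hgx.add (hasDerivAt_integral_Ioi (h.integrableOn_kernel_sol hg hD0 hD) hx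
    (hα.mul h1))
  rw [sub_eq_add_neg]
  refine h2.congr_of_eventuallyEq ?_
  filter_upwards [Ioi_mem_nhds hx] with y hy
  exact h.sol_eq hg hD0 hD hy

lemma abs_inner_sol_le {g : ℝ → ℝ} {D : ℝ} (hD0 : 0 ≤ D)
    (hD : ∀ y, c < y → |g y| ≤ D) {x : ℝ} (hx : c < x) :
    |∫ z in Ioi x, β z * volterraSol α β g z| ≤ (∫ z in Ioi x, b z) * (D * Real.exp A) :=
  h.abs_inner_le hx fun _ hz => h.abs_sol_le hD0 hD (hx.trans hz)

end VolterraBound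

/-! ### Dependence on parameters -/

/-- A pointwise limit of measurable partial sums. The bounds ensuring convergence may depend on the
parameter z. -/
lemma measurable_volterraSol_at {Z : Type*} [MeasurableSpace Z] {α β g : Z → ℝ → ℝ}
    (hα : Measurable (Function.uncurry α)) (hβ : Measurable (Function.uncurry β))
    (hg : Measurable (Function.uncurry g)) {x : Z → ℝ} (hx : Measurable x)
    (h : ∀ z, ∃ c b γ G A D, VolterraBound c (α z) (β z) b γ G A ∧ c < x z ∧ 0 ≤ D ∧
      ∀ y, c < y → |g z y| ≤ D) :
    Measurable fun z => volterraSol (α z) (β z) (g z) (x z) := by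
  refine measurable_of_tendsto_metrizable (f := fun (N : ℕ) z => ∑ n ∈ Finset.range N,
    (volterra (α z) (β z))^[n] (g z) (x z)) (fun N => ?_) ?_
  · refine Finset.measurable_sum _ fun n _ => ?_
    exact (measurable_volterra_iterate hα hβ hg n).comp (measurable_id.prodMk hx)
  · rw [tendsto_pi_nhds]
    intro z
    obtain ⟨c, b, γ, G, A, D, hV, hc, hD0, hD⟩ := h z
    exact hV.tendsto_sol hD0 hD hc

lemma measurable_inner_volterraSol_at {Z : Type*} [MeasurableSpace Z] {α β g : Z → ℝ → ℝ}
    (hα : Measurable (Function.uncurry α)) (hβ : Measurable (Function.uncurry β))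
    (hg : Measurable (Function.uncurry g)) {x : Z → ℝ} (hx : Measurable x)
    (h : ∀ z, ∃ c b γ G A D, VolterraBound c (α z) (β z) b γ G A ∧ c < x z ∧ 0 ≤ D ∧
      ∀ y, c < y → |g z y| ≤ D) :
    Measurable fun z => ∫ t in Ioi (x z), β z t * volterraSol (α z) (β z) (g z) t := by
  refine measurable_of_tendsto_metrizable (f := fun (N : ℕ) z => ∫ t in Ioi (x z), β z t *
    ∑ n ∈ Finset.range N, (volterra (α z) (β z))^[n] (g z) t) (fun N => ?_) ?_
  · have hm : Measurable fun q : Z × ℝ => β q.1 q.2 *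
        ∑ n ∈ Finset.range N, (volterra (α q.1) (β q.1))^[n] (g q.1) q.2 :=
      hβ.mul (Finset.measurable_sum _ fun n _ => measurable_volterra_iterate hα hβ hg n)
    exact (measurable_integral_Ioi (f := fun z t => β z t *
      ∑ n ∈ Finset.range N, (volterra (α z) (β z))^[n] (g z) t) hm).comp (measurable_id.prodMk hx)
  · rw [tendsto_pi_nhds]
    intro z
    obtain ⟨c, b, γ, G, A, D, hV, hc, hD0, hD⟩ := h z
    have hgz : Measurable (g z) := hg.comp (measurable_const.prodMk measurable_id)
    refine tendsto_integral_of_dominated_convergence (fun t => b t * (D * Real.exp A))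
      (fun N => ?_) ((hV.b_int.mono_set (Ioi_subset_Ioi hc.le)).mul_const _) (fun N => ?_) ?_
    · exact (hV.meas_β.mul (Finset.measurable_sum _ fun n _ =>
        measurable_volterra_iterate_single hV.meas_α hV.meas_β hgz n)).aestronglyMeasurable
    · filter_upwards [ae_restrict_mem measurableSet_Ioi] with t ht
      have ht' : c < t := hc.trans ht
      rw [norm_mul]
      exact mul_le_mul (hV.β_le t ht') (hV.abs_partial_le hD0 hD ht' N) (norm_nonneg _)
        (hV.b_nonneg ht')
    · filter_upwards [ae_restrict_mem measurableSet_Ioi] with t ht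
      exact (hV.tendsto_sol hD0 hD (hc.trans ht)).const_mul _

/-- Here b, γ, G and A are common to all z, so dominated convergence gives continuity of each
iterate and the Weierstrass test that of the sum. -/
lemma continuous_volterraSol {Z : Type*} [TopologicalSpace Z] [FirstCountableTopology Z]
    [Nonempty Z] {c A D : ℝ} {α b γ G : ℝ → ℝ} {β : Z → ℝ → ℝ} {g : ℝ → ℝ}
    (h : ∀ z, VolterraBound c α (β z) b γ G A) (hβ : ∀ t, Continuous fun z => β z t)
    (hg : Measurable g) (hD0 : 0 ≤ D) (hD : ∀ y, c < y → |g y| ≤ D) {x : ℝ} (hx : c < x) :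
    Continuous (fun z => volterraSol α (β z) g x) ∧
      Continuous fun z => ∫ t in Ioi x, β z t * volterraSol α (β z) g t := by
  obtain ⟨z₀⟩ := ‹Nonempty Z›
  have hstep : ∀ f : Z → ℝ → ℝ, (∀ z, Measurable (f z)) → ∀ E : ℝ,
      (∀ z y, c < y → |f z y| ≤ E) → (∀ y, c < y → Continuous fun z => f z y) →
      ∀ y, c < y → Continuous fun z => ∫ t in Ioi y, β z t * f z t := by
    intro f hfm E hE hf y hy
    refine continuous_of_dominated (bound := fun t => b t * E) (fun z =>
      ((h z).meas_β.mul (hfm z)).aestronglyMeasurable) (fun z => ?_)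
      (((h z₀).b_int.mono_set (Ioi_subset_Ioi hy.le)).mul_const _) ?_
    · filter_upwards [ae_restrict_mem measurableSet_Ioi] with t ht
      have ht' : c < t := hy.trans ht
      rw [norm_mul]
      exact mul_le_mul ((h z).β_le t ht') (hE z t ht') (norm_nonneg _) ((h z).b_nonneg ht')
    · filter_upwards [ae_restrict_mem measurableSet_Ioi] with t ht
      exact (hβ t).mul (hf t (hy.trans ht))
  have hm := fun z n => measurable_volterra_iterate_single (h z).meas_α (h z).meas_β hg n
  have hb : ∀ n z y, c < y → |(volterra α (β z))^[n] g y| ≤ D * (A ^ n / n.factorial) :=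
    fun n z y hy => (h z).abs_iterate_le' hD0 hD n hy
  have hiter : ∀ n y, c < y → Continuous fun z => (volterra α (β z))^[n] g y := by
    intro n
    induction n with
    | zero => intro y _; exact continuous_const
    | succ n ih =>
      intro y hy
      simp only [Function.iterate_succ', Function.comp]
      have h0 : 0 ≤ D * (A ^ n / n.factorial) := (abs_nonneg _).trans (hb n z₀ y hy)
      refine continuous_of_dominated (bound := fun t => γ t * (D * (A ^ n / n.factorial)))
        (fun z => (((h z).integrableOn_kernel (hm z n) (hb n z) h0).mono_set
          (Ioi_subset_Ioi hy.le)).aestronglyMeasurable) (fun z => ?_)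
        (((h z₀).γ_int.mono_set (Ioi_subset_Ioi hy.le)).mul_const _) ?_
      · filter_upwards [ae_restrict_mem measurableSet_Ioi] with t ht
        have ht' : c < t := hy.trans ht
        exact (h z).abs_kernel_le ht' (fun s hs => hb n z s (ht'.trans hs)) h0
      · filter_upwards [ae_restrict_mem measurableSet_Ioi] with t ht
        exact continuous_const.mul (hstep _ (fun z => hm z n) _ (hb n) ih t (hy.trans ht))
  have hsol : ∀ y, c < y → Continuous fun z => volterraSol α (β z) g y := fun y hy =>
    continuous_tsum (fun n => hiter n y hy) (VolterraBound.summable_bound A D)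
      (fun n z => hb n z y hy)
  refine ⟨hsol x hx, ?_⟩
  have h1 := hstep (fun z => (Ioi c).indicator (volterraSol α (β z) g))
    (fun z => (h z).sol_measurableOn hg hD0 hD) (D * Real.exp A)
    (fun z y hy => by rw [indicator_of_mem (mem_Ioi.2 hy)]; exact (h z).abs_sol_le hD0 hD hy)
    (fun y hy => by simp only [indicator_of_mem (mem_Ioi.2 hy)]; exact hsol y hy) x hx
  refine h1.congr fun z => setIntegral_congr_fun measurableSet_Ioi fun t ht => ?_
  simp only [indicator_of_mem (mem_Ioi.2 (lt_trans hx ht))]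

/-! ### Measurability of infima and of zero counts -/

/-- The approximation hypothesis reduces {inf S < x} to a countable union over rational points of S.
Parameters with S empty or unbounded below are split off, since the real infimum there takes the
default value 0. -/
lemma measurable_sInf_of_rat {Z : Type*} [MeasurableSpace Z] {S : Z → Set ℝ}
    (hS : ∀ c, MeasurableSet {z | c ∈ S z})
    (hq : ∀ z, ∀ c ∈ S z, ∀ x, c < x → ∃ q : ℚ, (q : ℝ) < x ∧ (q : ℝ) ∈ S z) :
    Measurable fun z => sInf (S z) := by
  have hne : ∀ z, (S z).Nonempty ↔ ∃ q : ℚ, (q : ℝ) ∈ S z := fun z =>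
    ⟨fun ⟨c, hc⟩ => let ⟨q, _, h⟩ := hq z c hc (c + 1) (by linarith); ⟨q, h⟩,
      fun ⟨q, h⟩ => ⟨_, h⟩⟩
  have hbd : ∀ z, BddBelow (S z) ↔ ∃ n : ℕ, ∀ q : ℚ, (q : ℝ) ∈ S z → -(n : ℝ) ≤ q := by
    intro z
    constructor
    · rintro ⟨b, hb⟩
      obtain ⟨n, hn⟩ := exists_nat_ge (-b)
      exact ⟨n, fun q h => by linarith [hb h]⟩
    · rintro ⟨n, hn⟩
      refine ⟨-(n : ℝ), fun c hc => le_of_forall_gt_imp_ge_of_dense fun x hx => ?_⟩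
      obtain ⟨q, hqx, hqS⟩ := hq z c hc x hx
      exact (hn q hqS).trans hqx.le
  have m1 : MeasurableSet {z | (S z).Nonempty} := by
    have : {z | (S z).Nonempty} = ⋃ q : ℚ, {z | (q : ℝ) ∈ S z} := by
      ext z; simp only [mem_iUnion, mem_ofPred_eq, hne]
    rw [this]
    exact MeasurableSet.iUnion fun q => hS q
  have m2 : MeasurableSet {z | BddBelow (S z)} := by
    have : {z | BddBelow (S z)} =
        ⋃ n : ℕ, ⋂ q : ℚ, ({z | (q : ℝ) ∈ S z}ᶜ ∪ {_z | -(n : ℝ) ≤ q}) := by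
      ext z
      simp only [mem_iUnion, mem_iInter, mem_union, mem_compl_iff, mem_ofPred_eq, hbd,
        imp_iff_not_or]
    rw [this]
    exact MeasurableSet.iUnion fun n => MeasurableSet.iInter fun q =>
      (hS q).compl.union (MeasurableSet.const _)
  have m3 := m1.inter m2
  refine measurable_of_Iio fun x => ?_
  have : (fun z => sInf (S z)) ⁻¹' Iio x =
      ({z | (S z).Nonempty} ∩ {z | BddBelow (S z)} ∩ ⋃ q : {q : ℚ // (q : ℝ) < x},
        {z | ((q : ℚ) : ℝ) ∈ S z}) ∪
      (({z | (S z).Nonempty} ∩ {z | BddBelow (S z)})ᶜ ∩ {_z | (0 : ℝ) < x}) := by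
    ext z
    change sInf (S z) < x ↔ _
    constructor
    · intro hlt
      by_cases h : z ∈ {z | (S z).Nonempty} ∩ {z | BddBelow (S z)}
      · obtain ⟨c, hc, hcx⟩ := (csInf_lt_iff h.2 h.1).1 hlt
        obtain ⟨q, hqx, hqS⟩ := hq z c hc x hcx
        exact Or.inl ⟨h, mem_iUnion.2 ⟨⟨q, hqx⟩, hqS⟩⟩
      · have h0 : sInf (S z) = 0 := by
          by_cases h1 : (S z).Nonempty
          · exact Real.sInf_of_not_bddBelow fun h2 => h ⟨h1, h2⟩
          · rw [not_nonempty_iff_eq_empty.1 h1, Real.sInf_empty]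
        exact Or.inr ⟨h, h0 ▸ hlt⟩
    · rintro (⟨h, hx⟩ | ⟨h, hx⟩)
      · obtain ⟨⟨q, hqx⟩, hqS⟩ := mem_iUnion.1 hx
        exact (csInf_le h.2 hqS).trans_lt hqx
      · have h0 : sInf (S z) = 0 := by
          by_cases h1 : (S z).Nonempty
          · exact Real.sInf_of_not_bddBelow fun h2 => h ⟨h1, h2⟩
          · rw [not_nonempty_iff_eq_empty.1 h1, Real.sInf_empty]
        rw [h0]; exact hx
  rw [this]
  exact (m3.inter (MeasurableSet.iUnion fun q => hS _)).union
    (m3.compl.inter (MeasurableSet.const _))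

/-- By compactness a nonnegative continuous function vanishes somewhere on K exactly when it takes
arbitrarily small values on a countable dense subset of K. This removes the uncountable quantifier.
-/
lemma measurableSet_exists_zero {Z T : Type*} [MeasurableSpace Z] [MetricSpace T]
    [SecondCountableTopology T] {K : Set T} (hK : IsCompact K) {H : Z → T → ℝ}
    (h0 : ∀ z t, 0 ≤ H z t) (hm : ∀ t, Measurable fun z => H z t) (hc : ∀ z, Continuous (H z)) :
    MeasurableSet {z | ∃ t ∈ K, H z t = 0} := by
  obtain ⟨D, hDc, hDd⟩ := TopologicalSpace.exists_countable_dense K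
  have : {z | ∃ t ∈ K, H z t = 0} = ⋂ n : ℕ, ⋃ d ∈ D, {z | H z (d : T) < 1 / ((n : ℝ) + 1)} := by
    ext z
    simp only [mem_iInter, mem_iUnion, mem_ofPred_eq]
    constructor
    · rintro ⟨t, htK, ht⟩ n
      have hcz : Continuous fun d : K => H z d := (hc z).comp continuous_subtype_val
      have hpos : (0 : ℝ) < 1 / ((n : ℝ) + 1) := by positivity
      obtain ⟨d, hd, hdD⟩ := hDd.inter_open_nonempty {d : K | H z d < 1 / ((n : ℝ) + 1)}
        (isOpen_lt hcz continuous_const) ⟨⟨t, htK⟩, by simpa [ht] using hpos⟩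
      exact ⟨d, hdD, hd⟩
    · intro h
      obtain ⟨d₀, -, -⟩ := h 0
      obtain ⟨t, htK, htmin⟩ := hK.exists_isMinOn ⟨d₀.1, d₀.2⟩ (hc z).continuousOn
      refine ⟨t, htK, le_antisymm ?_ (h0 z t)⟩
      refine le_of_forall_pos_le_add fun e he => ?_
      obtain ⟨n, hn⟩ := exists_nat_one_div_lt he
      obtain ⟨d, -, hd⟩ := h n
      have := htmin d.2
      simp only [mem_ofPred_eq] at this
      linarith
  rw [this]
  exact MeasurableSet.iInter fun n => MeasurableSet.biUnion hDc fun d _ =>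
    measurableSet_lt (hm d) measurable_const

lemma le_encard_iff_exists_fin {S : Set ℝ} {k : ℕ} :
    (k : ℕ∞) ≤ S.encard ↔ ∃ t : Fin k → ℝ, Function.Injective t ∧ ∀ i, t i ∈ S := by
  constructor
  · intro h
    obtain ⟨s, hs, hk⟩ := exists_subset_encard_eq h
    have hf : s.Finite := finite_of_encard_eq_coe hk
    have hcard : hf.toFinset.card = k := by
      have := hf.encard_eq_coe_toFinset_card
      rw [hk] at this
      exact_mod_cast this.symm
    let e := hf.toFinset.equivFinOfCardEq hcard
    refine ⟨fun i => (e.symm i : ℝ), fun i j hij => e.symm.injective (Subtype.ext hij), fun i => ?_⟩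
    exact hs (hf.mem_toFinset.1 (e.symm i).2)
  · rintro ⟨t, ht, hS⟩
    calc (k : ℕ∞) = (range t).encard := by
          rw [← image_univ, ht.encard_image, encard_univ]; simp
      _ ≤ S.encard := encard_le_encard (range_subset_iff.2 hS)

/-- Having k distinct zeros is one zero of Σ|F(tᵢ)| on the space of k-tuples of distinct points, and
that space is exhausted by countably many compact sets. -/
lemma measurableSet_zero_count {Z : Type*} [MeasurableSpace Z] {F : Z → ℝ → ℝ}
    (hm : ∀ t, Measurable fun z => F z t) (hc : ∀ z, Continuous (F z)) (k : ℕ) (c : ℝ) :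
    MeasurableSet {z | (k : ℕ∞) ≤ ({t | F z t = 0} ∩ Iic c).encard} := by
  -- Bounded tuples below c with separation at least 1/(n+1): the separation keeps the entries
  -- distinct in a closed condition.
  set K : ℕ → Set (Fin k → ℝ) := fun n => {t | (∀ i, |t i| ≤ n ∧ t i ≤ c) ∧
    ∀ i j, i ≠ j → 1 / ((n : ℝ) + 1) ≤ |t i - t j|}
  have hK : ∀ n, IsCompact (K n) := by
    intro n
    refine (isCompact_univ_pi fun _ : Fin k => isCompact_Icc (a := -(n : ℝ)) (b := n)).of_isClosed_subset
      ?_ (fun t ht i _ => abs_le.1 (ht.1 i).1)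
    refine IsClosed.and ?_ ?_
    · simp only [ofPred_forall]
      exact isClosed_iInter fun i => (isClosed_le (by fun_prop) continuous_const).and
        (isClosed_le (by fun_prop) continuous_const)
    · simp only [ofPred_forall]
      exact isClosed_iInter fun i => isClosed_iInter fun j => isClosed_iInter fun _ =>
        isClosed_le continuous_const (by fun_prop)
  have : {z | (k : ℕ∞) ≤ ({t | F z t = 0} ∩ Iic c).encard} =
      ⋃ n, {z | ∃ t ∈ K n, ∑ i, |F z (t i)| = 0} := by
    ext z
    simp only [mem_iUnion, mem_ofPred_eq, le_encard_iff_exists_fin]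
    constructor
    · rintro ⟨t, hinj, ht⟩
      have e1 : ∀ᶠ n : ℕ in atTop, ∀ i, |t i| ≤ n :=
        eventually_all.2 fun i => tendsto_natCast_atTop_atTop.eventually_ge_atTop _
      have e2 : ∀ᶠ n : ℕ in atTop, ∀ i j, i ≠ j → 1 / ((n : ℝ) + 1) ≤ |t i - t j| := by
        refine eventually_all.2 fun i => eventually_all.2 fun j => ?_
        by_cases hij : i = j
        · simp [hij]
        · have hpos : 0 < |t i - t j| := abs_pos.2 (sub_ne_zero.2 (hinj.ne hij))
          filter_upwards [tendsto_one_div_add_atTop_nhds_zero_nat.eventually_le_const hpos]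
            with n hn _ using hn
      obtain ⟨n, hn1, hn2⟩ := (e1.and e2).exists
      refine ⟨n, t, ⟨fun i => ⟨hn1 i, (ht i).2⟩, hn2⟩, Finset.sum_eq_zero fun i _ => ?_⟩
      rw [show F z (t i) = 0 from (ht i).1, abs_zero]
    · rintro ⟨n, t, ⟨ht1, ht2⟩, ht0⟩
      refine ⟨t, fun i j hij => ?_, fun i => ⟨?_, (ht1 i).2⟩⟩
      · by_contra hne
        have := ht2 i j hne
        rw [hij, sub_self, abs_zero] at this
        have : (0 : ℝ) < 1 / ((n : ℝ) + 1) := by positivity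
        linarith
      · have := (Finset.sum_eq_zero_iff_of_nonneg fun i _ => abs_nonneg _).1 ht0 i (Finset.mem_univ i)
        exact abs_eq_zero.1 this
  rw [this]
  refine MeasurableSet.iUnion fun n => measurableSet_exists_zero (hK n)
    (H := fun z (t : Fin k → ℝ) => ∑ i, |F z (t i)|)
    (fun z t => Finset.sum_nonneg fun i _ => abs_nonneg _) (fun t => ?_) (fun z => ?_)
  · exact Finset.measurable_sum _ fun i _ => (hm (t i)).abs
  · exact continuous_finsetSum _ fun i _ => ((hc z).comp (continuous_apply i)).abs

/-! ### The angular equation -/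

section
variable {l : ℝ} {p : ℝ × ℝ}

/-- `(f, F)` solves the angular equation on `(-1, 1)`; `F = Δ_x (1 - x²) f'`. -/
def IsAngularPair (l : ℝ) (p : ℝ × ℝ) (m : ℕ) (ξ lam : ℝ) (f F : ℝ → ℝ) : Prop :=
  ∀ x ∈ Ioo (-1 : ℝ) 1, HasDerivAt f (F x / (DeltaX l p x * (1 - x ^ 2))) x ∧
    HasDerivAt F (angularPotential l p m ξ x * f x - lam * f x) x

/-- The coefficient left after the factor `(1 - x²)^{m/2}` has been taken out of a solution. -/
def angularReduced (l : ℝ) (p : ℝ × ℝ) (m : ℕ) (ξ x : ℝ) : ℝ :=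
  (m : ℝ) ^ 2 * (DeltaX l p x ^ 2 - spin l p ^ 2 / l ^ 2 * (Xi l p + DeltaX l p x)) / DeltaX l p x
    + m * (1 - 3 * (spin l p ^ 2 / l ^ 2) * x ^ 2)
    - Xi l p * ξ ^ 2 * (x ^ 2 / DeltaX l p x)
    - 2 * (m : ℝ) * ξ * (Xi l p / DeltaX l p x) * ((spin l p) ^ 2 / l ^ 2) * x ^ 2
    + 2 / l ^ 2 * (spin l p) ^ 2 * (1 - x ^ 2)

/-- Outer coefficient of the integral equation of the reduced angular equation. -/
def angularOuter (l : ℝ) (p : ℝ × ℝ) (m : ℕ) : ℝ → ℝ :=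
  (Ioo (-1 : ℝ) 1).indicator fun x => ((1 - x ^ 2) ^ (m + 1) * DeltaX l p x)⁻¹

/-- Inner coefficient of the integral equation of the reduced angular equation. -/
def angularInner (l : ℝ) (p : ℝ × ℝ) (m : ℕ) (ξ lam : ℝ) : ℝ → ℝ :=
  (Ioo (-1 : ℝ) 1).indicator fun x => (1 - x ^ 2) ^ m * (angularReduced l p m ξ x - lam)

/-- The reduced solution which is regular at `x = 1`. -/
def angularG (l : ℝ) (p : ℝ × ℝ) (m : ℕ) (ξ lam : ℝ) : ℝ → ℝ :=
  volterraSol (angularOuter l p m) (angularInner l p m ξ lam) fun _ => 1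

/-- The flux of `angularG`. -/
def angularH (l : ℝ) (p : ℝ × ℝ) (m : ℕ) (ξ lam x : ℝ) : ℝ :=
  ∫ z in Ioi x, angularInner l p m ξ lam z * angularG l p m ξ lam z

/-- The solution which is recessive at `x = 1`. -/
def angularPhi (l : ℝ) (p : ℝ × ℝ) (m : ℕ) (ξ lam x : ℝ) : ℝ :=
  Real.sqrt (1 - x ^ 2) ^ m * angularG l p m ξ lam x

/-- The flux `Δ_x (1 - x²) φ'` of `angularPhi`. -/
def angularFlux (l : ℝ) (p : ℝ × ℝ) (m : ℕ) (ξ lam x : ℝ) : ℝ :=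
  Real.sqrt (1 - x ^ 2) ^ m * (-(m * x * DeltaX l p x * angularG l p m ξ lam x)
    - angularH l p m ξ lam x / (1 - x ^ 2) ^ m)

lemma sq_lt_one_of_mem {x : ℝ} (hx : x ∈ Ioo (-1 : ℝ) 1) : 0 < 1 - x ^ 2 := by
  nlinarith [hx.1, hx.2]

lemma Xi_le_DeltaX {x : ℝ} (hx : x ∈ Icc (-1 : ℝ) 1) : Xi l p ≤ DeltaX l p x := by
  unfold Xi DeltaX
  have h1 : x ^ 2 ≤ 1 := by nlinarith [hx.1, hx.2]
  have h2 : 0 ≤ spin l p ^ 2 / l ^ 2 := by positivity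
  nlinarith

lemma DeltaX_le_one (x : ℝ) : DeltaX l p x ≤ 1 := by
  unfold DeltaX
  have h2 : 0 ≤ spin l p ^ 2 / l ^ 2 * x ^ 2 := by positivity
  linarith

lemma DeltaX_pos (hp : p ∈ paramSpace l) {x : ℝ} (hx : x ∈ Icc (-1 : ℝ) 1) :
    0 < DeltaX l p x := (Xi_pos hp).trans_le (Xi_le_DeltaX hx)

lemma continuous_DeltaX : Continuous (DeltaX l p) := by unfold DeltaX; fun_prop

lemma continuousOn_angularReduced (hp : p ∈ paramSpace l) (m : ℕ) (ξ : ℝ) :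
    ContinuousOn (angularReduced l p m ξ) (Icc (-1 : ℝ) 1) := by
  have h := continuous_DeltaX (l := l) (p := p)
  have h0 : ∀ x ∈ Icc (-1 : ℝ) 1, DeltaX l p x ≠ 0 := fun x hx => (DeltaX_pos hp hx).ne'
  unfold angularReduced
  refine ContinuousOn.add (ContinuousOn.sub (ContinuousOn.sub (ContinuousOn.add
    (ContinuousOn.div ?_ h.continuousOn h0) ?_) ?_) ?_) ?_
  · fun_prop
  · fun_prop
  · exact continuousOn_const.mul (ContinuousOn.div (by fun_prop) h.continuousOn h0)
  · refine ContinuousOn.mul (ContinuousOn.mul (continuousOn_const.mul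
      (ContinuousOn.div (by fun_prop) h.continuousOn h0)) continuousOn_const) (by fun_prop)
  · fun_prop

lemma measurable_angularOuter (m : ℕ) :
    Measurable (Function.uncurry fun p : ℝ × ℝ => angularOuter l p m) := by
  have : (Function.uncurry fun p : ℝ × ℝ => angularOuter l p m) =
      {q : (ℝ × ℝ) × ℝ | q.2 ∈ Ioo (-1 : ℝ) 1}.indicator
        fun q => ((1 - q.2 ^ 2) ^ (m + 1) * DeltaX l q.1 q.2)⁻¹ := by
    funext q; rfl
  rw [this]
  refine Measurable.indicator ?_ (measurable_snd measurableSet_Ioo)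
  unfold DeltaX spin; fun_prop

lemma measurable_angularInner (m : ℕ) :
    Measurable (Function.uncurry fun z : (ℝ × ℝ) × ℝ × ℝ => angularInner l z.1 m z.2.1 z.2.2) := by
  have : (Function.uncurry fun z : (ℝ × ℝ) × ℝ × ℝ => angularInner l z.1 m z.2.1 z.2.2) =
      {q : ((ℝ × ℝ) × ℝ × ℝ) × ℝ | q.2 ∈ Ioo (-1 : ℝ) 1}.indicator
        fun q => (1 - q.2 ^ 2) ^ m * (angularReduced l q.1.1 m q.1.2.1 q.2 - q.1.2.2) := by
    funext q; rfl
  rw [this]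
  refine Measurable.indicator ?_ (measurable_snd measurableSet_Ioo)
  unfold angularReduced Xi DeltaX spin; fun_prop

/-- Near x = 1 the outer coefficient is of order (1 - y)^{-(m+1)}, while the inner integral vanishes
to order (1 - y)^{m+1}. The kernel is therefore bounded by a constant C, and G = C(1 - y) is its
primitive. The endpoint c > -1 avoids the other singularity; uniformity in |λ| ≤ N serves continuity
in λ. -/
lemma angular_volterraBound (hp : p ∈ paramSpace l) (m : ℕ) (ξ N : ℝ) {c : ℝ} (hc : -1 < c) :
    ∃ b γ C, ∀ lam, |lam| ≤ N → VolterraBound c (angularOuter l p m)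
      (angularInner l p m ξ lam) b γ (fun y => C * max (1 - y) 0) (2 * C) := by
  obtain ⟨Q₀, hQ₀⟩ := isCompact_Icc.exists_bound_of_continuousOn (continuousOn_angularReduced hp m ξ)
  set Q := max (Q₀ + N) 0
  have hQ : 0 ≤ Q := le_max_right _ _
  set C := Q * 2 ^ m / (Xi l p * (1 + c) ^ (m + 1)) with hC
  have hX := Xi_pos hp
  have hc1 : 0 < 1 + c := by linarith
  have hC0 : 0 ≤ C := by positivity
  set b : ℝ → ℝ := (Ioo (-1 : ℝ) 1).indicator fun x => Q * (1 - x ^ 2) ^ m with hb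
  have hbi : IntegrableOn b (Ioi c) := by
    refine Integrable.integrableOn ?_
    rw [integrable_indicator_iff measurableSet_Ioo]
    exact (Continuous.integrableOn_Icc (by fun_prop)).mono_set Ioo_subset_Icc_self
  set γ : ℝ → ℝ := (Iio (1 : ℝ)).indicator fun _ => C with hγ
  have hγi : IntegrableOn γ (Ioi c) := by
    rw [IntegrableOn, integrable_indicator_iff measurableSet_Iio, IntegrableOn,
      Measure.restrict_restrict measurableSet_Iio]
    refine integrableOn_const (s := Iio 1 ∩ Ioi c) ?_
    rw [inter_comm, Ioi_inter_Iio]; simp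
  have hm1 := (measurable_angularOuter (l := l) m).comp
    (measurable_const.prodMk measurable_id : Measurable fun x : ℝ => (p, x))
  refine ⟨b, γ, C, fun lam hlam => ?_⟩
  have hm2 := (measurable_angularInner (l := l) m).comp
    (measurable_const.prodMk measurable_id : Measurable fun x : ℝ => ((p, ξ, lam), x))
  refine ⟨hm1, hm2, hbi, fun y _ => ?_, fun y hy => ?_, hγi, by fun_prop, fun y => by positivity,
    fun y hy => ?_, fun x _ y _ hxy => ?_, fun n x hx => ?_⟩
  · by_cases hy : y ∈ Ioo (-1 : ℝ) 1
    · rw [hb, angularInner, indicator_of_mem hy, indicator_of_mem hy, abs_mul,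
        abs_of_nonneg (pow_nonneg (sq_lt_one_of_mem hy).le _), mul_comm]
      refine mul_le_mul_of_nonneg_right ?_ (pow_nonneg (sq_lt_one_of_mem hy).le _)
      refine (abs_sub _ _).trans (le_max_of_le_left (add_le_add ?_ hlam))
      exact hQ₀ y (Ioo_subset_Icc_self hy)
    · rw [hb, angularInner, indicator_of_notMem hy, indicator_of_notMem hy, abs_zero]
  · by_cases hy1 : y ∈ Ioo (-1 : ℝ) 1
    · have hy2 : 0 < 1 - y := by linarith [hy1.2]
      rw [angularOuter, indicator_of_mem hy1, hγ, indicator_of_mem (mem_Iio.2 hy1.2)]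
      have e1 : ∫ z in Ioi y, b z ≤ Q * (2 * (1 - y)) ^ m * (1 - y) := by
        have : ∫ z in Ioi y, b z = ∫ z in Ioo y 1, Q * (1 - z ^ 2) ^ m := by
          rw [hb, setIntegral_indicator measurableSet_Ioo]
          congr 2
          ext z; simp only [mem_inter_iff, mem_Ioi, mem_Ioo]
          constructor
          · rintro ⟨h1, h2, h3⟩; exact ⟨h1, h3⟩
          · rintro ⟨h1, h2⟩; exact ⟨h1, by linarith [hy1.1], h2⟩
        rw [this]
        have h2 : ∫ z in Ioo y 1, Q * (1 - z ^ 2) ^ m ≤ ∫ z in Ioo y 1, Q * (2 * (1 - y)) ^ m := by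
          refine setIntegral_mono_on ?_ (integrableOn_const (by simp)) measurableSet_Ioo
            fun z hz => ?_
          · exact (Continuous.integrableOn_Icc (by fun_prop)).mono_set Ioo_subset_Icc_self
          · have hz' := sq_lt_one_of_mem ⟨hy1.1.trans hz.1, hz.2⟩
            gcongr
            nlinarith [hz.1, hz.2, hy1.1]
        refine h2.trans (le_of_eq ?_)
        rw [setIntegral_const, measureReal_def, Real.volume_Ioo, ENNReal.toReal_ofReal hy2.le,
          smul_eq_mul]
        ring
      have e2 : |((1 - y ^ 2) ^ (m + 1) * DeltaX l p y)⁻¹| ≤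
          ((1 - y) ^ (m + 1) * (1 + c) ^ (m + 1) * Xi l p)⁻¹ := by
        have h1 := sq_lt_one_of_mem hy1
        have h2 := DeltaX_pos hp (Ioo_subset_Icc_self hy1)
        rw [abs_of_pos (by positivity)]
        have h3 := Xi_le_DeltaX (l := l) (p := p) (Ioo_subset_Icc_self hy1)
        rw [← mul_pow]
        gcongr
        nlinarith
      have e3 : 0 ≤ ∫ z in Ioi y, b z := by
        refine setIntegral_nonneg measurableSet_Ioi fun z _ => ?_
        refine indicator_nonneg (fun z hz => ?_) z
        exact mul_nonneg hQ (pow_nonneg (sq_lt_one_of_mem hz).le _)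
      calc _ ≤ ((1 - y) ^ (m + 1) * (1 + c) ^ (m + 1) * Xi l p)⁻¹ *
            (Q * (2 * (1 - y)) ^ m * (1 - y)) := by gcongr
        _ = C := by rw [hC, mul_pow, pow_succ (1 - y)]; field_simp
    · rw [angularOuter, indicator_of_notMem hy1, abs_zero, zero_mul]
      exact indicator_nonneg (fun _ _ => hC0) y
  · have : max (1 - y) 0 ≤ 2 := max_le (by linarith) (by norm_num)
    nlinarith
  · show C * max (1 - y) 0 ≤ C * max (1 - x) 0
    gcongr
  · rcases le_or_gt 1 x with h1 | h1
    · have : ∫ y in Ioi x, γ y * (C * max (1 - y) 0) ^ n = 0 := by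
        refine setIntegral_eq_zero_of_forall_eq_zero fun y hy => ?_
        have hy' : x < y := hy
        rw [hγ, indicator_of_notMem (by simp; linarith), zero_mul]
      rw [this]; positivity
    · have e : ∫ y in Ioi x, γ y * (C * max (1 - y) 0) ^ n =
          ∫ y in x..1, C ^ (n + 1) * (1 - y) ^ n := by
        rw [intervalIntegral.integral_of_le h1.le, integral_Ioc_eq_integral_Ioo,
          ← Ioi_inter_Iio, ← setIntegral_indicator measurableSet_Iio]
        refine setIntegral_congr_fun measurableSet_Ioi fun y _ => ?_
        by_cases hy : y < 1
        · simp only [hγ, indicator_of_mem (mem_Iio.2 hy)]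
          rw [max_eq_left (by linarith), mul_pow]; ring
        · simp only [hγ, indicator_of_notMem (show y ∉ Iio 1 from hy), zero_mul]
      rw [e, intervalIntegral.integral_const_mul,
        intervalIntegral.integral_comp_sub_left (fun y => y ^ n) 1, integral_pow,
        max_eq_left (by linarith)]
      apply le_of_eq
      rw [mul_pow]; simp; ring

lemma hasDerivAt_angularG (hp : p ∈ paramSpace l) (m : ℕ) (ξ lam : ℝ) {x : ℝ}
    (hx : x ∈ Ioo (-1 : ℝ) 1) :
    HasDerivAt (angularG l p m ξ lam)
      (-(((1 - x ^ 2) ^ (m + 1) * DeltaX l p x)⁻¹ * angularH l p m ξ lam x)) x ∧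
    HasDerivAt (angularH l p m ξ lam)
      (-((1 - x ^ 2) ^ m * (angularReduced l p m ξ x - lam) * angularG l p m ξ lam x)) x := by
  obtain ⟨c, hc, hcx⟩ := exists_between hx.1
  obtain ⟨b, γ, C, hV⟩ := angular_volterraBound hp m ξ |lam| hc
  have h := hV lam le_rfl
  have hev : Ioo (-1 : ℝ) 1 ∈ 𝓝 x := Ioo_mem_nhds hx.1 hx.2
  have hD : DeltaX l p x ≠ 0 := (DeltaX_pos hp (Ioo_subset_Icc_self hx)).ne'
  have hα : ContinuousAt (angularOuter l p m) x := by
    have : ContinuousAt (fun x => ((1 - x ^ 2) ^ (m + 1) * DeltaX l p x)⁻¹) x := by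
      refine ContinuousAt.inv₀ ?_ (mul_ne_zero (pow_ne_zero _ (sq_lt_one_of_mem hx).ne') hD)
      exact Continuous.continuousAt (by have := continuous_DeltaX (l := l) (p := p); fun_prop)
    refine this.congr ?_
    filter_upwards [hev] with y hy
    rw [angularOuter, indicator_of_mem hy]
  have hβ : ContinuousAt (angularInner l p m ξ lam) x := by
    have h1 : ContinuousAt (angularReduced l p m ξ) x :=
      (continuousOn_angularReduced hp m ξ).continuousAt (Icc_mem_nhds hx.1 hx.2)
    have : ContinuousAt (fun x => (1 - x ^ 2) ^ m * (angularReduced l p m ξ x - lam)) x :=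
      ContinuousAt.mul (by fun_prop) (h1.sub continuousAt_const)
    refine this.congr ?_
    filter_upwards [hev] with y hy
    rw [angularInner, indicator_of_mem hy]
  have h1 := h.hasDerivAt_sol (g := fun _ => (1 : ℝ)) (D := 1) measurable_const zero_le_one
    (fun y _ => by simp) hcx (hasDerivAt_const x (1 : ℝ)) hα hβ
  have h2 := h.hasDerivAt_inner (g := fun _ => (1 : ℝ)) (D := 1) measurable_const zero_le_one
    (fun y _ => by simp) hcx continuousAt_const hβ
  constructor
  · refine HasDerivAt.congr_deriv h1 ?_
    rw [zero_sub, angularOuter, indicator_of_mem hx]; rfl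
  · refine HasDerivAt.congr_deriv h2 ?_
    nth_rewrite 1 [angularInner]
    rw [indicator_of_mem hx]; rfl

lemma hasDerivAt_sqrt_pow (m : ℕ) {x : ℝ} (hx : x ∈ Ioo (-1 : ℝ) 1) :
    HasDerivAt (fun y => Real.sqrt (1 - y ^ 2) ^ m)
      (-(m * x / (1 - x ^ 2)) * Real.sqrt (1 - x ^ 2) ^ m) x := by
  have h0 := sq_lt_one_of_mem hx
  have h1 : HasDerivAt (fun y : ℝ => 1 - y ^ 2) (-(2 * x)) x := by
    simpa using (hasDerivAt_pow 2 x).const_sub 1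
  have h2 := (h1.sqrt h0.ne').pow m
  refine h2.congr_deriv ?_
  rcases m with _ | k
  · simp
  · have hs : Real.sqrt (1 - x ^ 2) ^ 2 = 1 - x ^ 2 := Real.sq_sqrt h0.le
    have hs0 : 0 < Real.sqrt (1 - x ^ 2) := Real.sqrt_pos.2 h0
    rw [← hs]
    set s := Real.sqrt (1 - x ^ 2)
    rw [show Real.sqrt (s ^ 2) = s from Real.sqrt_sq hs0.le]
    simp only [Nat.add_sub_cancel]
    push_cast
    field_simp
    ring

lemma isAngularPair_phi (hp : p ∈ paramSpace l) (m : ℕ) (ξ lam : ℝ) :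
    IsAngularPair l p m ξ lam (angularPhi l p m ξ lam) (angularFlux l p m ξ lam) := by
  intro x hx
  obtain ⟨hg, hh⟩ := hasDerivAt_angularG hp m ξ lam hx
  have hw := hasDerivAt_sqrt_pow m hx
  have h0 := sq_lt_one_of_mem hx
  have hD := DeltaX_pos hp (Ioo_subset_Icc_self hx)
  constructor
  · refine (hw.mul hg).congr_deriv ?_
    unfold angularFlux
    generalize angularG l p m ξ lam x = g at *
    generalize angularH l p m ξ lam x = h at *
    generalize Real.sqrt (1 - x ^ 2) ^ m = w at *
    generalize 1 - x ^ 2 = c at *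
    rw [pow_succ]
    field_simp
    ring
  · have hDx : HasDerivAt (fun y : ℝ => m * y * DeltaX l p y)
        (m * (1 - 3 * (spin l p ^ 2 / l ^ 2) * x ^ 2)) x := by
      unfold DeltaX
      have := ((hasDerivAt_id x).const_mul (m : ℝ)).mul
        (((hasDerivAt_pow 2 x).const_mul (spin l p ^ 2 / l ^ 2)).const_sub 1)
      refine this.congr_deriv ?_
      simp; ring
    have h1 : HasDerivAt (fun y : ℝ => (1 - y ^ 2) ^ m)
        (-(2 * x * m) * (1 - x ^ 2) ^ m / (1 - x ^ 2)) x := by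
      have := ((hasDerivAt_pow 2 x).const_sub 1).pow m
      refine this.congr_deriv ?_
      rcases m with _ | k
      · simp
      · simp only [Nat.add_sub_cancel, pow_succ]
        push_cast
        field_simp
    refine (hw.mul ((hDx.mul hg).neg.sub (hh.div h1 (pow_ne_zero _ h0.ne')))).congr_deriv ?_
    -- With Ξ = Δ_x - (a²/l²)(1 - x²), the pole m²Ξ²/(Δ_x(1 - x²)) of the potential cancels against
    -- m²x²Δ_x/(1 - x²), which comes from differentiating (1 - x²)^{m/2}. What remains is the
    -- regular coefficient `angularReduced`.
    have hX : Xi l p = DeltaX l p x - spin l p ^ 2 / l ^ 2 * (1 - x ^ 2) := by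
      unfold Xi DeltaX; ring
    simp only [angularPotential, angularReduced, angularPhi, Int.cast_natCast, Pi.sub_apply,
      Pi.neg_apply, Pi.mul_apply, Pi.div_apply]
    rw [hX]
    generalize angularG l p m ξ lam x = g at *
    generalize angularH l p m ξ lam x = h at *
    generalize Real.sqrt (1 - x ^ 2) ^ m = w at *
    generalize spin l p ^ 2 / l ^ 2 = κ at *
    generalize DeltaX l p x = d at *
    obtain ⟨c, hc⟩ : ∃ c, c = 1 - x ^ 2 := ⟨_, rfl⟩
    have hx3 : x ^ 2 = 1 - c := by rw [hc]; ring
    rw [← hc] at h0 ⊢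
    rw [hx3]
    have hC : 0 < c ^ m := by positivity
    rw [pow_succ]
    generalize c ^ m = C at *
    field_simp
    linear_combination (w * m ^ 2 * d ^ 2 * g * C) * hx3

end

/-! ### Wronskians of the angular equation and the eigenvalue condition -/

lemma eq_of_hasDerivAt_zero {E : Type*} [NormedAddCommGroup E] [NormedSpace ℝ E] {f : ℝ → E}
    {s : Set ℝ} (hs : IsOpen s) (hs' : IsPreconnected s)
    (hf : ∀ x ∈ s, HasDerivAt f 0 x) {x y : ℝ} (hx : x ∈ s) (hy : y ∈ s) : f x = f y :=
  hs.is_const_of_deriv_eq_zero hs' (fun x hx => (hf x hx).differentiableAt.differentiableWithinAt)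
    (fun x hx => (hf x hx).deriv) hx hy

section
variable {l : ℝ} {p : ℝ × ℝ} {m : ℕ} {ξ lam : ℝ} {f F g G : ℝ → ℝ}

lemma IsAngularPair.wronskian_eq (hp : p ∈ paramSpace l) (h₁ : IsAngularPair l p m ξ lam f F)
    (h₂ : IsAngularPair l p m ξ lam g G) {x y : ℝ} (hx : x ∈ Ioo (-1 : ℝ) 1)
    (hy : y ∈ Ioo (-1 : ℝ) 1) : f x * G x - F x * g x = f y * G y - F y * g y := by
  refine eq_of_hasDerivAt_zero (f := fun x => f x * G x - F x * g x) isOpen_Ioo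
    isPreconnected_Ioo (fun z hz => ?_) hx hy
  obtain ⟨a1, a2⟩ := h₁ z hz
  obtain ⟨b1, b2⟩ := h₂ z hz
  refine ((a1.mul b2).sub (a2.mul b1)).congr_deriv ?_
  have := sq_lt_one_of_mem hz
  have := DeltaX_pos hp (Ioo_subset_Icc_self hz)
  field_simp
  ring

lemma IsAngularPair.neg (h : IsAngularPair l p m ξ lam f F) :
    IsAngularPair l p m ξ lam (fun x => f (-x)) (fun x => -F (-x)) := by
  intro x hx
  obtain ⟨h1, h2⟩ := h (-x) ⟨by linarith [hx.2], by linarith [hx.1]⟩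
  have hP : angularPotential l p m ξ (-x) = angularPotential l p m ξ x := by
    simp [angularPotential, DeltaX]
  constructor
  · refine (h1.comp_of_eq x (hasDerivAt_neg x) rfl).congr_deriv ?_
    simp [DeltaX]; ring
  · refine (h2.comp_of_eq x (hasDerivAt_neg x) rfl).neg.congr_deriv ?_
    rw [hP]; ring

lemma IsAngularPair.hasDerivAt_div (hp : p ∈ paramSpace l) (h₁ : IsAngularPair l p m ξ lam f F)
    (h₂ : IsAngularPair l p m ξ lam g G) {x : ℝ} (hx : x ∈ Ioo (-1 : ℝ) 1) (hg : g x ≠ 0) :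
    HasDerivAt (fun y => f y / g y)
      (-(f x * G x - F x * g x) / (DeltaX l p x * (1 - x ^ 2) * g x ^ 2)) x := by
  refine ((h₁ x hx).1.div (h₂ x hx).1 hg).congr_deriv ?_
  have := sq_lt_one_of_mem hx
  have := DeltaX_pos hp (Ioo_subset_Icc_self hx)
  field_simp
  ring

lemma IsAngularEigenfunction.isAngularPair
    (h : IsAngularEigenfunction l p m ξ lam f) (hp : p ∈ paramSpace l) :
    IsAngularPair l p m ξ lam f (fun y => DeltaX l p y * (1 - y ^ 2) * deriv f y) := by
  intro x hx
  refine ⟨(h.diff x hx).hasDerivAt.congr_deriv ?_, h.ode x hx⟩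
  have := sq_lt_one_of_mem hx
  have := DeltaX_pos hp (Ioo_subset_Icc_self hx)
  field_simp

lemma abs_angularG_le (hp : p ∈ paramSpace l) (m : ℕ) (ξ lam : ℝ) {c : ℝ} (hc : -1 < c) :
    ∃ D, 0 ≤ D ∧ ∀ x, c < x → |angularG l p m ξ lam x| ≤ D := by
  obtain ⟨b, γ, C, hV⟩ := angular_volterraBound hp m ξ |lam| hc
  exact ⟨1 * Real.exp (2 * C), by positivity, fun x hx =>
    (hV lam le_rfl).abs_sol_le (g := fun _ => (1 : ℝ)) zero_le_one (fun y _ => by simp) hx⟩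

/-- The Volterra estimate gives |g - 1| ≤ C e^{2C}(1 - x); the threshold x₁ makes the right side at
most 1/2. -/
lemma angularG_near_one (hp : p ∈ paramSpace l) (m : ℕ) (ξ lam : ℝ) :
    ∃ x₁, 0 < x₁ ∧ x₁ < 1 ∧ ∀ x, x₁ < x → x < 1 →
      1 / 2 ≤ angularG l p m ξ lam x ∧ angularG l p m ξ lam x ≤ 3 / 2 := by
  obtain ⟨b, γ, C, hV⟩ := angular_volterraBound hp m ξ |lam| (show (-1 : ℝ) < 0 by norm_num)
  have h := hV lam le_rfl
  set K := |1 * Real.exp (2 * C) * C| + 1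
  have hK : 1 ≤ K := by simp only [K]; linarith [abs_nonneg (1 * Real.exp (2 * C) * C)]
  refine ⟨1 - 1 / (2 * K), ?_, ?_, fun x h1 h2 => ?_⟩
  · rw [sub_pos, div_lt_one (by positivity)]; linarith
  · linarith [show 0 < 1 / (2 * K) by positivity]
  · have hx0 : 0 < x := by
      have : 1 / (2 * K) < 1 := by rw [div_lt_one (by positivity)]; linarith
      linarith
    have h3 := h.abs_sol_sub_le (g := fun _ => (1 : ℝ)) (D := 1) measurable_const zero_le_one
      (fun y _ => by simp) hx0
    have h4 : 1 * Real.exp (2 * C) * (C * max (1 - x) 0) ≤ 1 / 2 := by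
      rw [max_eq_left (by linarith), ← mul_assoc]
      have h5 : 1 * Real.exp (2 * C) * C ≤ K := (le_abs_self _).trans (by simp [K])
      have h6 : 1 - x ≤ 1 / (2 * K) := by linarith
      calc _ ≤ K * (1 / (2 * K)) := by
            apply mul_le_mul h5 h6 (by linarith) (by linarith)
        _ = 1 / 2 := by field_simp
    have h7 := abs_le.1 (h3.trans h4)
    unfold angularG
    exact ⟨by linarith [h7.1], by linarith [h7.2]⟩

/-- Square integrability at x = 1 singles out the recessive solution. If the Wronskian κ were
nonzero, (f/φ)' would have size at least a multiple of (1 - x)^{-m-1}, whence |f/φ| ≳ (1 - x)^{-m}.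
As φ² is comparable to (1 - x)^m, f² ≳ (1 - x)^{-m} would dominate (1 - x)⁻¹, which is not
integrable. For m = 0 this growth is only logarithmic, hence the restriction m ≥ 1. -/
lemma wronskian_phi_eq_zero (hp : p ∈ paramSpace l) (hm : 1 ≤ m)
    (h : IsAngularPair l p m ξ lam f F)
    (hL : MemLp f 2 (volume.restrict (Ioo (-1 : ℝ) 1))) {x : ℝ} (hx : x ∈ Ioo (-1 : ℝ) 1) :
    f x * angularFlux l p m ξ lam x - F x * angularPhi l p m ξ lam x = 0 := by
  set φ := angularPhi l p m ξ lam
  set Φ := angularFlux l p m ξ lam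
  have hφ : IsAngularPair l p m ξ lam φ Φ := isAngularPair_phi hp m ξ lam
  by_contra hne
  set κ := f x * Φ x - F x * φ x with hκ
  obtain ⟨x₁, h10, h11, hg⟩ := angularG_near_one hp m ξ lam
  have hκ2 : 0 < κ ^ 2 := by positivity
  have hm0 : (0 : ℝ) < m := by exact_mod_cast hm
  -- Chosen so that the derivative of c₀(1 - y)^{-m} equals the lower bound for u' that follows from
  -- Δ_x ≤ 1, 1 - y² ≤ 2(1 - y) and φ² ≤ (9/4)(1 - y²)^m.
  set c₀ := κ ^ 2 * (4 / 9) / (2 ^ (m + 1) * m) with hc₀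
  have hc₀0 : 0 < c₀ := by positivity
  have hφ2 : ∀ y, x₁ < y → y < 1 → 1 / 4 * (1 - y ^ 2) ^ m ≤ φ y ^ 2 ∧
      φ y ^ 2 ≤ 9 / 4 * (1 - y ^ 2) ^ m := by
    intro y h1 h2
    obtain ⟨g1, g2⟩ := hg y h1 h2
    have h3 : 0 < 1 - y ^ 2 := by nlinarith
    have h4 : φ y ^ 2 = (1 - y ^ 2) ^ m * angularG l p m ξ lam y ^ 2 := by
      simp only [φ, angularPhi]
      rw [mul_pow, ← pow_mul, mul_comm m 2, pow_mul, Real.sq_sqrt h3.le]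
    have h5 : 0 < (1 - y ^ 2) ^ m := by positivity
    have h6 : 1 / 4 ≤ angularG l p m ξ lam y ^ 2 := by nlinarith
    have h7 : angularG l p m ξ lam y ^ 2 ≤ 9 / 4 := by nlinarith
    rw [h4, mul_comm (1 / 4 : ℝ), mul_comm (9 / 4 : ℝ)]
    constructor <;> gcongr
  have hφ0 : ∀ y, x₁ < y → y < 1 → 0 < φ y ^ 2 := by
    intro y h1 h2
    have h3 : 0 < 1 - y ^ 2 := by nlinarith
    exact lt_of_lt_of_le (by positivity) (hφ2 y h1 h2).1
  set u : ℝ → ℝ := fun y => -κ * (f y / φ y)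
  have hu : ∀ y ∈ Ioo x₁ 1, HasDerivAt u (κ ^ 2 / (DeltaX l p y * (1 - y ^ 2) * φ y ^ 2)) y := by
    intro y hy
    have hy' : y ∈ Ioo (-1 : ℝ) 1 := ⟨by linarith [hy.1], hy.2⟩
    refine ((h.hasDerivAt_div hp hφ hy' (fun h0 => ?_)).const_mul (-κ)).congr_deriv ?_
    · have := hφ0 y hy.1 hy.2; rw [h0] at this; norm_num at this
    · rw [h.wronskian_eq hp hφ hy' hx, ← hκ]; ring
  have hmono : MonotoneOn (fun y => u y - c₀ * ((1 - y) ^ m)⁻¹) (Ioo x₁ 1) := by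
    have hder : ∀ y ∈ Ioo x₁ 1, HasDerivAt (fun y => u y - c₀ * ((1 - y) ^ m)⁻¹)
        (κ ^ 2 / (DeltaX l p y * (1 - y ^ 2) * φ y ^ 2) - c₀ * (m / (1 - y) ^ (m + 1))) y := by
      intro y hy
      have h1 : 1 - y ≠ 0 := by linarith [hy.2]
      refine (hu y hy).sub (HasDerivAt.const_mul c₀ ?_)
      have := (((hasDerivAt_id y).const_sub 1).pow m).inv (pow_ne_zero m h1)
      refine this.congr_deriv ?_
      obtain ⟨k, rfl⟩ : ∃ k, m = k + 1 := ⟨m - 1, by omega⟩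
      simp only [id, Nat.add_sub_cancel, Pi.pow_apply]
      field_simp
      ring
    refine monotoneOn_of_deriv_nonneg (convex_Ioo _ _)
      (fun y hy => (hder y hy).continuousAt.continuousWithinAt) ?_ ?_
    · rw [interior_Ioo]
      exact fun y hy => (hder y hy).differentiableAt.differentiableWithinAt
    · rw [interior_Ioo]
      intro y hy
      rw [(hder y hy).deriv, sub_nonneg]
      have h1 : 0 < 1 - y := by linarith [hy.2]
      have h2 : 0 < 1 - y ^ 2 := by nlinarith [hy.1]
      have h3 := DeltaX_pos hp (x := y) ⟨by linarith [hy.1], hy.2.le⟩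
      have h4 := DeltaX_le_one (l := l) (p := p) y
      have h5 := hφ0 y hy.1 hy.2
      have h6 : DeltaX l p y * (1 - y ^ 2) * φ y ^ 2 ≤ 1 * (2 * (1 - y)) *
          (9 / 4 * (2 * (1 - y)) ^ m) := by
        gcongr
        · nlinarith
        · refine (hφ2 y hy.1 hy.2).2.trans ?_
          gcongr
          nlinarith
      calc c₀ * (m / (1 - y) ^ (m + 1)) = κ ^ 2 / (1 * (2 * (1 - y)) *
          (9 / 4 * (2 * (1 - y)) ^ m)) := by
            rw [hc₀, mul_pow, pow_succ, pow_succ]; field_simp; ring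
        _ ≤ _ := by gcongr
  set x₂ := (x₁ + 1) / 2
  have hx₂ : x₂ ∈ Ioo x₁ 1 := ⟨by simp only [x₂]; linarith, by simp only [x₂]; linarith⟩
  set B := |u x₂ - c₀ * ((1 - x₂) ^ m)⁻¹| + 1
  have hB : 1 ≤ B := by simp [B]
  -- To the right of x₃ half of c₀(1 - y)^{-m} outweighs the constant B left over from the
  -- monotonicity comparison.
  set x₃ := max x₂ (1 - c₀ / (2 * B))
  have hx₃ : x₃ < 1 := max_lt hx₂.2 (by linarith [show 0 < c₀ / (2 * B) by positivity])
  have hlow : ∀ y ∈ Ioo x₃ 1, c₀ ^ 2 / (16 * κ ^ 2) * (1 - y)⁻¹ ≤ f y ^ 2 := by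
    intro y hy
    have hy2 : x₂ < y := (le_max_left _ _).trans_lt hy.1
    have hy1 : x₁ < y := hx₂.1.trans hy2
    have hyB : 1 - c₀ / (2 * B) < y := (le_max_right _ _).trans_lt hy.1
    have h1 : 0 < 1 - y := by linarith [hy.2]
    have h1' : 1 - y ≤ 1 := by linarith
    have hpow : (1 - y) ^ m ≤ 1 - y := by
      simpa using pow_le_pow_of_le_one h1.le h1' hm
    have hpos : 0 < (1 - y) ^ m := by positivity
    have h2 := hmono hx₂ ⟨hy1, hy.2⟩ hy2.le
    simp only at h2
    have h3 : -B ≤ u x₂ - c₀ * ((1 - x₂) ^ m)⁻¹ := by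
      have := neg_abs_le (u x₂ - c₀ * ((1 - x₂) ^ m)⁻¹)
      simp only [B]; linarith
    have h4 : B ≤ c₀ / 2 * ((1 - y) ^ m)⁻¹ := by
      rw [← div_eq_mul_inv, le_div_iff₀ hpos]
      have : 1 - y < c₀ / (2 * B) := by linarith
      rw [lt_div_iff₀ (by positivity)] at this
      nlinarith
    have h5 : c₀ / 2 * ((1 - y) ^ m)⁻¹ ≤ u y := by linarith
    have h6 := hφ2 y hy1 hy.2
    have h7 : κ ^ 2 * f y ^ 2 = u y ^ 2 * φ y ^ 2 := by
      have hne' : φ y ≠ 0 := fun h0 => by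
        have := hφ0 y hy1 hy.2; rw [h0] at this; norm_num at this
      simp only [u]; field_simp
    have h8 : (c₀ / 2 * ((1 - y) ^ m)⁻¹) ^ 2 ≤ u y ^ 2 := pow_le_pow_left₀ (by positivity) h5 2
    have h9 : 1 / 4 * (1 - y) ^ m ≤ φ y ^ 2 := by
      refine le_trans ?_ h6.1
      gcongr
      nlinarith
    have h10 : (c₀ / 2 * ((1 - y) ^ m)⁻¹) ^ 2 * (1 / 4 * (1 - y) ^ m) ≤ κ ^ 2 * f y ^ 2 := by
      rw [h7]; gcongr
    have h11 : (c₀ / 2 * ((1 - y) ^ m)⁻¹) ^ 2 * (1 / 4 * (1 - y) ^ m) =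
        c₀ ^ 2 / 16 * ((1 - y) ^ m)⁻¹ := by field_simp; ring
    have h12 : (1 - y)⁻¹ ≤ ((1 - y) ^ m)⁻¹ := by gcongr
    have h13 : c₀ ^ 2 / 16 * (1 - y)⁻¹ ≤ κ ^ 2 * f y ^ 2 := by
      rw [h11] at h10
      refine le_trans ?_ h10
      gcongr
    calc c₀ ^ 2 / (16 * κ ^ 2) * (1 - y)⁻¹ = (c₀ ^ 2 / 16 * (1 - y)⁻¹) / κ ^ 2 := by
          field_simp
      _ ≤ _ := by rw [div_le_iff₀ hκ2]; linarith
  have hx₃0 : -1 < x₃ := lt_of_lt_of_le (by linarith [hx₂.1]) (le_max_left _ _)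
  have hint : IntegrableOn (fun y => f y ^ 2) (Ioo x₃ 1) :=
    IntegrableOn.mono_set (t := Ioo (-1 : ℝ) 1) hL.integrable_sq (Ioo_subset_Ioo_left hx₃0.le)
  have hint2 : IntegrableOn (fun y : ℝ => (y - 1)⁻¹) (Ioo x₃ 1) := by
    refine Integrable.mono' (hint.const_mul (16 * κ ^ 2 / c₀ ^ 2))
      (by fun_prop) ?_
    filter_upwards [ae_restrict_mem measurableSet_Ioo] with y hy
    rw [norm_inv, Real.norm_eq_abs, abs_sub_comm, abs_of_pos (by linarith [hy.2])]
    have := hlow y hy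
    calc (1 - y)⁻¹ = 16 * κ ^ 2 / c₀ ^ 2 * (c₀ ^ 2 / (16 * κ ^ 2) * (1 - y)⁻¹) := by
          field_simp
      _ ≤ _ := by gcongr
  have hiv : IntervalIntegrable (fun y : ℝ => (y - 1)⁻¹) volume x₃ 1 := by
    rw [intervalIntegrable_iff_integrableOn_Ioo_of_le hx₃.le]
    exact hint2
  rw [intervalIntegrable_sub_inv_iff] at hiv
  rcases hiv with h0 | h0
  · exact hx₃.ne h0
  · exact h0 right_mem_uIcc

lemma angularPhi_zero : angularPhi l p m ξ lam 0 = angularG l p m ξ lam 0 := by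
  simp [angularPhi]

lemma angularFlux_zero : angularFlux l p m ξ lam 0 = -angularH l p m ξ lam 0 := by
  simp [angularFlux]

/-- The equation is even, so φ(-x) is the solution recessive at x = -1. An eigenvalue means that it
is proportional to φ, that is, their Wronskian vanishes; at x = 0 this Wronskian is 2g(0)h(0). The
two factors correspond to odd and even eigenfunctions. -/
lemma mem_angularSpectrum_iff (hp : p ∈ paramSpace l) (hm : 1 ≤ m) :
    lam ∈ angularSpectrum l p m ξ ↔ angularG l p m ξ lam 0 * angularH l p m ξ lam 0 = 0 := by
  have hφ : IsAngularPair l p m ξ lam _ _ := isAngularPair_phi hp m ξ lam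
  have h00 : (0 : ℝ) ∈ Ioo (-1 : ℝ) 1 := by norm_num
  have hneg : ∀ x ∈ Ioo (-1 : ℝ) 1, -x ∈ Ioo (-1 : ℝ) 1 := fun x hx =>
    ⟨by linarith [hx.2], by linarith [hx.1]⟩
  have hW : ∀ x ∈ Ioo (-1 : ℝ) 1, angularPhi l p m ξ lam x * -angularFlux l p m ξ lam (-x) -
      angularFlux l p m ξ lam x * angularPhi l p m ξ lam (-x) =
      2 * (angularG l p m ξ lam 0 * angularH l p m ξ lam 0) := by
    intro x hx
    rw [hφ.wronskian_eq hp hφ.neg hx h00, neg_zero, angularPhi_zero, angularFlux_zero]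
    ring
  constructor
  · rintro ⟨f, hf⟩
    by_contra hne
    have hfp := hf.isAngularPair hp
    obtain ⟨x, hx, hfx⟩ := hf.ne_zero
    have e1 := wronskian_phi_eq_zero hp hm hfp hf.memLp hx
    have hL : MemLp (fun x => f (-x)) 2 (volume.restrict (Ioo (-1 : ℝ) 1)) := by
      have hmp : MeasurePreserving (fun x : ℝ => -x) (volume.restrict (Ioo (-1 : ℝ) 1))
          (volume.restrict (Ioo (-1 : ℝ) 1)) := by
        have := (Measure.measurePreserving_neg (volume : Measure ℝ)).restrict_preimage
          (measurableSet_Ioo (a := (-1 : ℝ)) (b := 1))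
        simpa using this
      exact hf.memLp.comp_measurePreserving hmp
    have e2 := wronskian_phi_eq_zero hp hm hfp.neg hL (hneg x hx)
    simp only [neg_neg] at e2
    have e3 := hW x hx
    apply hfx
    -- An eigenfunction has zero Wronskian with both φ(x) and φ(-x). Eliminating its derivative
    -- leaves f(x) times the Wronskian of these two.
    have h4 : f x * (2 * (angularG l p m ξ lam 0 * angularH l p m ξ lam 0)) = 0 := by
      rw [← e3]
      linear_combination -angularPhi l p m ξ lam x * e2 - angularPhi l p m ξ lam (-x) * e1
    exact (mul_eq_zero.1 h4).resolve_right (mul_ne_zero two_ne_zero hne)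
  · intro h0
    rw [h0, mul_zero] at hW
    set φ := angularPhi l p m ξ lam with hφdef
    obtain ⟨x₁, h10, h11, hg⟩ := angularG_near_one hp m ξ lam
    have hφpos : ∀ x, x₁ < x → x < 1 → 0 < φ x := by
      intro x h1 h2
      have : 0 < 1 - x ^ 2 := by nlinarith
      have h3 := (hg x h1 h2).1
      have h4 : 0 < Real.sqrt (1 - x ^ 2) := Real.sqrt_pos.2 this
      exact mul_pos (by positivity) (by linarith)
    have hbd : ∀ c, -1 < c → ∃ D, ∀ x, c < x → x < 1 → |φ x| ≤ D := by
      intro c hc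
      obtain ⟨D, hD0, hD⟩ := abs_angularG_le hp m ξ lam hc
      refine ⟨D, fun x h1 h2 => ?_⟩
      simp only [hφdef, angularPhi, abs_mul]
      have : |Real.sqrt (1 - x ^ 2) ^ m| ≤ 1 := by
        rw [abs_of_nonneg (by positivity)]
        refine pow_le_one₀ (Real.sqrt_nonneg _) ?_
        rw [Real.sqrt_le_one]
        nlinarith
      calc _ ≤ 1 * D := mul_le_mul this (hD x h1) (abs_nonneg _) zero_le_one
        _ = D := one_mul D
    set c := -(x₁ + 1) / 2
    have hc1 : -1 < c := by simp only [c]; linarith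
    have hc2 : c < -x₁ := by simp only [c]; linarith
    obtain ⟨D, hD⟩ := hbd c hc1
    set k := φ c / φ (-c)
    -- The vanishing Wronskian makes φ(x)/φ(-x) constant near x = -1, so boundedness of φ near 1
    -- transfers to -1 and φ is square integrable.
    have hratio : ∀ x ∈ Ioo (-1) (-x₁), φ x / φ (-x) = k := by
      intro x hx
      refine eq_of_hasDerivAt_zero (f := fun x => φ x / φ (-x)) isOpen_Ioo isPreconnected_Ioo
        (fun y hy => ?_) hx ⟨hc1, hc2⟩
      have hy' : y ∈ Ioo (-1 : ℝ) 1 := ⟨hy.1, by linarith [hy.2]⟩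
      have := hφ.hasDerivAt_div hp hφ.neg hy'
        (hφpos (-y) (by linarith [hy.2]) (by linarith [hy.1])).ne'
      refine this.congr_deriv ?_
      rw [hW y hy', neg_zero, zero_div]
    have hbound : ∀ x ∈ Ioo (-1 : ℝ) 1, |φ x| ≤ max D (|k| * D) := by
      intro x hx
      rcases le_or_gt x c with h1 | h1
      · refine le_max_of_le_right ?_
        have h2 := hratio x ⟨hx.1, by linarith⟩
        have h3 := hφpos (-x) (by linarith) (by linarith [hx.1])
        rw [div_eq_iff h3.ne'] at h2
        rw [h2, abs_mul]
        exact mul_le_mul_of_nonneg_left (hD _ (by linarith) (by linarith [hx.1])) (abs_nonneg _)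
      · exact le_max_of_le_left (hD x h1 hx.2)
    have hder : ∀ x ∈ Ioo (-1 : ℝ) 1,
        DeltaX l p x * (1 - x ^ 2) * deriv φ x = angularFlux l p m ξ lam x := by
      intro x hx
      rw [(hφ x hx).1.deriv]
      have := sq_lt_one_of_mem hx
      have := DeltaX_pos hp (Ioo_subset_Icc_self hx)
      field_simp
    refine ⟨φ, ⟨(x₁ + 1) / 2, ⟨by linarith, by linarith⟩,
      (hφpos _ (by linarith) (by linarith)).ne'⟩, ?_, fun x hx => (hφ x hx).1.differentiableAt,
      fun x hx => ?_, fun h => ?_, fun h => ?_⟩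
    · refine MemLp.of_bound ?_ (max D (|k| * D)) ?_
      · exact ContinuousOn.aestronglyMeasurable
          (fun x hx => (hφ x hx).1.continuousAt.continuousWithinAt) measurableSet_Ioo
      · filter_upwards [ae_restrict_mem measurableSet_Ioo] with x hx using hbound x hx
    · refine (hφ x hx).2.congr_of_eventuallyEq ?_
      filter_upwards [Ioo_mem_nhds hx.1 hx.2] with y hy using hder y hy
    · exfalso; have : (m : ℤ) ≠ 0 := by exact_mod_cast (by omega : m ≠ 0)
      exact this h
    · exfalso; have : (m : ℤ) ≠ 0 := by exact_mod_cast (by omega : m ≠ 0)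
      exact this h

/-! ### Measurability of the angular eigenvalues -/

lemma continuous_angularDet (hp : p ∈ paramSpace l) (m : ℕ) (ξ : ℝ) :
    Continuous fun lam => angularG l p m ξ lam 0 * angularH l p m ξ lam 0 := by
  rw [continuous_iff_continuousAt]
  intro lam
  obtain ⟨b, γ, C, hV⟩ := angular_volterraBound hp m ξ (|lam| + 1) (show (-1 : ℝ) < -1 / 2 by norm_num)
  set Z := {t : ℝ // |t| < |lam| + 1}
  have : Nonempty Z := ⟨⟨lam, by simp⟩⟩
  have h := continuous_volterraSol (Z := Z) (β := fun z => angularInner l p m ξ z.1)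
    (g := fun _ => (1 : ℝ)) (D := 1) (fun z => hV z.1 z.2.le) (fun t => ?_) measurable_const
    zero_le_one (fun y _ => by simp) (show (-1 / 2 : ℝ) < 0 by norm_num)
  · have hopen : IsOpen {t : ℝ | |t| < |lam| + 1} := isOpen_lt continuous_abs continuous_const
    have h2 : ContinuousOn (fun lam => angularG l p m ξ lam 0 * angularH l p m ξ lam 0)
        {t : ℝ | |t| < |lam| + 1} := by
      rw [continuousOn_iff_continuous_domRestrict]
      exact h.1.mul h.2
    exact h2.continuousAt (hopen.mem_nhds (by simp))
  · by_cases ht : t ∈ Ioo (-1 : ℝ) 1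
    · simp only [angularInner, indicator_of_mem ht]
      exact continuous_const.mul (continuous_const.sub continuous_subtype_val)
    · simp only [angularInner, indicator_of_notMem ht]
      exact continuous_const

lemma continuousOn_omegaMinus (hl : 0 < l) : ContinuousOn (omegaMinus l) (paramSpace l) := by
  have h1 := continuousOn_rMinus hl
  have h2 := continuous_spin l
  have h3 := continuous_Xi l
  unfold omegaMinus omegaAt
  refine ContinuousOn.div (by fun_prop) (by fun_prop) fun p hp => ?_
  have := spin_pos hp
  positivity

lemma measurable_angularOuter_comp {Z : Type*} [MeasurableSpace Z] {P : Z → ℝ × ℝ}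
    (hP : Measurable P) : Measurable (Function.uncurry fun z => angularOuter l (P z) m) := by
  have e : (Function.uncurry fun z => angularOuter l (P z) m) =
      (Function.uncurry fun p : ℝ × ℝ => angularOuter l p m) ∘ fun q : Z × ℝ => (P q.1, q.2) := by
    funext q; rw [Function.comp_apply, Function.uncurry, Function.uncurry]
  rw [e]
  exact Measurable.comp (measurable_angularOuter m)
    ((hP.comp measurable_fst).prodMk measurable_snd)

lemma measurable_angularInner_comp {Z : Type*} [MeasurableSpace Z] {P : Z → ℝ × ℝ}
    {ξ t : Z → ℝ} (hP : Measurable P) (hξ : Measurable ξ) (ht : Measurable t) :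
    Measurable (Function.uncurry fun z => angularInner l (P z) m (ξ z) (t z)) := by
  have e : (Function.uncurry fun z => angularInner l (P z) m (ξ z) (t z)) =
      (Function.uncurry fun z : (ℝ × ℝ) × ℝ × ℝ => angularInner l z.1 m z.2.1 z.2.2) ∘
        fun q : Z × ℝ => ((P q.1, ξ q.1, t q.1), q.2) := by
    funext q; rw [Function.comp_apply, Function.uncurry, Function.uncurry]
  rw [e]
  exact Measurable.comp (measurable_angularInner m)
    (((hP.prodMk (hξ.prodMk ht)).comp measurable_fst).prodMk measurable_snd)

/-- The eigenvalue is the infimum of those c with at least ℓ - m + 1 zeros of g(0)h(0) in (-∞, c].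
These zeros are counted measurably, and the set of such c is upward closed, so rational c suffice.
-/
lemma measurable_lamMinus (hl : 0 < l) (hm : 1 ≤ m) (ℓ : ℕ) :
    Measurable fun z : paramSpace l => lamMinus l z m ℓ := by
  have hω : Measurable fun z : paramSpace l => omegaMinus l z :=
    (continuousOn_iff_continuous_domRestrict.1 (continuousOn_omegaMinus hl)).measurable
  have hξ : Measurable fun z : paramSpace l => spin l z * omegaMinus l z * (m : ℤ) :=
    (((continuous_spin l).measurable.comp measurable_subtype_coe).mul hω).mul_const _
  unfold lamMinus angularEigenvalue
  refine measurable_sInf_of_rat (fun c => ?_) (fun z c hc x hcx => ?_)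
  · have hα := measurable_angularOuter_comp (l := l) (m := m)
      (measurable_subtype_coe (p := (· ∈ paramSpace l)))
    have hβ := fun t : ℝ => measurable_angularInner_comp (l := l) (m := m)
      (measurable_subtype_coe (p := (· ∈ paramSpace l))) hξ (measurable_const (a := t))
    have hmeas := measurableSet_zero_count (Z := paramSpace l)
      (F := fun z t => angularG l z m (spin l z * omegaMinus l z * (m : ℤ)) t 0 *
        angularH l z m (spin l z * omegaMinus l z * (m : ℤ)) t 0) (fun t => ?_)
      (fun z => continuous_angularDet z.2 m _) (ℓ - (m : ℤ).natAbs + 1) c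
    · convert hmeas using 3 with z
      rw [mem_ofPred_eq]
      congr! 3
      ext t
      exact mem_angularSpectrum_iff z.2 hm
    · have hb : ∀ z : paramSpace l, ∃ c b γ G A D, VolterraBound c (angularOuter l z m)
          (angularInner l z m (spin l z * omegaMinus l z * (m : ℤ)) t) b γ G A ∧ c < 0 ∧ 0 ≤ D ∧
          ∀ y, c < y → |(1 : ℝ)| ≤ D := by
        intro z
        obtain ⟨b, γ, C, hV⟩ := angular_volterraBound z.2 m (spin l z * omegaMinus l z * (m : ℤ)) |t|
          (show (-1 : ℝ) < -1 / 2 by norm_num)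
        exact ⟨-1 / 2, b, γ, _, _, 1, hV t le_rfl, by norm_num, zero_le_one, by simp⟩
      exact (measurable_volterraSol_at hα (hβ t) (g := fun _ _ => (1 : ℝ)) measurable_const
        (x := fun _ => (0 : ℝ)) measurable_const hb).mul
        (measurable_inner_volterraSol_at hα (hβ t) (g := fun _ _ => (1 : ℝ)) measurable_const
        (x := fun _ => (0 : ℝ)) measurable_const hb)
  · obtain ⟨q, hq1, hq2⟩ := exists_rat_btwn hcx
    refine ⟨q, hq2, le_trans (α := ℕ∞) hc (encard_le_encard ?_)⟩
    exact inter_subset_inter_right _ (Iic_subset_Iic.2 hq1.le)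

end

section
variable {l : ℝ} {p : ℝ × ℝ}

/-! ### The vector field `Γ` -/

/-- `Γ M`, the derivative of the mass in `ϑ`. -/
def gammaMass (l : ℝ) (p : ℝ × ℝ) : ℝ :=
  (3 * rMinus l p ^ 2 / l ^ 2 + (1 + spin l p ^ 2 / l ^ 2) - spin l p ^ 2 / rMinus l p ^ 2) / 2 *
    (-(rMinus l p ^ 2 + spin l p ^ 2) ^ 2 / (2 * rMinus l p * (Xi l p * spin l p ^ 2)))

lemma hasDerivAt_massOfRoot {a t : ℝ} (hl : 0 < l) (ht : 0 < t) :
    HasDerivAt (massOfRoot l a)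
      ((3 * t ^ 2 / l ^ 2 + (1 + a ^ 2 / l ^ 2) - a ^ 2 / t ^ 2) / 2) t := by
  unfold massOfRoot
  have h1 : HasDerivAt (fun t : ℝ => a ^ 2 + t ^ 2) (2 * t) t := by
    simpa using (hasDerivAt_pow 2 t).const_add (a ^ 2)
  have h2 : HasDerivAt (fun t : ℝ => 1 + t ^ 2 / l ^ 2) (2 * t / l ^ 2) t := by
    simpa using ((hasDerivAt_pow 2 t).div_const (l ^ 2)).const_add 1
  have h3 : HasDerivAt (fun t : ℝ => 2 * t) 2 t := by
    simpa using (hasDerivAt_id t).const_mul (2 : ℝ)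
  refine ((h1.mul h2).div h3 (by positivity)).congr_deriv ?_
  simp only [Pi.mul_apply]
  field_simp
  ring

/-- At fixed 𝔞 the coordinates invert explicitly: r₋ = √(Ξa²/s - a²), and the mass is the one for
which this is a root of Δ. Openness of 𝒫 keeps the curve inside for s near ϑ(p). -/
lemma flowLine (hl : 0 < l) (hp : p ∈ paramSpace l) :
    HasDerivAt (fun s => mass l (coordInv l s p.2)) (gammaMass l p) (theta l p) ∧
    ∀ᶠ s in 𝓝 (theta l p), coordInv l s p.2 ∈ paramSpace l ∧ (coordInv l s p.2).2 = p.2 ∧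
      theta l (coordInv l s p.2) = s := by
  set a := spin l p with ha
  set X := Xi l p with hX
  set t₀ := rMinus l p with ht₀
  set θ := theta l p with hθ
  have ha0 : 0 < a := spin_pos hp
  have hX0 : 0 < X := Xi_pos hp
  have ht0 : 0 < t₀ := rMinus_pos hl hp
  have hθ0 : 0 < θ := theta_pos hp
  have hθe : θ = X * a ^ 2 / (t₀ ^ 2 + a ^ 2) := theta_eq_div hp
  set t : ℝ → ℝ := fun s => Real.sqrt (X * a ^ 2 / s - a ^ 2) with ht
  have harg : X * a ^ 2 / θ - a ^ 2 = t₀ ^ 2 := by rw [hθe]; field_simp; ring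
  have htθ : t θ = t₀ := by simp only [ht]; rw [harg, Real.sqrt_sq ht0.le]
  have hdt : HasDerivAt t (-(t₀ ^ 2 + a ^ 2) ^ 2 / (2 * t₀ * (X * a ^ 2))) θ := by
    have h1 : HasDerivAt (fun s : ℝ => X * a ^ 2 / s - a ^ 2) (-(X * a ^ 2) / θ ^ 2) θ := by
      have := ((hasDerivAt_inv hθ0.ne').const_mul (X * a ^ 2)).sub_const (a ^ 2)
      simp only [← div_eq_mul_inv] at this
      refine this.congr_deriv ?_
      field_simp
    have h2 := h1.sqrt (by rw [harg]; positivity)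
    refine h2.congr_deriv ?_
    rw [harg, Real.sqrt_sq ht0.le, hθe]
    field_simp
  set q : ℝ → ℝ × ℝ := fun s => (massOfRoot l a (t s) * Real.sqrt 3 / l, p.2) with hq
  have h3 : (0 : ℝ) < Real.sqrt 3 := by positivity
  have hmass : ∀ s, mass l (q s) = massOfRoot l a (t s) := by
    intro s; simp only [hq, mass]; field_simp
  have hspin : ∀ s, spin l (q s) = a := fun s => rfl
  have hdM : HasDerivAt (fun s => massOfRoot l a (t s)) (gammaMass l p) θ := by
    have h1 := hasDerivAt_massOfRoot (a := a) hl ht0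
    exact HasDerivAt.comp_of_eq θ h1 hdt htθ.symm
  have hqθ : q θ = p := by
    refine Prod.ext ((mass_inj hl).1 ?_) rfl
    rw [hmass, htθ, mass_eq hl hp]
  have hqc : ContinuousAt q θ :=
    ((hdM.continuousAt.mul continuousAt_const).div_const l).prodMk continuousAt_const
  have hP : ∀ᶠ s in 𝓝 θ, q s ∈ paramSpace l := by
    have : paramSpace l ∈ 𝓝 (q θ) := by rw [hqθ]; exact (isOpen_paramSpace hl).mem_nhds hp
    exact hqc.eventually this
  have hrp : ContinuousAt (rPlus l) (q θ) := by
    rw [hqθ]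
    exact (continuousOn_rPlus hl).continuousAt ((isOpen_paramSpace hl).mem_nhds hp)
  have hrp' : ContinuousAt (fun s => rPlus l (q s)) θ := hrp.comp hqc
  -- Being a root is not enough: staying below r₊ along the curve identifies t(s) as r₋.
  have hlt : ∀ᶠ s in 𝓝 θ, t s < rPlus l (q s) := by
    refine hdt.continuousAt.eventually_lt hrp' ?_
    rw [htθ, hqθ]; exact rMinus_lt_rPlus hl hp
  have hpos : ∀ᶠ s in 𝓝 θ, 0 < t s := hdt.continuousAt.eventually_const_lt (by rw [htθ]; exact ht0)
  have hs0 : ∀ᶠ s in 𝓝 θ, 0 < s := eventually_gt_nhds hθ0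
  have hth : ∀ᶠ s in 𝓝 θ, q s ∈ paramSpace l ∧ theta l (q s) = s := by
    filter_upwards [hP, hlt, hpos, hs0] with s h1 h2 h4 h5
    refine ⟨h1, ?_⟩
    have hD : Delta l (q s) (t s) = 0 := by
      rw [Delta_eq_zero_iff h4.ne', hmass, hspin]
    have hr : rMinus l (q s) = t s := by
      have hmem : t s ∈ {r : ℝ | Delta l (q s) r = 0} := hD
      rw [Delta_zeros hl (rMinus_lt_rPlus hl h1) (Delta_rMinus hl h1) (Delta_rPlus hl h1)] at hmem
      rcases hmem with h | h
      · exact h.symm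
      · exact absurd h h2.ne
    have hsq : t s ^ 2 = X * a ^ 2 / s - a ^ 2 := by
      have : 0 < X * a ^ 2 / s - a ^ 2 := Real.sqrt_pos.1 h4
      simp only [ht]; rw [Real.sq_sqrt this.le]
    rw [theta_eq_div h1, hr, hspin, hsq, show Xi l (q s) = X from rfl, sub_add_cancel]
    field_simp
  have hinv : ∀ᶠ s in 𝓝 θ, coordInv l s p.2 = q s := by
    filter_upwards [hth] with s h1
    exact coordInv_eq hl h1.1 (by rw [coord, h1.2])
  refine ⟨hdM.congr_of_eventuallyEq ?_, ?_⟩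
  · filter_upwards [hinv] with s h1; rw [h1, hmass]
  · filter_upwards [hinv, hth] with s h1 h2
    rw [h1]; exact ⟨h2.1, rfl, h2.2⟩

lemma flowLine_self (hl : 0 < l) (hp : p ∈ paramSpace l) : coordInv l (theta l p) p.2 = p :=
  coordInv_eq hl hp rfl

lemma hasDerivAt_Delta_flow (hl : 0 < l) (hp : p ∈ paramSpace l) (r : ℝ) :
    HasDerivAt (fun s => Delta l (coordInv l s p.2) r) (-(2 * r * gammaMass l p)) (theta l p) := by
  obtain ⟨h1, h2⟩ := flowLine hl hp
  have h3 : HasDerivAt (fun s => (spin l p ^ 2 + r ^ 2) * (1 + r ^ 2 / l ^ 2) -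
      2 * mass l (coordInv l s p.2) * r) (-(2 * r * gammaMass l p)) (theta l p) := by
    refine (((h1.const_mul 2).mul_const r).const_sub _).congr_deriv ?_
    ring
  refine h3.congr_of_eventuallyEq ?_
  filter_upwards [h2] with s hs
  rw [Delta, spin_eq_of_snd hs.2.1]

lemma gammaDeriv_Delta_inv (hl : 0 < l) (hp : p ∈ paramSpace l) {r : ℝ} (hr : rPlus l p < r) :
    gammaDeriv l (fun q => (Delta l q r)⁻¹) p = 2 * r * gammaMass l p / Delta l p r ^ 2 := by
  have h := (hasDerivAt_Delta_flow hl hp r).inv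
    (by rw [flowLine_self hl hp]; exact (Delta_pos hl hp hr).ne')
  rw [flowLine_self hl hp, neg_neg] at h
  exact h.deriv

/-- At fixed r the flow freezes a, Ξ and ω_r, while ω₋ = s/a is linear in s and Δ changes only
through the mass. -/
lemma gammaDeriv_potential (hl : 0 < l) (hp : p ∈ paramSpace l) {r : ℝ} (hr : rPlus l p < r) :
    gammaDeriv l (fun q => (r ^ 2 + (spin l q) ^ 2) ^ 2 / (Delta l q r) ^ 2
            * (omegaMinus l q - omegaAt l q r) ^ 2) p =
      (r ^ 2 + spin l p ^ 2) ^ 2 * (4 * r * gammaMass l p / Delta l p r ^ 3 *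
        (omegaMinus l p - omegaAt l p r) ^ 2 +
        2 * (omegaMinus l p - omegaAt l p r) / (spin l p * Delta l p r ^ 2)) := by
  have hD := (Delta_pos hl hp hr).ne'
  have ha := spin_pos hp
  have h1 := hasDerivAt_Delta_flow hl hp r
  have h2 : HasDerivAt (fun s => s / spin l p - omegaAt l p r) (1 / spin l p) (theta l p) :=
    ((hasDerivAt_id _).div_const _).sub_const _
  have h3 : HasDerivAt (fun s => (r ^ 2 + spin l p ^ 2) ^ 2 / (Delta l (coordInv l s p.2) r) ^ 2
      * (s / spin l p - omegaAt l p r) ^ 2)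
      ((r ^ 2 + spin l p ^ 2) ^ 2 * (4 * r * gammaMass l p / Delta l p r ^ 3 *
        (omegaMinus l p - omegaAt l p r) ^ 2 +
        2 * (omegaMinus l p - omegaAt l p r) / (spin l p * Delta l p r ^ 2))) (theta l p) := by
    refine (((hasDerivAt_const (theta l p) ((r ^ 2 + spin l p ^ 2) ^ 2)).div (h1.pow 2)
      (pow_ne_zero 2 (by beta_reduce; rw [flowLine_self hl hp]; exact hD))).mul (h2.pow 2)).congr_deriv ?_
    have e : theta l p / spin l p = omegaMinus l p := by rw [theta_eq hp]; field_simp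
    simp only [Pi.pow_apply, Pi.div_apply, flowLine_self hl hp, e]
    field_simp
    ring
  refine HasDerivAt.deriv (h3.congr_of_eventuallyEq ?_)
  filter_upwards [(flowLine hl hp).2] with s hs
  have e1 : spin l (coordInv l s p.2) = spin l p := spin_eq_of_snd hs.2.1
  have e2 : omegaMinus l (coordInv l s p.2) = s / spin l p := by
    have := theta_eq hs.1
    rw [hs.2.2, e1] at this
    rw [eq_div_iff ha.ne', mul_comm]; exact this.symm
  have e3 : omegaAt l (coordInv l s p.2) r = omegaAt l p r := by
    rw [omegaAt, omegaAt, e1, Xi_eq_of_snd hs.2.1]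
  rw [e1, e2, e3]

/-! ### Turning points -/

/-- `μ + ω₋² a² - 2 a ω₋ Ξ`. -/
def muShift (l : ℝ) (p : ℝ × ℝ) (μ : ℝ) : ℝ :=
  μ + (omegaMinus l p) ^ 2 * (spin l p) ^ 2 - 2 * spin l p * omegaMinus l p * Xi l p

/-- `3M/Ξ`, where `Δ / (r² + a²)²` is large. -/
def rTop (l : ℝ) (p : ℝ × ℝ) : ℝ := 3 * mass l p / Xi l p

/-- The quantity whose positivity makes `V_main` positive at `3M/Ξ`. -/
def barrier (l : ℝ) (p : ℝ × ℝ) (μ : ℝ) : ℝ :=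
  ((l ^ 2)⁻¹ + 3 * ((mass l p) ^ 2 / Xi l p)
    * ((9 * (mass l p) ^ 2 / (Xi l p) ^ 2 + (spin l p) ^ 2) ^ 2)⁻¹)
    * (μ + (omegaMinus l p) ^ 2 * (spin l p) ^ 2 - 2 * spin l p * omegaMinus l p * Xi l p)
    - (omegaMinus l p) ^ 2

/-- `(r² + a²)² V_main`, a quartic polynomial. -/
def quartic (l : ℝ) (p : ℝ × ℝ) (μ r : ℝ) : ℝ :=
  muShift l p μ * Delta l p r - omegaMinus l p ^ 2 * (r ^ 2 - rMinus l p ^ 2) ^ 2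

/-- From aΞ = ω₋(r₋² + a²) one gets ω₋ - ω_r = ω₋(r² - r₋²)/(r² + a²). In particular the quartic
also vanishes at r₋, a third positive root besides the turning points. -/
lemma potentialMain_eq (hp : p ∈ paramSpace l) (μ r : ℝ) :
    potentialMain l p μ r = quartic l p μ r / (r ^ 2 + spin l p ^ 2) ^ 2 := by
  have ha := spin_pos hp
  have hω : spin l p * Xi l p = omegaMinus l p * (rMinus l p ^ 2 + spin l p ^ 2) := by
    unfold omegaMinus omegaAt; field_simp
  unfold potentialMain quartic muShift omegaAt
  rw [hω]
  field_simp
  ring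

lemma muShift_lt (hl : 0 < l) {μ : ℝ} (h : μ < muTop l p) :
    muShift l p μ / l ^ 2 - omegaMinus l p ^ 2 < 0 := by
  rw [sub_neg, div_lt_iff₀ (by positivity)]
  unfold muShift; unfold muTop at h; linarith

lemma barrier_coeff_pos (hl : 0 < l) (hp : p ∈ paramSpace l) :
    0 < (l ^ 2)⁻¹ + 3 * ((mass l p) ^ 2 / Xi l p)
      * ((9 * (mass l p) ^ 2 / (Xi l p) ^ 2 + (spin l p) ^ 2) ^ 2)⁻¹ := by
  have := Xi_pos hp
  have := mass_pos hl hp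
  have := spin_pos hp
  positivity

lemma muShift_pos (hl : 0 < l) (hp : p ∈ paramSpace l) {μ : ℝ} (h : 0 < barrier l p μ) :
    0 < muShift l p μ := by
  have h1 := barrier_coeff_pos hl hp
  have h2 : 0 < omegaMinus l p ^ 2 := by have := omegaMinus_pos hp; positivity
  unfold barrier at h
  exact (mul_pos_iff_of_pos_left h1).1 (by unfold muShift; linarith)

lemma barrier_mono (hl : 0 < l) (hp : p ∈ paramSpace l) {μ μ' : ℝ} (h : 0 < barrier l p μ)
    (hμ : μ ≤ μ') : 0 < barrier l p μ' := by
  refine h.trans_le ?_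
  unfold barrier
  have := barrier_coeff_pos hl hp
  gcongr

lemma rPlus_lt_rTop (hl : 0 < l) (hp : p ∈ paramSpace l) : rPlus l p < rTop l p := by
  have hX := Xi_pos hp
  have hM := mass_pos hl hp
  have hr := rPlus_pos hl hp
  have ha := spin_pos hp
  have h := Delta_rPlus hl hp
  unfold rTop
  rw [lt_div_iff₀ hX]
  have h1 : Delta l p (rPlus l p) = (rPlus l p ^ 2 + spin l p ^ 2) ^ 2 / l ^ 2 +
      Xi l p * (rPlus l p ^ 2 + spin l p ^ 2) - 2 * mass l p * rPlus l p := by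
    unfold Delta Xi; field_simp; ring
  rw [h1] at h
  have h2 : 0 < (rPlus l p ^ 2 + spin l p ^ 2) ^ 2 / l ^ 2 := by positivity
  have h3 : 0 < Xi l p * spin l p ^ 2 := by positivity
  have h4 : Xi l p * rPlus l p * rPlus l p < 2 * mass l p * rPlus l p := by nlinarith
  have h5 := lt_of_mul_lt_mul_right h4 hr.le
  nlinarith

lemma rTop_pos (hl : 0 < l) (hp : p ∈ paramSpace l) : 0 < rTop l p :=
  (rPlus_pos hl hp).trans (rPlus_lt_rTop hl hp)

/-- At r = 3M/Ξ the quotient Δ/(r² + a²)² exceeds the coefficient in `barrier` by Ξa²/(r² + a²)²,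
and 0 ≤ ω_r ≤ ω₋ bounds the subtracted square by ω₋². -/
lemma potentialMain_rTop_pos (hl : 0 < l) (hp : p ∈ paramSpace l) {μ : ℝ}
    (h : 0 < barrier l p μ) : 0 < potentialMain l p μ (rTop l p) := by
  have hX := Xi_pos hp
  have hM := mass_pos hl hp
  have ha := spin_pos hp
  have hk := muShift_pos hl hp h
  have hr := rTop_pos hl hp
  have hrm := rMinus_pos hl hp
  have hb := (rMinus_lt_rPlus hl hp).trans (rPlus_lt_rTop hl hp)
  have h1 : (omegaMinus l p - omegaAt l p (rTop l p)) ^ 2 ≤ omegaMinus l p ^ 2 := by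
    have h2 : 0 ≤ omegaAt l p (rTop l p) := by unfold omegaAt; positivity
    have h3 : omegaAt l p (rTop l p) ≤ omegaMinus l p := by
      unfold omegaMinus omegaAt; gcongr
    exact pow_le_pow_left₀ (by linarith) (by linarith) 2
  have h2 : (l ^ 2)⁻¹ + 3 * ((mass l p) ^ 2 / Xi l p)
      * ((9 * (mass l p) ^ 2 / (Xi l p) ^ 2 + (spin l p) ^ 2) ^ 2)⁻¹ ≤
      Delta l p (rTop l p) / (rTop l p ^ 2 + spin l p ^ 2) ^ 2 := by
    have e1 : 9 * (mass l p) ^ 2 / (Xi l p) ^ 2 = rTop l p ^ 2 := by unfold rTop; ring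
    rw [e1, ← div_eq_mul_inv, ← sub_nonneg]
    have e2 : Delta l p (rTop l p) / (rTop l p ^ 2 + spin l p ^ 2) ^ 2 -
        ((l ^ 2)⁻¹ + 3 * (mass l p ^ 2 / Xi l p) / (rTop l p ^ 2 + spin l p ^ 2) ^ 2) =
        Xi l p * spin l p ^ 2 / (rTop l p ^ 2 + spin l p ^ 2) ^ 2 := by
      have e3 : Delta l p (rTop l p) = (rTop l p ^ 2 + spin l p ^ 2) ^ 2 / l ^ 2 +
          Xi l p * (rTop l p ^ 2 + spin l p ^ 2) - 2 * mass l p * rTop l p := by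
        unfold Delta Xi; field_simp; ring
      have e4 : mass l p = Xi l p * rTop l p / 3 := by unfold rTop; field_simp
      rw [e3, e4]
      field_simp
      ring
    rw [e2]; positivity
  unfold potentialMain
  unfold barrier at h
  change 0 < _ * muShift l p μ - _
  change 0 < _ * muShift l p μ - _ at h
  have h3 := mul_le_mul_of_nonneg_right h2 hk.le
  linarith

lemma quartic_expand (l : ℝ) (p : ℝ × ℝ) (μ : ℝ) : ∃ c₂ c₁ c₀, ∀ r, quartic l p μ r =
    (muShift l p μ / l ^ 2 - omegaMinus l p ^ 2) * r ^ 4 + c₂ * r ^ 2 + c₁ * r + c₀ := by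
  refine ⟨muShift l p μ * (1 + spin l p ^ 2 / l ^ 2) + 2 * omegaMinus l p ^ 2 * rMinus l p ^ 2,
    -2 * mass l p * muShift l p μ,
    muShift l p μ * spin l p ^ 2 - omegaMinus l p ^ 2 * rMinus l p ^ 4, fun r => ?_⟩
  unfold quartic Delta; ring

lemma quartic_divided {c₄ c₂ c₁ c₀ x y z : ℝ} {Q : ℝ → ℝ}
    (hQ : ∀ r, Q r = c₄ * r ^ 4 + c₂ * r ^ 2 + c₁ * r + c₀) (hx : Q x = 0) (hy : Q y = 0)
    (hz : Q z = 0) (hxy : x ≠ y) (hxz : x ≠ z) (hyz : y ≠ z) :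
    c₄ * (x ^ 2 + y ^ 2 + z ^ 2 + x * y + y * z + z * x) + c₂ = 0 := by
  rw [hQ] at hx hy hz
  apply mul_left_cancel₀ (mul_ne_zero (mul_ne_zero (sub_ne_zero.2 hxy) (sub_ne_zero.2 hxz))
    (sub_ne_zero.2 hyz))
  linear_combination (y - z) * hx - (x - z) * hy + (x - y) * hz

/-- Without a cubic term the four roots sum to zero, so they cannot all be positive. The proof
subtracts two second divided differences. -/
lemma quartic_no_four {c₄ c₂ c₁ c₀ x y z t : ℝ} {Q : ℝ → ℝ}
    (hQ : ∀ r, Q r = c₄ * r ^ 4 + c₂ * r ^ 2 + c₁ * r + c₀) (hc : c₄ ≠ 0) (hx : Q x = 0)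
    (hy : Q y = 0) (hz : Q z = 0) (ht : Q t = 0) (hxy : x ≠ y) (hxz : x ≠ z) (hyz : y ≠ z)
    (hx0 : 0 < x) (hy0 : 0 < y) (hz0 : 0 < z) (ht0 : 0 < t) : t = x ∨ t = y ∨ t = z := by
  by_contra! hne
  have h1 := quartic_divided hQ hx hy hz hxy hxz hyz
  have h2 := quartic_divided hQ hx hy ht hxy hne.1.symm hne.2.1.symm
  have h3 : c₄ * (z - t) * (x + y + z + t) = 0 := by linear_combination h1 - h2
  have h4 : x + y + z + t ≠ 0 := by positivity
  exact mul_ne_zero (mul_ne_zero hc (sub_ne_zero.2 hne.2.2.symm)) h4 h3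

/-- The same sum rule with z counted twice: x + y + 2z = 0 is impossible for positive roots. -/
lemma quartic_simple {c₄ c₂ c₁ c₀ x y z : ℝ} {Q : ℝ → ℝ}
    (hQ : ∀ r, Q r = c₄ * r ^ 4 + c₂ * r ^ 2 + c₁ * r + c₀) (hc : c₄ ≠ 0) (hx : Q x = 0)
    (hy : Q y = 0) (hz : Q z = 0) (hxy : x ≠ y) (hxz : x ≠ z) (hyz : y ≠ z)
    (hx0 : 0 < x) (hy0 : 0 < y) (hz0 : 0 < z) : 4 * c₄ * z ^ 3 + 2 * c₂ * z + c₁ ≠ 0 := by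
  intro hd
  have h1 := quartic_divided hQ hx hy hz hxy hxz hyz
  rw [hQ] at hx hz
  have h2 : c₄ * (x ^ 2 + 2 * x * z + 3 * z ^ 2) + c₂ = 0 := by
    apply mul_left_cancel₀ (pow_ne_zero 2 (sub_ne_zero.2 hxz))
    linear_combination hx - hz - (x - z) * hd
  have h3 : c₄ * (y - z) * (x + y + 2 * z) = 0 := by linear_combination h1 - h2
  have h4 : x + y + 2 * z ≠ 0 := by positivity
  exact mul_ne_zero (mul_ne_zero hc (sub_ne_zero.2 hyz)) h4 h3

lemma continuous_quartic (l : ℝ) (p : ℝ × ℝ) (μ : ℝ) : Continuous (quartic l p μ) := by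
  unfold quartic Delta; fun_prop

lemma quartic_rMinus (hl : 0 < l) (hp : p ∈ paramSpace l) (μ : ℝ) :
    quartic l p μ (rMinus l p) = 0 := by rw [quartic, Delta_rMinus hl hp]; ring

lemma quartic_rPlus_neg (hl : 0 < l) (hp : p ∈ paramSpace l) (μ : ℝ) :
    quartic l p μ (rPlus l p) < 0 := by
  rw [quartic, Delta_rPlus hl hp, mul_zero, zero_sub, neg_lt_zero]
  have h1 := omegaMinus_pos hp
  have h2 := rMinus_pos hl hp
  have h3 := rMinus_lt_rPlus hl hp
  have : 0 < rPlus l p ^ 2 - rMinus l p ^ 2 := by nlinarith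
  positivity

lemma quartic_eventually_neg (hl : 0 < l) {μ : ℝ} (hμ : μ < muTop l p) :
    ∀ᶠ r in atTop, quartic l p μ r < 0 := by
  obtain ⟨c₂, c₁, c₀, hQ⟩ := quartic_expand l p μ
  have hc := muShift_lt hl hμ
  set c₄ := muShift l p μ / l ^ 2 - omegaMinus l p ^ 2
  have h1 : Tendsto (fun r : ℝ => c₄ + (c₂ * (r ^ 2)⁻¹ + c₁ * (r ^ 3)⁻¹ + c₀ * (r ^ 4)⁻¹)) atTop
      (𝓝 (c₄ + (c₂ * 0 + c₁ * 0 + c₀ * 0))) := by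
    have e : ∀ n : ℕ, n ≠ 0 → Tendsto (fun r : ℝ => (r ^ n)⁻¹) atTop (𝓝 0) := fun n hn =>
      (tendsto_pow_atTop hn).inv_tendsto_atTop
    exact (((e 2 two_ne_zero).const_mul _).add ((e 3 three_ne_zero).const_mul _) |>.add
      ((e 4 four_ne_zero).const_mul _)).const_add _
  simp only [mul_zero, add_zero] at h1
  filter_upwards [h1.eventually_lt_const hc, eventually_gt_atTop 0] with r hr h0
  rw [hQ]
  have : c₄ * r ^ 4 + c₂ * r ^ 2 + c₁ * r + c₀ =
      r ^ 4 * (c₄ + (c₂ * (r ^ 2)⁻¹ + c₁ * (r ^ 3)⁻¹ + c₀ * (r ^ 4)⁻¹)) := by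
    field_simp
    ring
  rw [this]
  exact mul_neg_of_pos_of_neg (by positivity) hr

/-- The position of the two turning points and the sign of `V_main`. -/
structure TurningPoints (l : ℝ) (p : ℝ × ℝ) (μ : ℝ) : Prop where
  lt_one : rPlus l p < turnOne l p μ
  one_lt : turnOne l p μ < rTop l p
  lt_two : rTop l p < turnTwo l p μ
  zero_one : potentialMain l p μ (turnOne l p μ) = 0
  zero_two : potentialMain l p μ (turnTwo l p μ) = 0
  neg_left : ∀ r, rPlus l p < r → r < turnOne l p μ → potentialMain l p μ r < 0
  pos : ∀ r, turnOne l p μ < r → r < turnTwo l p μ → 0 < potentialMain l p μ r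
  neg_right : ∀ r, turnTwo l p μ < r → potentialMain l p μ r < 0
  simple : ∃ d < 0, HasDerivAt (potentialMain l p μ) d (turnTwo l p μ)

/-- The quartic is negative at r₊, positive at 3M/Ξ and negative near infinity, which gives two
roots beyond r₊. With r₋ these are three positive roots, so there are no others, and the
intermediate value theorem fixes the sign on each interval. -/
lemma turningPoints (hl : 0 < l) (hp : p ∈ paramSpace l) {μ : ℝ} (hb : 0 < barrier l p μ)
    (hμ : μ < muTop l p) : TurningPoints l p μ := by
  have ha := spin_pos hp
  have hden : ∀ r, 0 < (r ^ 2 + spin l p ^ 2) ^ 2 := fun r => by positivity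
  have hz : ∀ r, potentialMain l p μ r = 0 ↔ quartic l p μ r = 0 := fun r => by
    rw [potentialMain_eq hp, div_eq_zero_iff, or_iff_left (hden r).ne']
  have hpo : ∀ r, 0 < potentialMain l p μ r ↔ 0 < quartic l p μ r := fun r => by
    rw [potentialMain_eq hp, lt_div_iff₀ (hden r), zero_mul]
  have hng : ∀ r, potentialMain l p μ r < 0 ↔ quartic l p μ r < 0 := fun r => by
    rw [potentialMain_eq hp, div_lt_iff₀ (hden r), zero_mul]
  have hc := continuous_quartic l p μ
  have hrp := rPlus_pos hl hp
  have hrm := rMinus_pos hl hp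
  have hmp := rMinus_lt_rPlus hl hp
  have hpt := rPlus_lt_rTop hl hp
  have hT : 0 < quartic l p μ (rTop l p) := (hpo _).1 (potentialMain_rTop_pos hl hp hb)
  have hP := quartic_rPlus_neg hl hp μ
  obtain ⟨c₂, c₁, c₀, hQ⟩ := quartic_expand l p μ
  have hc4 := muShift_lt hl hμ
  have hbig : ∀ r, ∃ R, r < R ∧ quartic l p μ R < 0 := fun r =>
    ((eventually_gt_atTop r).and (quartic_eventually_neg hl hμ)).exists
  obtain ⟨x, hx, hx0⟩ := intermediate_value_Ioo hpt.le hc.continuousOn ⟨hP, hT⟩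
  obtain ⟨R, hR, hRn⟩ := hbig (rTop l p)
  obtain ⟨y, hy, hy0⟩ := intermediate_value_Ioo' hR.le hc.continuousOn ⟨hRn, hT⟩
  have hxy : x < y := hx.2.trans hy.1
  have hmx : rMinus l p < x := hmp.trans hx.1
  have hroots : ∀ r, rPlus l p < r → quartic l p μ r = 0 → r = x ∨ r = y := by
    intro r hr hr0
    rcases quartic_no_four hQ hc4.ne (quartic_rMinus hl hp μ) hx0 hy0 hr0 hmx.ne
      (hmx.trans hxy).ne hxy.ne hrm (hrm.trans hmx) (hrm.trans (hmx.trans hxy))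
      (hrp.trans hr) with h | h | h
    · linarith
    · exact Or.inl h
    · exact Or.inr h
  have h2 : turnTwo l p μ = y := by
    refine IsGreatest.csSup_eq ⟨⟨hx.1.trans hxy, (hz y).2 hy0⟩, ?_⟩
    rintro r ⟨hr, hr0⟩
    rcases hroots r hr ((hz r).1 hr0) with h | h <;> linarith
  have h1 : turnOne l p μ = x := by
    unfold turnOne
    rw [h2]
    refine IsGreatest.csSup_eq ⟨⟨hx.1, hxy, (hz x).2 hx0⟩, ?_⟩
    rintro r ⟨hr, hry, hr0⟩
    rcases hroots r hr ((hz r).1 hr0) with h | h <;> linarith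
  have hneg : ∀ r, y < r → quartic l p μ r < 0 := by
    intro r hr
    by_contra! hcon
    obtain ⟨R', hR', hRn'⟩ := hbig r
    obtain ⟨t, ht, ht0⟩ := intermediate_value_Icc' hR'.le hc.continuousOn ⟨hRn'.le, hcon⟩
    rcases hroots t (by linarith [ht.1, hx.1]) ht0 with h | h <;> linarith [ht.1]
  refine ⟨by rw [h1]; exact hx.1, by rw [h1]; exact hx.2, by rw [h2]; exact hy.1,
    by rw [h1, hz]; exact hx0, by rw [h2, hz]; exact hy0, ?_, ?_, ?_, ?_⟩
  · intro r hr1 hr2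
    rw [h1] at hr2
    rw [hng]
    by_contra! hcon
    obtain ⟨t, ht, ht0⟩ := intermediate_value_Icc hr1.le hc.continuousOn ⟨hP.le, hcon⟩
    have htp : t ≠ rPlus l p := by rintro rfl; exact hP.ne ht0
    rcases hroots t (lt_of_le_of_ne ht.1 htp.symm) ht0 with h | h <;> linarith [ht.2]
  · intro r hr1 hr2
    rw [h1] at hr1; rw [h2] at hr2
    rw [hpo]
    by_contra! hcon
    rcases lt_trichotomy r (rTop l p) with h | h | h
    · obtain ⟨t, ht, ht0⟩ := intermediate_value_Icc h.le hc.continuousOn ⟨hcon, hT.le⟩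
      rcases hroots t (by linarith [ht.1, hx.1]) ht0 with h' | h' <;> linarith [ht.1, ht.2, hy.1]
    · rw [h] at hcon; linarith
    · obtain ⟨t, ht, ht0⟩ := intermediate_value_Icc' h.le hc.continuousOn ⟨hcon, hT.le⟩
      rcases hroots t (by linarith [ht.1, hx.1]) ht0 with h' | h' <;> linarith [ht.1, ht.2, hx.2]
  · intro r hr
    rw [h2] at hr
    exact (hng r).2 (hneg r hr)
  · have hsim := quartic_simple hQ hc4.ne (quartic_rMinus hl hp μ) hx0 hy0 hmx.ne
      (hmx.trans hxy).ne hxy.ne hrm (hrm.trans hmx) (hrm.trans (hmx.trans hxy))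
    set c₄ := muShift l p μ / l ^ 2 - omegaMinus l p ^ 2
    have hdq : HasDerivAt (quartic l p μ) (4 * c₄ * y ^ 3 + 2 * c₂ * y + c₁) y := by
      rw [funext hQ]
      refine (((((hasDerivAt_pow 4 y).const_mul c₄).add ((hasDerivAt_pow 2 y).const_mul c₂)).add
        ((hasDerivAt_id y).const_mul c₁)).add_const c₀).congr_deriv ?_
      simp; ring
    have hdd : HasDerivAt (fun r => (r ^ 2 + spin l p ^ 2) ^ 2)
        (2 * (y ^ 2 + spin l p ^ 2) * (2 * y)) y := by
      refine (((hasDerivAt_pow 2 y).add_const _).pow 2).congr_deriv ?_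
      simp
    have hdV := hdq.div hdd (hden y).ne'
    rw [hy0, zero_mul, sub_zero] at hdV
    rw [h2]
    have hV : HasDerivAt (potentialMain l p μ) _ y :=
      hdV.congr_of_eventuallyEq (Eventually.of_forall fun r => potentialMain_eq hp μ r)
    -- The derivative is nonpositive because V_main is negative to the right of the root, and
    -- nonzero because the root is simple.
    refine ⟨_, lt_of_le_of_ne ?_ ?_, hV⟩
    · have ht := hV.tendsto_slope.mono_left (nhdsGT_le_nhdsNE y)
      refine le_of_tendsto ht ?_
      filter_upwards [self_mem_nhdsWithin] with r hr
      rw [slope_def_field, (hz y).2 hy0, sub_zero]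
      exact div_nonpos_of_nonpos_of_nonneg ((hng r).2 (hneg r hr)).le (sub_nonneg.2 (le_of_lt hr))
    · refine div_ne_zero (mul_ne_zero hsim (hden y).ne') ?_
      have := hden y
      positivity

/-- Comparison with r₂ becomes a sign condition on V_main at a fixed radius. This is used both for
measurability of r₂ and to state the trapping condition by closed inequalities. -/
lemma TurningPoints.turnTwo_le_iff {μ : ℝ} (h : TurningPoints l p μ) (r : ℝ) :
    turnTwo l p μ ≤ r ↔ rTop l p ≤ r ∧ potentialMain l p μ r ≤ 0 := by
  constructor
  · intro hr
    refine ⟨h.lt_two.le.trans hr, ?_⟩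
    rcases hr.eq_or_lt with h1 | h1
    · rw [← h1]; exact h.zero_two.le
    · exact (h.neg_right r h1).le
  · rintro ⟨h1, h2⟩
    by_contra! hlt
    exact absurd (h.pos r (h.one_lt.trans_le h1) hlt) (not_lt.2 h2)

lemma TurningPoints.turnOne_le_iff {μ : ℝ} (h : TurningPoints l p μ) (r : ℝ) :
    turnOne l p μ ≤ r ↔ rPlus l p < r ∧ (rTop l p ≤ r ∨ 0 ≤ potentialMain l p μ r) := by
  constructor
  · intro hr
    refine ⟨h.lt_one.trans_le hr, ?_⟩
    rcases le_or_gt (rTop l p) r with h1 | h1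
    · exact Or.inl h1
    · right
      rcases hr.eq_or_lt with h2 | h2
      · rw [← h2]; exact h.zero_one.ge
      · exact (h.pos r h2 (h1.trans h.lt_two)).le
  · rintro ⟨h1, h2⟩
    by_contra! hlt
    rcases h2 with h2 | h2
    · linarith [h.one_lt]
    · linarith [h.neg_left r h1 hlt]

end

section
variable {l : ℝ} {p : ℝ × ℝ}

/-! ### The trapping range -/

/-- The explicit form of the second condition in the definition of the trapping range. -/
def decayTerm (l : ℝ) (p : ℝ × ℝ) (μ r : ℝ) : ℝ :=
  2 * r * gammaMass l p / Delta l p r ^ 2 * muShift l p μ -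
    (r ^ 2 + spin l p ^ 2) ^ 2 * (4 * r * gammaMass l p / Delta l p r ^ 3 *
        (omegaMinus l p - omegaAt l p r) ^ 2 +
        2 * (omegaMinus l p - omegaAt l p r) / (spin l p * Delta l p r ^ 2))

/-- The pairs `(μ, r)` at which the second condition fails. -/
def decayFailure (l c : ℝ) : Set ((ℝ × ℝ) × ℝ × ℝ) :=
  {x | (x.1 ∈ paramSpace l ∧ x.2.1 < muTop l x.1 ∧ rPlus l x.1 < x.2.2) ∧
    c ≤ x.2.1 ∧ rTop l x.1 ≤ x.2.2 ∧ potentialMain l x.1 x.2.1 x.2.2 ≤ 0 ∧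
    0 ≤ decayTerm l x.1 x.2.1 x.2.2}

/-- The first condition is monotone in μ, so it need only be tested at c. The second, quantified
over μ and r, fails exactly when p is the projection of some point of `decayFailure`. -/
lemma mem_trappingRange_iff (hl : 0 < l) (hp : p ∈ paramSpace l) (c : ℝ) :
    c ∈ trappingRange l p ↔ Xi l p ^ 2 < c ∧ c < muTop l p ∧ 0 < barrier l p c ∧
      p ∉ Prod.fst '' decayFailure l c := by
  have hdec : ∀ μ r, rPlus l p < r → (gammaDeriv l (fun q => (Delta l q r)⁻¹) p
          * (μ + (spin l p) ^ 2 * (omegaMinus l p) ^ 2 - 2 * spin l p * omegaMinus l p * Xi l p)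
        - gammaDeriv l (fun q => (r ^ 2 + (spin l q) ^ 2) ^ 2 / (Delta l q r) ^ 2
            * (omegaMinus l q - omegaAt l q r) ^ 2) p) = decayTerm l p μ r := by
    intro μ r hr
    rw [gammaDeriv_Delta_inv hl hp hr, gammaDeriv_potential hl hp hr, decayTerm, muShift]
    ring
  constructor
  · rintro ⟨h1, h2, h3⟩
    refine ⟨h1, h2, (h3 c ⟨le_rfl, h2⟩).1, ?_⟩
    rintro ⟨⟨q, μ, r⟩, ⟨⟨h4, h5, h6⟩, h7, h8, h9, h10⟩, rfl⟩
    obtain ⟨h11, h12⟩ := h3 μ ⟨h7, h5⟩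
    have ht := turningPoints hl hp (μ := μ) h11 h5
    have := h12 r ((ht.turnTwo_le_iff r).2 ⟨h8, h9⟩)
    rw [hdec μ r h6] at this
    exact absurd h10 (not_le.2 this)
  · rintro ⟨h1, h2, h3, h4⟩
    refine ⟨h1, h2, fun μ hμ => ⟨barrier_mono hl hp h3 hμ.1, fun r hr => ?_⟩⟩
    have ht := turningPoints hl hp (barrier_mono hl hp h3 hμ.1) hμ.2
    obtain ⟨h5, h6⟩ := (ht.turnTwo_le_iff r).1 hr
    have h7 := (rPlus_lt_rTop hl hp).trans_le h5
    rw [hdec μ r h7]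
    by_contra! hcon
    exact h4 ⟨(p, μ, r), ⟨⟨hp, hμ.2, h7⟩, hμ.1, h5, h6, hcon⟩, rfl⟩

/-- Projections of Borel sets need not be Borel. A relatively closed subset of an open set in a
proper space is σ-compact, however, and so is its projection. -/
lemma measurableSet_image_fst {X Y : Type*} [MetricSpace X] [MetricSpace Y] [ProperSpace X]
    [ProperSpace Y] [MeasurableSpace X] [BorelSpace X] {O : Set (X × Y)} (hO : IsOpen O)
    {F : X × Y → ℝ} (hF : ContinuousOn F O) :
    MeasurableSet (Prod.fst '' (O ∩ F ⁻¹' Ici 0)) := by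
  obtain ⟨K, hKc, hKO, hK, -⟩ := hO.exists_iUnion_isClosed
  rw [← hK, iUnion_inter, image_iUnion]
  refine MeasurableSet.iUnion fun n => ?_
  have hcl : IsClosed (K n ∩ F ⁻¹' Ici 0) :=
    (hF.mono (hKO n)).preimage_isClosed_of_isClosed (hKc n) isClosed_Ici
  obtain ⟨C, hC, hCeq⟩ := (isSigmaCompact_univ.of_isClosed_subset hcl (subset_univ _)).image
    continuous_fst
  rw [← hCeq]
  exact MeasurableSet.iUnion fun i => (hC i).isClosed.measurableSet

lemma continuousOn_gammaMass (hl : 0 < l) : ContinuousOn (gammaMass l) (paramSpace l) := by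
  have h1 := continuousOn_rMinus hl
  have h2 := continuous_spin l
  have h3 := continuous_Xi l
  have hr : ∀ p ∈ paramSpace l, rMinus l p ≠ 0 := fun p hp => (rMinus_pos hl hp).ne'
  unfold gammaMass
  refine ContinuousOn.mul (ContinuousOn.div_const ?_ _) (ContinuousOn.div ?_ ?_ fun p hp => ?_)
  · refine ContinuousOn.sub (by fun_prop) (ContinuousOn.div (by fun_prop) (by fun_prop) ?_)
    exact fun p hp => pow_ne_zero 2 (hr p hp)
  · fun_prop
  · fun_prop
  · have := rMinus_pos hl hp
    have := Xi_pos hp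
    have := spin_pos hp
    positivity

lemma continuousOn_muTop (hl : 0 < l) : ContinuousOn (muTop l) (paramSpace l) := by
  have h1 := continuousOn_omegaMinus hl
  have h2 := continuous_spin l
  have h3 := continuous_Xi l
  unfold muTop; fun_prop

lemma continuousOn_rTop : ContinuousOn (rTop l) (paramSpace l) := by
  have h2 := continuous_mass l
  have h3 := continuous_Xi l
  unfold rTop
  exact ContinuousOn.div (by fun_prop) (by fun_prop) fun p hp => (Xi_pos hp).ne'

lemma continuousOn_barrier (hl : 0 < l) (c : ℝ) :
    ContinuousOn (fun p => barrier l p c) (paramSpace l) := by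
  have h1 := continuousOn_omegaMinus hl
  have h2 := continuous_spin l
  have h3 := continuous_Xi l
  have h4 := continuous_mass l
  have hX : ∀ p ∈ paramSpace l, Xi l p ≠ 0 := fun p hp => (Xi_pos hp).ne'
  unfold barrier
  refine ContinuousOn.sub (ContinuousOn.mul (continuousOn_const.add (ContinuousOn.mul
    (continuousOn_const.mul (ContinuousOn.div (by fun_prop) (by fun_prop) hX))
    (ContinuousOn.inv₀ (ContinuousOn.pow (ContinuousOn.add (ContinuousOn.div (by fun_prop)
      (by fun_prop) fun p hp => pow_ne_zero 2 (hX p hp)) (by fun_prop)) 2) fun p hp => ?_)))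
    (by fun_prop)) (by fun_prop)
  have := Xi_pos hp
  have := spin_pos hp
  positivity

lemma continuousOn_omegaMinus_sub (hl : 0 < l) :
    ContinuousOn (fun x : (ℝ × ℝ) × ℝ × ℝ => omegaMinus l x.1 - omegaAt l x.1 x.2.2)
      (Prod.fst ⁻¹' paramSpace l) := by
  have hω : ContinuousOn (fun x : (ℝ × ℝ) × ℝ × ℝ => omegaMinus l x.1) (Prod.fst ⁻¹' paramSpace l) :=
    (continuousOn_omegaMinus hl).comp continuousOn_fst fun x hx => hx
  have hs : Continuous fun x : (ℝ × ℝ) × ℝ × ℝ => spin l x.1 := (continuous_spin l).comp continuous_fst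
  have hX : Continuous fun x : (ℝ × ℝ) × ℝ × ℝ => Xi l x.1 := (continuous_Xi l).comp continuous_fst
  refine hω.sub (ContinuousOn.div (hs.mul hX).continuousOn
    (((continuous_snd.comp continuous_snd).pow 2).add (hs.pow 2)).continuousOn fun x hx => ?_)
  have := spin_pos (l := l) hx
  positivity

lemma continuousOn_muShift (hl : 0 < l) :
    ContinuousOn (fun x : (ℝ × ℝ) × ℝ × ℝ => muShift l x.1 x.2.1) (Prod.fst ⁻¹' paramSpace l) := by
  have hω : ContinuousOn (fun x : (ℝ × ℝ) × ℝ × ℝ => omegaMinus l x.1) (Prod.fst ⁻¹' paramSpace l) :=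
    (continuousOn_omegaMinus hl).comp continuousOn_fst fun x hx => hx
  have hs : ContinuousOn (fun x : (ℝ × ℝ) × ℝ × ℝ => spin l x.1) (Prod.fst ⁻¹' paramSpace l) :=
    ((continuous_spin l).comp continuous_fst).continuousOn
  have hX : ContinuousOn (fun x : (ℝ × ℝ) × ℝ × ℝ => Xi l x.1) (Prod.fst ⁻¹' paramSpace l) :=
    ((continuous_Xi l).comp continuous_fst).continuousOn
  unfold muShift
  fun_prop

lemma continuousOn_potentialMain (hl : 0 < l) :
    ContinuousOn (fun x : (ℝ × ℝ) × ℝ × ℝ => potentialMain l x.1 x.2.1 x.2.2)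
      (Prod.fst ⁻¹' paramSpace l) := by
  have hs : Continuous fun x : (ℝ × ℝ) × ℝ × ℝ => spin l x.1 := (continuous_spin l).comp continuous_fst
  have hD : Continuous fun x : (ℝ × ℝ) × ℝ × ℝ => Delta l x.1 x.2.2 :=
    (continuous_Delta l).comp (continuous_fst.prodMk (continuous_snd.comp continuous_snd))
  have hmu := continuousOn_muShift hl
  unfold muShift at hmu
  refine ContinuousOn.sub (ContinuousOn.mul (ContinuousOn.div hD.continuousOn
    ((((continuous_snd.comp continuous_snd).pow 2).add (hs.pow 2)).pow 2).continuousOn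
      fun x hx => ?_) hmu) ((continuousOn_omegaMinus_sub hl).pow 2)
  have := spin_pos (l := l) hx
  positivity

lemma continuousOn_decayTerm (hl : 0 < l) :
    ContinuousOn (fun x : (ℝ × ℝ) × ℝ × ℝ => decayTerm l x.1 x.2.1 x.2.2)
      {x | x.1 ∈ paramSpace l ∧ x.2.1 < muTop l x.1 ∧ rPlus l x.1 < x.2.2} := by
  set O : Set ((ℝ × ℝ) × ℝ × ℝ) :=
    {x | x.1 ∈ paramSpace l ∧ x.2.1 < muTop l x.1 ∧ rPlus l x.1 < x.2.2}
  have hOW : O ⊆ Prod.fst ⁻¹' paramSpace l := fun x hx => hx.1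
  have hs : ContinuousOn (fun x : (ℝ × ℝ) × ℝ × ℝ => spin l x.1) O :=
    ((continuous_spin l).comp continuous_fst).continuousOn
  have hr : ContinuousOn (fun x : (ℝ × ℝ) × ℝ × ℝ => x.2.2) O :=
    (continuous_snd.comp continuous_snd).continuousOn
  have hD : ContinuousOn (fun x : (ℝ × ℝ) × ℝ × ℝ => Delta l x.1 x.2.2) O :=
    ((continuous_Delta l).comp
      (continuous_fst.prodMk (continuous_snd.comp continuous_snd))).continuousOn
  have hg : ContinuousOn (fun x : (ℝ × ℝ) × ℝ × ℝ => gammaMass l x.1) O :=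
    (continuousOn_gammaMass hl).comp continuousOn_fst hOW
  have hom := (continuousOn_omegaMinus_sub hl).mono hOW
  have hmu := (continuousOn_muShift hl).mono hOW
  have hD0 : ∀ x ∈ O, Delta l x.1 x.2.2 ≠ 0 := fun x hx => (Delta_pos hl hx.1 hx.2.2).ne'
  have hs0 : ∀ x ∈ O, spin l x.1 ≠ 0 := fun x hx => (spin_pos hx.1).ne'
  have h1 := ((continuousOn_const (c := (2 : ℝ))).mul hr).mul hg
  have h2 := h1.div (hD.pow 2) fun x hx => pow_ne_zero 2 (hD0 x hx)
  have h3 := ((continuousOn_const (c := (4 : ℝ))).mul hr).mul hg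
  have h4 := h3.div (hD.pow 3) fun x hx => pow_ne_zero 3 (hD0 x hx)
  have h5 := ((continuousOn_const (c := (2 : ℝ))).mul hom).div (hs.mul (hD.pow 2))
    fun x hx => mul_ne_zero (hs0 x hx) (pow_ne_zero 2 (hD0 x hx))
  exact (h2.mul hmu).sub ((((hr.pow 2).add (hs.pow 2)).pow 2).mul ((h4.mul (hom.pow 2)).add h5))

lemma measurableSet_decayFailure (hl : 0 < l) (c : ℝ) :
    MeasurableSet (Prod.fst '' decayFailure l c) := by
  set O : Set ((ℝ × ℝ) × ℝ × ℝ) :=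
    {x | x.1 ∈ paramSpace l ∧ x.2.1 < muTop l x.1 ∧ rPlus l x.1 < x.2.2} with hOdef
  set W : Set ((ℝ × ℝ) × ℝ × ℝ) := Prod.fst ⁻¹' paramSpace l with hW
  have hWo : IsOpen W := (isOpen_paramSpace hl).preimage continuous_fst
  have hμ : ContinuousOn (fun x : (ℝ × ℝ) × ℝ × ℝ => muTop l x.1) W :=
    (continuousOn_muTop hl).comp continuousOn_fst fun x hx => hx
  have hrp : ContinuousOn (fun x : (ℝ × ℝ) × ℝ × ℝ => rPlus l x.1) W :=
    (continuousOn_rPlus hl).comp continuousOn_fst fun x hx => hx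
  have hrt : ContinuousOn (fun x : (ℝ × ℝ) × ℝ × ℝ => rTop l x.1) W :=
    continuousOn_rTop.comp continuousOn_fst fun x hx => hx
  have hr1 : Continuous fun x : (ℝ × ℝ) × ℝ × ℝ => x.2.1 := continuous_fst.comp continuous_snd
  have hr2 : Continuous fun x : (ℝ × ℝ) × ℝ × ℝ => x.2.2 := continuous_snd.comp continuous_snd
  have hO : IsOpen O := by
    have e : O = W ∩ (fun x : (ℝ × ℝ) × ℝ × ℝ => (muTop l x.1 - x.2.1, x.2.2 - rPlus l x.1)) ⁻¹'
        (Ioi 0 ×ˢ Ioi 0) := by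
      ext x; simp [hOdef, hW]
    rw [e]
    refine ContinuousOn.isOpen_inter_preimage ?_ hWo (isOpen_Ioi.prod isOpen_Ioi)
    exact (hμ.sub hr1.continuousOn).prodMk (hr2.continuousOn.sub hrp)
  have hOW : O ⊆ W := fun x hx => hx.1
  have hV := (continuousOn_potentialMain hl).mono hOW
  have hd := continuousOn_decayTerm hl
  -- The four non-strict conditions are merged into F ≥ 0, with F the minimum of four functions
  -- continuous on O.
  have h1 : ContinuousOn (fun x : (ℝ × ℝ) × ℝ × ℝ => min (x.2.1 - c) (x.2.2 - rTop l x.1)) O :=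
    (hr1.continuousOn.sub continuousOn_const).inf (hr2.continuousOn.sub (hrt.mono hOW))
  have h2 : ContinuousOn (fun x : (ℝ × ℝ) × ℝ × ℝ =>
      min (-potentialMain l x.1 x.2.1 x.2.2) (decayTerm l x.1 x.2.1 x.2.2)) O := hV.neg.inf hd
  have hF := h1.inf h2
  convert measurableSet_image_fst hO hF using 2
  ext x
  simp only [decayFailure, hOdef, mem_inter_iff, mem_ofPred_eq, mem_preimage, mem_Ici, le_inf_iff,
    sub_nonneg, neg_nonneg]
  tauto

lemma trappingRange_mono {c c' : ℝ}
    (h : c ∈ trappingRange l p) (hcc : c ≤ c') (hc' : c' < muTop l p) : c' ∈ trappingRange l p :=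
  ⟨h.1.trans_le hcc, hc', fun μ hμ => h.2.2 μ ⟨hcc.trans hμ.1, hμ.2⟩⟩

lemma measurableSet_mem_trappingRange (hl : 0 < l) (c : ℝ) :
    MeasurableSet {z : paramSpace l | c ∈ trappingRange l z} := by
  have e : {z : paramSpace l | c ∈ trappingRange l z} =
      {z : paramSpace l | Xi l z ^ 2 < c} ∩ {z : paramSpace l | c < muTop l z} ∩
        {z : paramSpace l | 0 < barrier l z c} ∩
        (Subtype.val ⁻¹' (Prod.fst '' decayFailure l c))ᶜ := by
    ext z
    have := mem_trappingRange_iff hl z.2 c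
    simp only [mem_ofPred_eq, this, mem_inter_iff, mem_compl_iff, mem_preimage]
    tauto
  rw [e]
  have h1 := continuousOn_iff_continuous_domRestrict.1 (continuousOn_muTop hl)
  have h2 := continuousOn_iff_continuous_domRestrict.1 (continuousOn_barrier hl c)
  have h3 : Continuous fun z : paramSpace l => Xi l z := (continuous_Xi l).comp continuous_subtype_val
  exact (((isOpen_lt (h3.pow 2) continuous_const).measurableSet.inter
    (isOpen_lt continuous_const h1).measurableSet).inter
    (isOpen_lt continuous_const h2).measurableSet).inter
    (measurable_subtype_coe (measurableSet_decayFailure hl c)).compl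

lemma trappingRange_rat {c x : ℝ}
    (h : c ∈ trappingRange l p) (hcx : c < x) : ∃ q : ℚ, (q : ℝ) < x ∧ (q : ℝ) ∈ trappingRange l p := by
  obtain ⟨q, hq1, hq2⟩ := exists_rat_btwn (lt_min hcx h.2.1)
  exact ⟨q, hq2.trans_le (min_le_left _ _),
    trappingRange_mono h hq1.le (hq2.trans_le (min_le_right _ _))⟩

lemma measurable_muZero (hl : 0 < l) : Measurable fun z : paramSpace l => muZero l z :=
  measurable_sInf_of_rat (measurableSet_mem_trappingRange hl)
    fun _ _ hc _ hx => trappingRange_rat hc hx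

lemma muOne_eq (h : (trappingRange l p).Nonempty) :
    muOne l p = muTop l p := by
  obtain ⟨c, hc⟩ := h
  refine csSup_eq_of_forall_le_of_forall_lt_exists_gt ⟨c, hc⟩ (fun a ha => ha.2.1.le) fun w hw => ?_
  obtain ⟨d, hd1, hd2⟩ := exists_between (max_lt hw hc.2.1)
  exact ⟨d, trappingRange_mono hc ((le_max_right _ _).trans hd1.le) hd2,
    (le_max_left _ _).trans_lt hd1⟩

lemma measurable_muOne (hl : 0 < l) : Measurable fun z : paramSpace l => muOne l z := by
  classical
  have e : (fun z : paramSpace l => muOne l z) =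
      (⋃ q : ℚ, {z : paramSpace l | (q : ℝ) ∈ trappingRange l z}).indicator
        fun z => muTop l z := by
    funext z
    by_cases h : (trappingRange l (z : ℝ × ℝ)).Nonempty
    · rw [muOne_eq h, indicator_of_mem]
      obtain ⟨c, hc⟩ := h
      obtain ⟨q, -, hq⟩ := trappingRange_rat hc (show c < c + 1 by linarith)
      exact mem_iUnion.2 ⟨q, hq⟩
    · rw [indicator_of_notMem, muOne, not_nonempty_iff_eq_empty.1 h, Real.sSup_empty]
      intro hz
      obtain ⟨q, hq⟩ := mem_iUnion.1 hz
      exact h ⟨q, hq⟩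
  rw [e]
  exact (continuousOn_iff_continuous_domRestrict.1 (continuousOn_muTop hl)).measurable.indicator
    (MeasurableSet.iUnion fun q => measurableSet_mem_trappingRange hl q)

lemma measurable_sigmaOne (hl : 0 < l) : Measurable fun z : paramSpace l => sigmaOne l z := by
  have h0 := measurable_muZero hl
  have h1 := measurable_muOne hl
  unfold sigmaOne
  exact h0.add ((h1.sub h0).const_mul _)

lemma measurable_sigmaTwo (hl : 0 < l) : Measurable fun z : paramSpace l => sigmaTwo l z := by
  have h0 := measurable_muZero hl
  have h1 := measurable_muOne hl
  unfold sigmaTwo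
  exact h0.add (((h1.sub h0).const_mul 3).div_const 4 |> fun h => by
    simpa [mul_div_right_comm] using h)

lemma mem_trappingRange_of_sigma {μ : ℝ}
    (h1 : sigmaOne l p < μ) (h2 : μ < sigmaTwo l p) : μ ∈ trappingRange l p := by
  have hne : (trappingRange l p).Nonempty := by
    -- For an empty range the real infimum and supremum both default to 0, so σ₁ = σ₂ = 0 and no μ
    -- lies strictly between them.
    by_contra hcon
    rw [not_nonempty_iff_eq_empty] at hcon
    have e0 : muZero l p = 0 := by rw [muZero, hcon, Real.sInf_empty]
    have e1 : muOne l p = 0 := by rw [muOne, hcon, Real.sSup_empty]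
    rw [sigmaOne, e0, e1] at h1
    rw [sigmaTwo, e0, e1] at h2
    linarith
  have hbd : BddBelow (trappingRange l p) := ⟨Xi l p ^ 2, fun c hc => hc.1.le⟩
  have e1 := muOne_eq hne
  have h01 : muZero l p < muOne l p := by unfold sigmaOne at h1; unfold sigmaTwo at h2; linarith
  have h3 : muZero l p < μ := by unfold sigmaOne at h1; linarith
  obtain ⟨c, hc, hcμ⟩ := (csInf_lt_iff hbd hne).1 h3
  refine trappingRange_mono hc hcμ.le ?_
  rw [← e1]; unfold sigmaTwo at h2; linarith

lemma turningPoints_of_sigma (hl : 0 < l) (hp : p ∈ paramSpace l) {μ : ℝ}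
    (h1 : sigmaOne l p < μ) (h2 : μ < sigmaTwo l p) : TurningPoints l p μ := by
  have h := mem_trappingRange_of_sigma h1 h2
  have h' := (mem_trappingRange_iff hl hp μ).1 h
  exact turningPoints hl hp h'.2.2.1 h'.2.1

end

section
variable {l : ℝ} {p : ℝ × ℝ}

/-! ### The radial equation near infinity -/

/-- `dr*/dr`. -/
def tortoiseWeight (l : ℝ) (p : ℝ × ℝ) (r : ℝ) : ℝ := (r ^ 2 + spin l p ^ 2) / Delta l p r

/-- The zeroth order coefficient of the radial equation. -/
def radialPotential (l : ℝ) (p : ℝ × ℝ) (ω : ℝ) (m : ℤ) (lam r : ℝ) : ℝ :=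
  potentialZero l p ω m lam r + potentialOne l p r - ω ^ 2

/-- The substitution s = 1/r compactifies the end r = ∞: bounds on [c, ∞) follow from continuity on
[0, 1/c]. -/
lemma exists_bound_inv {q : ℝ → ℝ} {c : ℝ} (hc : 0 < c) (hq : ContinuousOn q (Icc 0 c⁻¹)) :
    ∃ B, 0 < B ∧ ∀ r, c ≤ r → |q r⁻¹| ≤ B := by
  obtain ⟨B, hB⟩ := isCompact_Icc.exists_bound_of_continuousOn hq
  refine ⟨max B 1, by positivity, fun r hr => (hB _ ⟨?_, ?_⟩).trans (le_max_left _ _)⟩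
  · have : 0 < r := hc.trans_le hr
    positivity
  · gcongr

lemma tortoiseWeight_pos (hl : 0 < l) (hp : p ∈ paramSpace l) {r : ℝ} (hr : rPlus l p < r) :
    0 < tortoiseWeight l p r := by
  have := Delta_pos hl hp hr
  have := spin_pos hp
  unfold tortoiseWeight; positivity

lemma continuousAt_tortoiseWeight (hl : 0 < l) (hp : p ∈ paramSpace l) {r : ℝ}
    (hr : rPlus l p < r) : ContinuousAt (tortoiseWeight l p) r := by
  unfold tortoiseWeight
  exact ContinuousAt.div (by fun_prop) (continuous_Delta_right l p).continuousAt
    (Delta_pos hl hp hr).ne'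

lemma tortoiseWeight_le (hl : 0 < l) (hp : p ∈ paramSpace l) {c : ℝ} (hc : rPlus l p < c) :
    ∃ B, 0 < B ∧ ∀ r, c ≤ r → |tortoiseWeight l p r| ≤ B / r ^ 2 := by
  have hc0 : 0 < c := (rPlus_pos hl hp).trans hc
  set D : ℝ → ℝ := fun s => (spin l p ^ 2 * s ^ 2 + 1) * (s ^ 2 + 1 / l ^ 2) -
    2 * mass l p * s ^ 3 with hD
  have hDΔ : ∀ r : ℝ, 0 < r → D r⁻¹ = Delta l p r / r ^ 4 := by
    intro r hr
    simp only [hD, Delta]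
    field_simp
  have hD0 : ∀ s ∈ Icc 0 c⁻¹, D s ≠ 0 := by
    rintro s ⟨h0, h1⟩
    rcases h0.eq_or_lt with rfl | h0
    · simp only [hD]; norm_num; exact hl.ne'
    · have h2 : c ≤ s⁻¹ := by rw [le_inv_comm₀ hc0 h0]; exact h1
      have := hDΔ s⁻¹ (by positivity)
      rw [inv_inv] at this
      rw [this]
      have := Delta_pos hl hp (hc.trans_le h2)
      positivity
  obtain ⟨B, hB0, hB⟩ := exists_bound_inv hc0 (q := fun s => (1 + spin l p ^ 2 * s ^ 2) / D s)
    (ContinuousOn.div (by fun_prop) (by simp only [hD]; fun_prop) hD0)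
  refine ⟨B, hB0, fun r hr => ?_⟩
  have hr0 : 0 < r := hc0.trans_le hr
  have h := hB r hr
  have hΔ := Delta_pos hl hp (hc.trans_le hr)
  have e : (1 + spin l p ^ 2 * r⁻¹ ^ 2) / D r⁻¹ = tortoiseWeight l p r * r ^ 2 := by
    rw [hDΔ r hr0, tortoiseWeight]
    field_simp
  rw [e, abs_mul, abs_of_pos (show 0 < r ^ 2 by positivity)] at h
  rwa [le_div_iff₀ (by positivity)]

lemma radialPotential_bound (hl : 0 < l) (hp : p ∈ paramSpace l) {c : ℝ} (hc : 0 < c) (ω : ℝ)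
    (m : ℤ) (lam : ℝ) : ∃ B, 0 < B ∧ ∀ r, c ≤ r → |radialPotential l p ω m lam r| ≤ B := by
  have ha := spin_pos hp
  -- The potential in the variable s = 1/r after simplification. The three parts of V₁ grow
  -- individually like r²/l⁴ with coefficients -3, 5 and -2; these cancel, which makes the
  -- expression regular at s = 0.
  obtain ⟨B, hB0, hB⟩ := exists_bound_inv hc (q := fun s =>
    (((spin l p ^ 2 * s ^ 2 + 1) * (s ^ 2 + 1 / l ^ 2) - 2 * mass l p * s ^ 3) *
        (lam + ω ^ 2 * spin l p ^ 2) - Xi l p ^ 2 * spin l p ^ 2 * m ^ 2 * s ^ 4 -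
      2 * m * ω * spin l p * Xi l p * (((spin l p ^ 2 * s ^ 2 + 1) * (s ^ 2 + 1 / l ^ 2) -
        2 * mass l p * s ^ 3) - (s ^ 2 + spin l p ^ 2 * s ^ 4))) / (1 + spin l p ^ 2 * s ^ 2) ^ 2 +
    ((spin l p ^ 2 * s ^ 2 + 1) * (s ^ 2 + 1 / l ^ 2) - 2 * mass l p * s ^ 3) *
      (-spin l p ^ 2 / l ^ 2 + 2 * mass l p * s + (spin l p ^ 2 - 3 * spin l p ^ 4 / l ^ 2) * s ^ 2
        - 4 * mass l p * spin l p ^ 2 * s ^ 3 +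
        (spin l p ^ 4 - 2 * spin l p ^ 6 / l ^ 2) * s ^ 4) / (1 + spin l p ^ 2 * s ^ 2) ^ 4 - ω ^ 2)
    (by
      refine ContinuousOn.sub (ContinuousOn.add (ContinuousOn.div (by fun_prop) (by fun_prop) ?_)
        (ContinuousOn.div (by fun_prop) (by fun_prop) ?_)) (by fun_prop) <;>
      · intro s _
        positivity)
  refine ⟨B, hB0, fun r hr => ?_⟩
  have hr0 : 0 < r := hc.trans_le hr
  refine le_of_eq_of_le (congrArg abs ?_) (hB r hr)
  unfold radialPotential
  have h1 : r ^ 2 + spin l p ^ 2 ≠ 0 := by positivity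
  congr 2
  · unfold potentialZero Delta
    have h2 : (1 + spin l p ^ 2 * r⁻¹ ^ 2) ^ 2 = (r ^ 2 + spin l p ^ 2) ^ 2 / r ^ 4 := by
      field_simp
    rw [h2]
    field_simp
  · unfold potentialOne Delta
    have h2 : (1 + spin l p ^ 2 * r⁻¹ ^ 2) ^ 4 = (r ^ 2 + spin l p ^ 2) ^ 4 / r ^ 8 := by
      field_simp
    rw [h2]
    field_simp
    ring

lemma continuousAt_radialPotential (hp : p ∈ paramSpace l) (ω : ℝ) (m : ℤ) (lam r : ℝ) :
    ContinuousAt (radialPotential l p ω m lam) r := by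
  have ha := spin_pos hp
  have hΔ := continuous_Delta_right l p
  have h : ∀ n : ℕ, ∀ s : ℝ, (s ^ 2 + spin l p ^ 2) ^ n ≠ 0 := fun n s => by positivity
  have h1 : ∀ s : ℝ, s ^ 2 + spin l p ^ 2 ≠ 0 := fun s => by positivity
  refine Continuous.continuousAt ?_
  unfold radialPotential potentialZero potentialOne
  refine Continuous.sub (Continuous.add (Continuous.div (by fun_prop) (by fun_prop) (h 2))
    (Continuous.sub (Continuous.add (Continuous.div (by fun_prop) (by fun_prop) (h 4))
    (Continuous.div (by fun_prop) (by fun_prop) (h 3))) (Continuous.mul (by fun_prop)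
    (Continuous.div (by fun_prop) (by fun_prop) h1)))) (by fun_prop)

lemma measurable_tortoiseWeight (l : ℝ) :
    Measurable fun x : (ℝ × ℝ) × ℝ => tortoiseWeight l x.1 x.2 := by
  have h1 := continuous_Delta l
  have h2 : Continuous fun x : (ℝ × ℝ) × ℝ => x.2 ^ 2 + spin l x.1 ^ 2 := by
    unfold spin; fun_prop
  exact h2.measurable.div h1.measurable

/-! ### Integrals of powers -/

lemma integrableOn_div_sq {c : ℝ} (hc : 0 < c) (C : ℝ) : IntegrableOn (fun y => C / y ^ 2) (Ioi c) := by
  have h : IntegrableOn (fun y : ℝ => 1 / y ^ 2) (Ioi c) := by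
    have := integrableOn_Ioi_rpow_of_lt (show (-2 : ℝ) < -1 by norm_num) hc
    refine this.congr_fun (fun y hy => ?_) measurableSet_Ioi
    have hy : 0 < y := hc.trans hy
    simp only
    rw [show (-2 : ℝ) = -((2 : ℕ) : ℝ) by norm_num, Real.rpow_neg hy.le, Real.rpow_natCast,
      one_div]
  simpa [div_eq_mul_inv, IntegrableOn] using h.const_mul C

lemma integral_div_sq_mul {x : ℝ} (hx : 0 < x) {C : ℝ} (hC : 0 ≤ C) (n : ℕ) :
    ∫ y in Ioi x, C / y ^ 2 * (C / y) ^ n = (C / x) ^ (n + 1) / (n + 1) := by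
  have h := integral_Ioi_of_hasDerivAt_of_nonneg' (a := x) (l := 0)
    (g := fun y => -((C / y) ^ (n + 1) / (n + 1))) (g' := fun y => C / y ^ 2 * (C / y) ^ n)
    (fun y hy => ?_) (fun y hy => ?_) ?_
  · rw [h]; ring
  · have hy : y ≠ 0 := (hx.trans_le hy).ne'
    have h1 := (((hasDerivAt_const y C).div (hasDerivAt_id y) hy).pow (n + 1)).div_const
      ((n : ℝ) + 1)
    refine h1.neg.congr_deriv ?_
    have : (n : ℝ) + 1 ≠ 0 := by positivity
    simp only [Nat.add_sub_cancel, id, Pi.div_apply]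
    push_cast
    field_simp
    ring
  · have hy : 0 < y := hx.trans hy
    positivity
  · have h1 : Tendsto (fun y : ℝ => C / y) atTop (𝓝 0) := tendsto_const_nhds.div_atTop tendsto_id
    have := ((h1.pow (n + 1)).div_const ((n : ℝ) + 1)).neg
    simpa using this

/-- With dr*/dr = O(r⁻²) and a bounded potential, the inner integral is O(1/r) and the kernel is at
most C/r², which is minus the derivative of G = C/r. The maximum with c only keeps G nonnegative and
bounded for all arguments. -/
lemma radial_volterraBound (hl : 0 < l) (hp : p ∈ paramSpace l) {c : ℝ} (hc : rPlus l p < c)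
    {Q : ℝ → ℝ} (hQ : Measurable Q) {N : ℝ} (hN0 : 0 < N) (hN : ∀ r, c ≤ r → |Q r| ≤ N) :
    ∃ B C A, 0 < B ∧ 0 < C ∧ (∀ r, c ≤ r → |tortoiseWeight l p r| ≤ B / r ^ 2) ∧
      VolterraBound c (tortoiseWeight l p) (fun r => tortoiseWeight l p r * Q r)
      (fun r => B / r ^ 2 * N) (fun r => C / r ^ 2) (fun r => C / max r c) A := by
  have hc0 : 0 < c := (rPlus_pos hl hp).trans hc
  obtain ⟨B, hB0, hB⟩ := tortoiseWeight_le hl hp hc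
  have hw : Measurable (tortoiseWeight l p) := (measurable_tortoiseWeight l).comp
    (measurable_const.prodMk measurable_id : Measurable fun x : ℝ => (p, x))
  refine ⟨B, B * (B * N) / c, B * (B * N) / c / c, hB0, by positivity, hB, hw, hw.mul hQ,
    (integrableOn_div_sq hc0 B).mul_const N, fun y hy => ?_, fun y hy => ?_,
    integrableOn_div_sq hc0 _, by fun_prop, fun y => ?_, fun y hy => ?_, ?_, fun n x hx => ?_⟩
  · rw [abs_mul]
    exact mul_le_mul (hB y hy.le) (hN y hy.le) (abs_nonneg _) (by positivity)
  · have hy0 : 0 < y := hc0.trans hy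
    have h := integral_div_sq_mul hy0 (show 0 ≤ B * N by positivity) 0
    simp only [pow_zero, mul_one, zero_add, pow_one, Nat.cast_zero, div_one] at h
    have e : ∫ z in Ioi y, B / z ^ 2 * N = B * N / y := by
      rw [← h]; congr 1; funext z; ring
    rw [e]
    calc _ ≤ B / y ^ 2 * (B * N / c) := by
          gcongr
          exact hB y hy.le
      _ = _ := by ring
  · have : 0 < max y c := hc0.trans_le (le_max_right _ _)
    positivity
  · rw [max_eq_left hy.le]; gcongr
  · intro x hx y _ hxy
    have : 0 < max x c := hc0.trans_le (le_max_right _ _)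
    simp only
    gcongr
  · rw [max_eq_left hx.le, ← integral_div_sq_mul (hc0.trans hx) (by positivity) n]
    refine (setIntegral_congr_fun measurableSet_Ioi fun y hy => ?_).le
    simp only [max_eq_left (lt_trans hx hy).le]

end

section
variable {l : ℝ} {p : ℝ × ℝ} {ω : ℝ} {m : ℤ} {lam : ℝ}

/-! ### The tortoise coordinate -/

lemma integrableOn_tortoiseWeight (hl : 0 < l) (hp : p ∈ paramSpace l) {c : ℝ}
    (hc : rPlus l p < c) : IntegrableOn (tortoiseWeight l p) (Ioi c) := by
  obtain ⟨B, C, A, -, -, h, hV⟩ := radial_volterraBound hl hp hc (Q := fun _ => 1)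
    measurable_const one_pos (fun r _ => by simp)
  exact hV.b_int.mono' hV.meas_α.aestronglyMeasurable (by
    filter_upwards [ae_restrict_mem measurableSet_Ioi] with y hy
    simpa using h y (le_of_lt hy))

lemma rStar_eq (l : ℝ) (p : ℝ × ℝ) (r : ℝ) :
    rStar l p r = Real.pi / 2 * l - ∫ s in Ioi r, tortoiseWeight l p s := rfl

lemma hasDerivAt_rStar (hl : 0 < l) (hp : p ∈ paramSpace l) {r : ℝ} (hr : rPlus l p < r) :
    HasDerivAt (rStar l p) (tortoiseWeight l p r) r := by
  obtain ⟨c, hc, hcr⟩ := exists_between hr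
  have := (hasDerivAt_integral_Ioi (integrableOn_tortoiseWeight hl hp hc) hcr
    (continuousAt_tortoiseWeight hl hp hr)).const_sub (Real.pi / 2 * l)
  rw [neg_neg] at this
  exact this

lemma strictMonoOn_rStar (hl : 0 < l) (hp : p ∈ paramSpace l) :
    StrictMonoOn (rStar l p) (Ioi (rPlus l p)) := by
  refine strictMonoOn_of_deriv_pos (convex_Ioi _) (fun r hr =>
    (hasDerivAt_rStar hl hp hr).continuousAt.continuousWithinAt) fun r hr => ?_
  rw [interior_Ioi] at hr
  rw [(hasDerivAt_rStar hl hp hr).deriv]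
  exact tortoiseWeight_pos hl hp hr

lemma abs_rStar_sub_le (hl : 0 < l) (hp : p ∈ paramSpace l) {c : ℝ} (hc : rPlus l p < c) :
    ∃ B, 0 < B ∧ ∀ r, c ≤ r → |rStar l p r - Real.pi / 2 * l| ≤ B / r := by
  obtain ⟨B, hB0, hB⟩ := tortoiseWeight_le hl hp hc
  have hc0 : 0 < c := (rPlus_pos hl hp).trans hc
  refine ⟨B, hB0, fun r hr => ?_⟩
  have hr0 : 0 < r := hc0.trans_le hr
  have h := integral_div_sq_mul hr0 hB0.le 0
  simp only [pow_zero, mul_one, zero_add, pow_one, Nat.cast_zero, div_one] at h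
  rw [rStar_eq, sub_sub_cancel_left, abs_neg, ← h, ← Real.norm_eq_abs]
  refine norm_integral_le_of_norm_le (integrableOn_div_sq hr0 B) ?_
  filter_upwards [ae_restrict_mem measurableSet_Ioi] with y hy
  exact hB y (hr.trans (le_of_lt hy))

/-! ### First order form of the radial equation -/

/-- `u` solves the radial equation, and `y` is its derivative in the tortoise coordinate. -/
def IsRadialPair (l : ℝ) (p : ℝ × ℝ) (ω : ℝ) (m : ℤ) (lam : ℝ) (u y : ℝ → ℂ) : Prop :=
  ∀ r : ℝ, rPlus l p < r →
    HasDerivAt u ((tortoiseWeight l p r : ℝ) * y r) r ∧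
    HasDerivAt y (((tortoiseWeight l p r * radialPotential l p ω m lam r : ℝ) : ℂ) * u r) r

lemma inv_tortoiseWeight (l : ℝ) (p : ℝ × ℝ) (r : ℝ) :
    Delta l p r / (r ^ 2 + spin l p ^ 2) = (tortoiseWeight l p r)⁻¹ := by
  rw [tortoiseWeight, inv_div]

lemma IsRadialSolution.isRadialPair (hl : 0 < l) (hp : p ∈ paramSpace l) {u : ℝ → ℂ}
    (h : IsRadialSolution l p ω m lam u) : IsRadialPair l p ω m lam u (dStar l p u) := by
  intro r hr
  obtain ⟨h1, h2, h3⟩ := h r hr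
  have hw : ((tortoiseWeight l p r : ℝ) : ℂ) ≠ 0 :=
    Complex.ofReal_ne_zero.2 (tortoiseWeight_pos hl hp hr).ne'
  have hd : ∀ v : ℝ → ℂ, deriv v r = (tortoiseWeight l p r : ℝ) * dStar l p v r := by
    intro v
    rw [dStar, inv_tortoiseWeight, Complex.ofReal_inv, mul_inv_cancel_left₀ hw]
  refine ⟨h1.hasDerivAt.congr_deriv (hd u), h2.hasDerivAt.congr_deriv ?_⟩
  rw [hd (dStar l p u), Complex.ofReal_mul, mul_assoc]
  congr 1
  exact eq_of_sub_eq_zero (by rw [← neg_eq_zero, ← h3, radialPotential]; ring)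

lemma IsRadialPair.dStar_eq (hl : 0 < l) (hp : p ∈ paramSpace l) {u y : ℝ → ℂ}
    (h : IsRadialPair l p ω m lam u y) {r : ℝ} (hr : rPlus l p < r) : dStar l p u r = y r := by
  have hw : ((tortoiseWeight l p r : ℝ) : ℂ) ≠ 0 :=
    Complex.ofReal_ne_zero.2 (tortoiseWeight_pos hl hp hr).ne'
  rw [dStar, inv_tortoiseWeight, Complex.ofReal_inv, (h r hr).1.deriv, inv_mul_cancel_left₀ hw]

lemma IsRadialPair.isRadialSolution (hl : 0 < l) (hp : p ∈ paramSpace l) {u y : ℝ → ℂ}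
    (h : IsRadialPair l p ω m lam u y) : IsRadialSolution l p ω m lam u := by
  intro r hr
  have hw : ((tortoiseWeight l p r : ℝ) : ℂ) ≠ 0 :=
    Complex.ofReal_ne_zero.2 (tortoiseWeight_pos hl hp hr).ne'
  have h2 : HasDerivAt (dStar l p u)
      (((tortoiseWeight l p r * radialPotential l p ω m lam r : ℝ) : ℂ) * u r) r := by
    refine (h r hr).2.congr_of_eventuallyEq ?_
    filter_upwards [Ioi_mem_nhds hr] with s hs using h.dStar_eq hl hp hs
  refine ⟨(h r hr).1.differentiableAt, h2.differentiableAt, ?_⟩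
  rw [show dStar l p (dStar l p u) r = ((tortoiseWeight l p r)⁻¹ : ℝ) * deriv (dStar l p u) r by
    rw [dStar, inv_tortoiseWeight], h2.deriv, radialPotential, Complex.ofReal_inv,
    Complex.ofReal_mul, mul_assoc, inv_mul_cancel_left₀ hw]
  ring

lemma IsRadialPair.wronskian_eq {u y v z : ℝ → ℂ} (h : IsRadialPair l p ω m lam u y)
    (h' : IsRadialPair l p ω m lam v z) {r s : ℝ} (hr : rPlus l p < r) (hs : rPlus l p < s) :
    u r * z r - y r * v r = u s * z s - y s * v s := by
  refine eq_of_hasDerivAt_zero (f := fun r => u r * z r - y r * v r) isOpen_Ioi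
    isPreconnected_Ioi (fun x hx => ?_) hr hs
  obtain ⟨h1, h2⟩ := h x hx
  obtain ⟨h3, h4⟩ := h' x hx
  refine ((h1.mul h4).sub (h2.mul h3)).congr_deriv ?_
  push_cast
  ring

lemma IsRadialPair.wronskian_eq_of_tendsto {u y v z : ℝ → ℂ} (h : IsRadialPair l p ω m lam u y)
    (h' : IsRadialPair l p ω m lam v z) {A B C D : ℂ} (hu : Tendsto u atTop (𝓝 A))
    (hy : Tendsto y atTop (𝓝 B)) (hv : Tendsto v atTop (𝓝 C)) (hz : Tendsto z atTop (𝓝 D))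
    {r : ℝ} (hr : rPlus l p < r) : u r * z r - y r * v r = A * D - B * C := by
  refine tendsto_nhds_unique (tendsto_const_nhds.congr' ?_) ((hu.mul hz).sub (hy.mul hv))
  filter_upwards [eventually_gt_atTop (rPlus l p)] with s hs using h.wronskian_eq h' hr hs

lemma IsRadialPair.add_smul {u y v z : ℝ → ℂ} (h : IsRadialPair l p ω m lam u y)
    (h' : IsRadialPair l p ω m lam v z) (α β : ℂ) :
    IsRadialPair l p ω m lam (fun r => α * u r + β * v r) (fun r => α * y r + β * z r) := by
  intro r hr
  obtain ⟨h1, h2⟩ := h r hr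
  obtain ⟨h3, h4⟩ := h' r hr
  exact ⟨((h1.const_mul α).add (h3.const_mul β)).congr_deriv (by ring),
    ((h2.const_mul α).add (h4.const_mul β)).congr_deriv (by ring)⟩

/-! ### Solutions with prescribed behaviour at infinity -/

/-- The coefficient of the inner integral in the integral form of the radial equation. -/
def radialInner (l : ℝ) (p : ℝ × ℝ) (ω : ℝ) (m : ℤ) (lam r : ℝ) : ℝ :=
  tortoiseWeight l p r * radialPotential l p ω m lam r

/-- The solution with data `(g, g')` at infinity, if `g` is affine in the tortoise coordinate. -/
def radialSol (l : ℝ) (p : ℝ × ℝ) (ω : ℝ) (m : ℤ) (lam : ℝ) (g : ℝ → ℝ) : ℝ → ℝ :=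
  volterraSol (tortoiseWeight l p) (radialInner l p ω m lam) g

/-- The derivative of `radialSol`, up to that of `g`. -/
def radialFlux (l : ℝ) (p : ℝ × ℝ) (ω : ℝ) (m : ℤ) (lam : ℝ) (g : ℝ → ℝ) (r : ℝ) : ℝ :=
  ∫ s in Ioi r, radialInner l p ω m lam s * radialSol l p ω m lam g s

lemma measurable_radialPotential (l : ℝ) (m : ℤ) : Measurable
    fun x : ((ℝ × ℝ) × ℝ × ℝ) × ℝ => radialPotential l x.1.1 x.1.2.1 m x.1.2.2 x.2 := by
  have h1 : Measurable fun x : ((ℝ × ℝ) × ℝ × ℝ) × ℝ => Delta l x.1.1 x.2 := by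
    unfold Delta spin mass; fun_prop
  have h2 : Measurable fun x : ((ℝ × ℝ) × ℝ × ℝ) × ℝ => spin l x.1.1 := by
    unfold spin; fun_prop
  have h3 : Measurable fun x : ((ℝ × ℝ) × ℝ × ℝ) × ℝ => mass l x.1.1 := by
    unfold mass; fun_prop
  have h4 : Measurable fun x : ((ℝ × ℝ) × ℝ × ℝ) × ℝ => Xi l x.1.1 := by
    unfold Xi spin; fun_prop
  unfold radialPotential potentialZero potentialOne
  fun_prop

lemma measurable_radialInner (l : ℝ) (m : ℤ) : Measurable
    fun x : ((ℝ × ℝ) × ℝ × ℝ) × ℝ => radialInner l x.1.1 x.1.2.1 m x.1.2.2 x.2 := by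
  have h : Measurable fun x : ((ℝ × ℝ) × ℝ × ℝ) × ℝ => tortoiseWeight l x.1.1 x.2 :=
    (measurable_tortoiseWeight l).comp
      ((measurable_fst.comp measurable_fst).prodMk measurable_snd)
  exact h.mul (measurable_radialPotential l m)

lemma exists_radial_volterraBound (hl : 0 < l) (hp : p ∈ paramSpace l) (ω : ℝ) (m : ℤ) (lam : ℝ)
    {c : ℝ} (hc : rPlus l p < c) :
    ∃ B C A N, 0 < B ∧ 0 < C ∧ 0 < N ∧ VolterraBound c (tortoiseWeight l p)
      (radialInner l p ω m lam) (fun r => B / r ^ 2 * N) (fun r => C / r ^ 2)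
      (fun r => C / max r c) A := by
  obtain ⟨N, hN0, hN⟩ := radialPotential_bound hl hp ((rPlus_pos hl hp).trans hc) ω m lam
  obtain ⟨B, C, A, hB, hC, -, h⟩ := radial_volterraBound hl hp hc
    (Q := radialPotential l p ω m lam) (continuous_iff_continuousAt.2 fun r =>
      continuousAt_radialPotential hp ω m lam r).measurable hN0 hN
  exact ⟨B, C, A, N, hB, hC, hN0, h⟩

/-- `g` is, near infinity, an inhomogeneity for the integral form of the radial equation. -/
structure IsRadialSeed (l : ℝ) (p : ℝ × ℝ) (g : ℝ → ℝ) (A B : ℝ) : Prop where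
  meas : Measurable g
  bound : ∀ c, rPlus l p < c → ∃ D, 0 ≤ D ∧ ∀ y, c < y → |g y| ≤ D
  deriv : ∀ r, rPlus l p < r → HasDerivAt g (tortoiseWeight l p r * B) r
  lim : Tendsto g atTop (𝓝 A)

lemma isRadialSeed_one (l : ℝ) (p : ℝ × ℝ) : IsRadialSeed l p (fun _ => 1) 1 0 where
  meas := measurable_const
  bound _ _ := ⟨1, zero_le_one, fun _ _ => by simp⟩
  deriv r _ := by simpa using hasDerivAt_const r (1 : ℝ)
  lim := tendsto_const_nhds

lemma measurable_rStar (l : ℝ) : Measurable fun x : (ℝ × ℝ) × ℝ => rStar l x.1 x.2 := by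
  have h := measurable_integral_Ioi (f := fun p : ℝ × ℝ => tortoiseWeight l p)
    (measurable_tortoiseWeight l)
  exact h.const_sub _

lemma isRadialSeed_rStar (hl : 0 < l) (hp : p ∈ paramSpace l) :
    IsRadialSeed l p (fun r => rStar l p r - Real.pi / 2 * l) 0 1 where
  meas := ((measurable_rStar l).comp
    (measurable_const.prodMk measurable_id : Measurable fun x : ℝ => (p, x))).sub_const _
  bound c hc := by
    obtain ⟨B, hB0, hB⟩ := abs_rStar_sub_le hl hp hc
    have hc0 : 0 < c := (rPlus_pos hl hp).trans hc
    refine ⟨B / c, by positivity, fun y hy => (hB y hy.le).trans ?_⟩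
    gcongr
  deriv r hr := by simpa using (hasDerivAt_rStar hl hp hr).sub_const (Real.pi / 2 * l)
  lim := by
    obtain ⟨B, hB0, hB⟩ := abs_rStar_sub_le hl hp (lt_add_one (rPlus l p))
    refine squeeze_zero_norm' ?_ (tendsto_const_nhds.div_atTop tendsto_id : Tendsto
      (fun r : ℝ => B / r) atTop (𝓝 0))
    filter_upwards [eventually_ge_atTop (rPlus l p + 1)] with r hr using hB r hr

/-- Differentiating u = g + Tu twice recovers the equation, because g is affine in r* and
contributes nothing to u''. The seeds 1 and r* - πl/2 generate a fundamental system. -/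
lemma IsRadialSeed.isRadialPair (hl : 0 < l) (hp : p ∈ paramSpace l) {g : ℝ → ℝ} {A B : ℝ}
    (h : IsRadialSeed l p g A B) (ω : ℝ) (m : ℤ) (lam : ℝ) :
    IsRadialPair l p ω m lam (fun r => (radialSol l p ω m lam g r : ℝ))
      (fun r => (B - radialFlux l p ω m lam g r : ℝ)) := by
  intro r hr
  obtain ⟨c, hc, hcr⟩ := exists_between hr
  obtain ⟨b, C, A', N, hb, hC, hN, hV⟩ := exists_radial_volterraBound hl hp ω m lam hc
  obtain ⟨D, hD0, hD⟩ := h.bound c hc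
  have hw := continuousAt_tortoiseWeight hl hp hr
  have hβ : ContinuousAt (radialInner l p ω m lam) r :=
    hw.mul (continuousAt_radialPotential hp ω m lam r)
  have h1 := hV.hasDerivAt_sol h.meas hD0 hD hcr (h.deriv r hr) hw hβ
  have h2 := (hV.hasDerivAt_inner h.meas hD0 hD hcr (h.deriv r hr).continuousAt hβ).const_sub B
  constructor
  · refine (h1.ofReal_comp).congr_deriv ?_
    rw [← Complex.ofReal_mul, Complex.ofReal_inj, radialFlux, mul_sub]
    rfl
  · refine (h2.ofReal_comp).congr_deriv ?_
    rw [← Complex.ofReal_mul, Complex.ofReal_inj, neg_neg]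
    rfl

lemma IsRadialSeed.tendsto (hl : 0 < l) (hp : p ∈ paramSpace l) {g : ℝ → ℝ} {A B : ℝ}
    (h : IsRadialSeed l p g A B) (ω : ℝ) (m : ℤ) (lam : ℝ) :
    Tendsto (fun r => ((radialSol l p ω m lam g r : ℝ) : ℂ)) atTop (𝓝 A) ∧
      Tendsto (fun r => ((B - radialFlux l p ω m lam g r : ℝ) : ℂ)) atTop (𝓝 B) := by
  have hc := lt_add_one (rPlus l p)
  set c := rPlus l p + 1
  have hc0 : 0 < c := (rPlus_pos hl hp).trans hc
  obtain ⟨b, C, A', N, hb, hC, hN, hV⟩ := exists_radial_volterraBound hl hp ω m lam hc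
  obtain ⟨D, hD0, hD⟩ := h.bound c hc
  have hlim : ∀ E : ℝ, Tendsto (fun r : ℝ => E / r) atTop (𝓝 0) := fun E =>
    tendsto_const_nhds.div_atTop tendsto_id
  constructor
  · refine (Complex.continuous_ofReal.tendsto A).comp ?_
    have h1 : Tendsto (fun r => radialSol l p ω m lam g r - g r) atTop (𝓝 0) := by
      refine squeeze_zero_norm' ?_ (hlim (D * Real.exp A' * C))
      filter_upwards [eventually_gt_atTop c] with r hr
      refine (hV.abs_sol_sub_le h.meas hD0 hD hr).trans_eq ?_
      rw [max_eq_left hr.le]; ring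
    simpa using h1.add h.lim
  · refine (Complex.continuous_ofReal.tendsto B).comp ?_
    have h1 : Tendsto (radialFlux l p ω m lam g) atTop (𝓝 0) := by
      refine squeeze_zero_norm' ?_ (hlim (b * N * (D * Real.exp A')))
      filter_upwards [eventually_gt_atTop c] with r hr
      refine (hV.abs_inner_sol_le hD0 hD hr).trans_eq ?_
      have h := integral_div_sq_mul (hc0.trans hr) hb.le 0
      simp only [pow_zero, mul_one, zero_add, pow_one, Nat.cast_zero, div_one] at h
      rw [integral_mul_const, h]; ring
    simpa using h1.const_sub B

/-- `u_∞`, in explicit form. -/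
def infSol (l : ℝ) (p : ℝ × ℝ) (ω : ℝ) (m : ℤ) (lam : ℝ) : ℝ → ℝ :=
  radialSol l p ω m lam fun r => rStar l p r - Real.pi / 2 * l

/-- The derivative of `u_∞` in the tortoise coordinate, in explicit form. -/
def infFlux (l : ℝ) (p : ℝ × ℝ) (ω : ℝ) (m : ℤ) (lam r : ℝ) : ℝ :=
  1 - radialFlux l p ω m lam (fun r => rStar l p r - Real.pi / 2 * l) r

lemma isRadialPair_infSol (hl : 0 < l) (hp : p ∈ paramSpace l) (ω : ℝ) (m : ℤ) (lam : ℝ) :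
    IsRadialPair l p ω m lam (fun r => (infSol l p ω m lam r : ℝ))
      (fun r => (infFlux l p ω m lam r : ℝ)) :=
  (isRadialSeed_rStar hl hp).isRadialPair hl hp ω m lam

lemma tendsto_infSol (hl : 0 < l) (hp : p ∈ paramSpace l) (ω : ℝ) (m : ℤ) (lam : ℝ) :
    Tendsto (fun r => ((infSol l p ω m lam r : ℝ) : ℂ)) atTop (𝓝 0) ∧
      Tendsto (fun r => ((infFlux l p ω m lam r : ℝ) : ℂ)) atTop (𝓝 1) := by
  have h := (isRadialSeed_rStar hl hp).tendsto hl hp ω m lam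
  rw [Complex.ofReal_zero, Complex.ofReal_one] at h
  exact h

lemma exists_isRadialPair_regular (hl : 0 < l) (hp : p ∈ paramSpace l) (ω : ℝ) (m : ℤ)
    (lam : ℝ) : ∃ v z : ℝ → ℂ, IsRadialPair l p ω m lam v z ∧ Tendsto v atTop (𝓝 1) ∧
      Tendsto z atTop (𝓝 0) := by
  have h := (isRadialSeed_one l p).tendsto hl hp ω m lam
  exact ⟨_, _, (isRadialSeed_one l p).isRadialPair hl hp ω m lam, by simpa using h.1,
    by simpa using h.2⟩

lemma isUInfty_infSol (hl : 0 < l) (hp : p ∈ paramSpace l) (ω : ℝ) (m : ℤ) (lam : ℝ) :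
    IsUInfty l p ω m lam (fun r => (infSol l p ω m lam r : ℝ)) := by
  have h := isRadialPair_infSol hl hp ω m lam
  refine ⟨h.isRadialSolution hl hp, (tendsto_infSol hl hp ω m lam).1,
    (tendsto_infSol hl hp ω m lam).2.congr' ?_⟩
  filter_upwards [eventually_gt_atTop (rPlus l p)] with r hr using (h.dStar_eq hl hp hr).symm

/-- Uniqueness by three Wronskians evaluated at infinity: those of the explicit solution and of u
with the regular solution v both equal -1, and that of u with the explicit solution is 0. Linear
algebra at r concludes. -/
lemma IsUInfty.eq_infSol (hl : 0 < l) (hp : p ∈ paramSpace l) {u : ℝ → ℂ}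
    (hu : IsUInfty l p ω m lam u) {r : ℝ} (hr : rPlus l p < r) :
    u r = (infSol l p ω m lam r : ℝ) ∧ dStar l p u r = (infFlux l p ω m lam r : ℝ) := by
  obtain ⟨v, z, hvz, hv, hz⟩ := exists_isRadialPair_regular hl hp ω m lam
  have h := isRadialPair_infSol hl hp ω m lam
  obtain ⟨h1, h2⟩ := tendsto_infSol hl hp ω m lam
  have hu' := hu.1.isRadialPair hl hp
  have e1 := h.wronskian_eq_of_tendsto hvz h1 h2 hv hz hr
  have e2 := hu'.wronskian_eq_of_tendsto hvz hu.2.1 hu.2.2 hv hz hr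
  have e3 := hu'.wronskian_eq_of_tendsto h hu.2.1 hu.2.2 h1 h2 hr
  set U := ((infSol l p ω m lam r : ℝ) : ℂ)
  set Y := ((infFlux l p ω m lam r : ℝ) : ℂ)
  constructor
  · linear_combination (u r - U) * e1 + (U) * (e1 - e2) + v r * e3
  · linear_combination (dStar l p u r - Y) * e1 + Y * (e1 - e2) + z r * e3

/-! ### The Wronskian `𝔚₂` -/

/-- Cramer's rule for the fundamental system, whose Wronskian is -1. -/
lemma exists_isRadialPair_data (hl : 0 < l) (hp : p ∈ paramSpace l) (ω : ℝ) (m : ℤ) (lam : ℝ)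
    {r : ℝ} (hr : rPlus l p < r) (A B : ℂ) :
    ∃ u y : ℝ → ℂ, IsRadialPair l p ω m lam u y ∧ u r = A ∧ y r = B := by
  obtain ⟨v, z, hvz, hv, hz⟩ := exists_isRadialPair_regular hl hp ω m lam
  have h := isRadialPair_infSol hl hp ω m lam
  obtain ⟨h1, h2⟩ := tendsto_infSol hl hp ω m lam
  have e1 := h.wronskian_eq_of_tendsto hvz h1 h2 hv hz hr
  refine ⟨_, _, h.add_smul hvz (B * v r - A * z r)
    (A * (infFlux l p ω m lam r : ℝ) - B * (infSol l p ω m lam r : ℝ)), ?_, ?_⟩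
  · linear_combination -A * e1
  · linear_combination -B * e1

/-- The Wronskian is constant, so it may be moved to the point where the data of u_Ai2 are
prescribed. Existence of both solutions makes the choices in their definitions genuine, and
injectivity of r* identifies the initial point. -/
lemma wTwo_eq (hl : 0 < l) (hp : p ∈ paramSpace l) {ε : ℝ × ℝ → ℝ} {ℓ : ℕ} {r₀ : ℝ}
    (h₁ : rPlus l p < turnOne l p (lamMinus l p m ℓ / (m : ℝ) ^ 2))
    (hr : turnOne l p (lamMinus l p m ℓ / (m : ℝ) ^ 2) < r₀)
    (hr' : rStar l p r₀ = rStar l p (turnOne l p (lamMinus l p m ℓ / (m : ℝ) ^ 2)) + ε p) :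
    wTwo l ε m ℓ p =
      airyApprox l p m (lamMinus l p m ℓ / (m : ℝ) ^ 2) r₀ *
          (infFlux l p (omegaMinus l p * m) m (lamMinus l p m ℓ) r₀ : ℝ) -
        dStar l p (airyApprox l p m (lamMinus l p m ℓ / (m : ℝ) ^ 2)) r₀ *
          (infSol l p (omegaMinus l p * m) m (lamMinus l p m ℓ) r₀ : ℝ) := by
  set μ := lamMinus l p m ℓ / (m : ℝ) ^ 2 with hμ
  have hr₀ : rPlus l p < r₀ := h₁.trans hr
  have hinf : IsUInfty l p (omegaMinus l p * m) m (lamMinus l p m ℓ) (uInfty l p m ℓ) :=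
    Classical.epsilon_spec ⟨_, isUInfty_infSol hl hp _ m _⟩
  have hai : IsUAiryTwo l ε p m (lamMinus l p m ℓ) (uAiryTwo l ε p m ℓ) := by
    refine Classical.epsilon_spec ?_
    obtain ⟨u, y, hu, h2, h3⟩ := exists_isRadialPair_data hl hp (omegaMinus l p * m) m
      (lamMinus l p m ℓ) hr₀ (airyApprox l p m μ r₀) (dStar l p (airyApprox l p m μ) r₀)
    exact ⟨u, hu.isRadialSolution hl hp, r₀, hr, hr', h2, by rw [hu.dStar_eq hl hp hr₀, h3]⟩
  obtain ⟨hs, r₁, h2, h3, h4, h5⟩ := hai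
  obtain rfl : r₁ = r₀ :=
    (strictMonoOn_rStar hl hp).injOn (mem_Ioi.2 (h₁.trans h2)) hr₀ (h3.trans hr'.symm)
  obtain ⟨h6, h7⟩ := hinf.eq_infSol hl hp hr₀
  rw [wTwo, wronskian, (hs.isRadialPair hl hp).wronskian_eq (hinf.1.isRadialPair hl hp)
    (lt_add_one _) hr₀, h4, h5, h6, h7]

end

/-! ### Airy's equation -/

/-- The coefficient of `x ^ (3 k + j)` in a power series solution of Airy's equation. -/
def airyCoeff (j k : ℕ) : ℝ := ∏ i ∈ Finset.range k, (((3 * i + 3 + j) * (3 * i + 2 + j) : ℕ) : ℝ)⁻¹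

lemma airyCoeff_succ (j k : ℕ) :
    airyCoeff j (k + 1) * ((3 * k + 3 + j : ℕ) * (3 * k + 2 + j : ℕ)) = airyCoeff j k := by
  rw [airyCoeff, Finset.prod_range_succ, mul_assoc, Nat.cast_mul,
    inv_mul_cancel₀ (by positivity), mul_one, airyCoeff]

lemma airyCoeff_nonneg (j k : ℕ) : 0 ≤ airyCoeff j k :=
  Finset.prod_nonneg fun _ _ => by positivity

lemma airyCoeff_le (j k : ℕ) : airyCoeff j k ≤ (k.factorial : ℝ)⁻¹ := by
  induction k with
  | zero => simp [airyCoeff]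
  | succ k ih =>
    have e : ((k + 1).factorial : ℝ)⁻¹ = (k.factorial : ℝ)⁻¹ * ((k + 1 : ℕ) : ℝ)⁻¹ := by
      rw [Nat.factorial_succ, mul_comm (k + 1), Nat.cast_mul, mul_inv]
    rw [airyCoeff, Finset.prod_range_succ, e]
    refine mul_le_mul ih ?_ (by positivity) (by positivity)
    refine inv_anti₀ (Nat.cast_pos.2 k.succ_pos) (Nat.cast_le.2 ?_)
    nlinarith

/-- The power series starting with xʲ. Its first term is split off so that no exponent in the
differentiated tails is a truncated subtraction. On |x| ≤ R the tails are dominated by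
R^{3+j}(R³)ᵏ/k!, which permits termwise differentiation. -/
lemma exists_airy_series (j : ℕ) (hj : j ≤ 1) : ∃ y y' : ℝ → ℝ, (∀ x, HasDerivAt y (y' x) x) ∧
    (∀ x, HasDerivAt y' (x * y x) x) ∧ y 0 = 0 ^ j ∧ y' 0 = j := by
  set t : ℕ → ℝ → ℝ := fun k x => airyCoeff j (k + 1) * x ^ (3 * k + 3 + j) with ht
  set t' : ℕ → ℝ → ℝ := fun k x =>
    airyCoeff j (k + 1) * ((3 * k + 3 + j : ℕ) * x ^ (3 * k + 2 + j)) with ht'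
  set t'' : ℕ → ℝ → ℝ := fun k x => airyCoeff j k * x ^ (3 * k + 1 + j) with ht''
  set u : ℝ → ℕ → ℝ := fun R k => R ^ (3 + j) * ((R ^ 3) ^ k / k.factorial) with hu
  have hus : ∀ R, Summable (u R) := fun R => (Real.summable_pow_div_factorial (R ^ 3)).mul_left _
  have hc : ∀ k, airyCoeff j (k + 1) * (3 * k + 3 + j : ℕ) ≤ airyCoeff j k := by
    intro k
    rw [← airyCoeff_succ j k, ← mul_assoc]
    refine le_mul_of_one_le_right (mul_nonneg (airyCoeff_nonneg _ _) (by positivity)) ?_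
    exact_mod_cast (by omega : 1 ≤ 3 * k + 2 + j)
  have hbound : ∀ R, 1 ≤ R → ∀ k i, i ≤ 3 * k + 3 + j → ∀ x, |x| ≤ R → ∀ a, 0 ≤ a →
      a ≤ airyCoeff j k → ‖a * x ^ i‖ ≤ u R k := by
    intro R hR k i hi x hx a ha hak
    rw [norm_mul, Real.norm_of_nonneg ha, norm_pow, Real.norm_eq_abs]
    calc a * |x| ^ i ≤ (k.factorial : ℝ)⁻¹ * R ^ (3 * k + 3 + j) := by
          refine mul_le_mul (hak.trans (airyCoeff_le j k)) ?_ (by positivity) (by positivity)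
          exact (pow_le_pow_left₀ (abs_nonneg _) hx _).trans (pow_le_pow_right₀ hR hi)
      _ = u R k := by rw [hu]; simp only; rw [← pow_mul, add_assoc, pow_add]; ring
  have hb' : ∀ R, 1 ≤ R → ∀ k x, |x| ≤ R → ‖t' k x‖ ≤ u R k := by
    intro R hR k x hx
    rw [ht']; simp only
    rw [← mul_assoc]
    exact hbound R hR k _ (by omega) x hx _ (mul_nonneg (airyCoeff_nonneg _ _) (by positivity))
      (hc k)
  have hb'' : ∀ R, 1 ≤ R → ∀ k x, |x| ≤ R → ‖t'' k x‖ ≤ u R k := fun R hR k x hx =>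
    hbound R hR k _ (by omega) x hx _ (airyCoeff_nonneg _ _) le_rfl
  have hz : ∀ k, t k 0 = 0 := fun k => by simp [ht]
  have hz' : ∀ k, t' k 0 = 0 := fun k => by simp [ht']
  have hmem : ∀ x : ℝ, x ∈ Metric.ball (0 : ℝ) (|x| + 1) := fun x => by simp
  have hle : ∀ {x y : ℝ}, y ∈ Metric.ball (0 : ℝ) (|x| + 1) → |y| ≤ |x| + 1 := fun {x y} hy => by
    rw [mem_ball_zero_iff] at hy; exact hy.le
  have h1R : ∀ x : ℝ, 1 ≤ |x| + 1 := fun x => by linarith [abs_nonneg x]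
  have hd : ∀ x, HasDerivAt (fun x => ∑' k, t k x) (∑' k, t' k x) x := fun x =>
    hasDerivAt_tsum_of_isPreconnected (hus (|x| + 1)) Metric.isOpen_ball
      (convex_ball _ _).isPreconnected (fun k y _ =>
        ((hasDerivAt_pow (3 * k + 3 + j) y).const_mul (airyCoeff j (k + 1))).congr_deriv (by
          rw [ht', show 3 * k + 3 + j - 1 = 3 * k + 2 + j by omega]))
      (fun k y hy => hb' _ (h1R x) k y (hle hy)) (Metric.mem_ball_self (by positivity))
      (by simp only [hz]; exact summable_zero) (hmem x)
  have hd' : ∀ x, HasDerivAt (fun x => ∑' k, t' k x) (∑' k, t'' k x) x := fun x =>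
    hasDerivAt_tsum_of_isPreconnected (hus (|x| + 1)) Metric.isOpen_ball
      (convex_ball _ _).isPreconnected (fun k y _ =>
        (((hasDerivAt_pow (3 * k + 2 + j) y).const_mul _).const_mul
          (airyCoeff j (k + 1))).congr_deriv (by
          rw [ht'']
          simp only
          rw [show 3 * k + 2 + j - 1 = 3 * k + 1 + j by omega, ← airyCoeff_succ j k]
          ring))
      (fun k y hy => hb'' _ (h1R x) k y (hle hy)) (Metric.mem_ball_self (by positivity))
      (by simp only [hz']; exact summable_zero) (hmem x)
  refine ⟨fun x => x ^ j + ∑' k, t k x, fun x => j + ∑' k, t' k x, fun x => ?_, fun x => ?_,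
    by simp [hz], by simp [hz']⟩
  · refine ((hasDerivAt_pow j x).add (hd x)).congr_deriv ?_
    interval_cases j <;> simp
  · refine ((hd' x).const_add (j : ℝ)).congr_deriv ?_
    have hs : Summable fun k => airyCoeff j k * x ^ (3 * k + j) :=
      Summable.of_norm_bounded (hus (|x| + 1)) fun k => hbound _ (h1R x) k _ (by omega) x
        (by linarith) _ (airyCoeff_nonneg _ _) le_rfl
    have e : ∑' k, t'' k x = x * ∑' k, airyCoeff j k * x ^ (3 * k + j) := by
      rw [← tsum_mul_left]
      exact tsum_congr fun k => by simp only [ht'']; ring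
    rw [e, hs.tsum_eq_zero_add]
    congr 2
    · simp [airyCoeff]

lemma exists_isAiry : ∃ y, IsAiry y := by
  obtain ⟨f, f', h1, h2, h3, h4⟩ := exists_airy_series 0 zero_le_one
  obtain ⟨g, g', h5, h6, h7, h8⟩ := exists_airy_series 1 le_rfl
  set A : ℝ := 1 / ((3 : ℝ) ^ (2 / 3 : ℝ) * Real.Gamma (2 / 3))
  set B : ℝ := -1 / ((3 : ℝ) ^ (1 / 3 : ℝ) * Real.Gamma (1 / 3))
  have hd : ∀ x, HasDerivAt (fun x => A * f x + B * g x) (A * f' x + B * g' x) x := fun x =>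
    ((h1 x).const_mul A).add ((h5 x).const_mul B)
  have hde : deriv (fun x => A * f x + B * g x) = fun x => A * f' x + B * g' x :=
    funext fun x => (hd x).deriv
  refine ⟨fun x => A * f x + B * g x, fun x => (hd x).differentiableAt, fun x => ?_, ?_, ?_⟩
  · rw [hde]
    exact (((h2 x).const_mul A).add ((h6 x).const_mul B)).congr_deriv (by ring)
  · change A * f 0 + B * g 0 = A
    rw [h3, h7]; ring
  · rw [hde]
    change A * f' 0 + B * g' 0 = B
    rw [h4, h8, Nat.cast_zero, Nat.cast_one]; ring

lemma differentiable_airyAi : Differentiable ℝ airyAi :=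
  (Classical.epsilon_spec exists_isAiry : IsAiry airyAi).1

section
variable {l : ℝ} {p : ℝ × ℝ} {μ : ℝ}

/-! ### The Liouville–Green variable at the turning point -/

/-- The quotient `h / ((3/2) ∫ √h k)^{2/3}` has a limit at a simple zero of `h`. -/
lemma tendsto_div_integral_sqrt_rpow {h k : ℝ → ℝ} {d k₀ δ : ℝ} (hδ : 0 < δ) (hd : 0 < d)
    (hk₀ : 0 < k₀) (hpos : ∀ t ∈ Ioo 0 δ, 0 < h t) (hc : ContinuousOn h (Icc 0 δ))
    (hkc : ContinuousOn k (Icc 0 δ)) (hk : k 0 = k₀)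
    (hlim : Tendsto (fun t => h t / t) (𝓝[>] 0) (𝓝 d)) :
    Tendsto (fun t => h t / (3 / 2 * ∫ s in (0 : ℝ)..t, √(h s) * k s) ^ (2 / 3 : ℝ)) (𝓝[>] 0)
      (𝓝 (d / (√d * k₀) ^ (2 / 3 : ℝ))) := by
  have hIoo : Ioo 0 δ ∈ 𝓝[>] (0 : ℝ) := Ioo_mem_nhdsGT hδ
  have hfc : ContinuousOn (fun s => √(h s) * k s) (Icc 0 δ) :=
    (Real.continuous_sqrt.comp_continuousOn hc).mul hkc
  have hfi : IntervalIntegrable (fun s => √(h s) * k s) volume 0 δ :=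
    ContinuousOn.intervalIntegrable (by rwa [uIcc_of_le hδ.le])
  -- By l'Hôpital: the integrand behaves like √d k₀ √t. The claim then follows by writing the
  -- quotient as (h/t) over ((3/2)J/t^{3/2})^{2/3}, with J the integral.
  have hJ : Tendsto (fun t => (∫ s in (0 : ℝ)..t, √(h s) * k s) / t ^ (3 / 2 : ℝ)) (𝓝[>] 0)
      (𝓝 (√d * k₀ * (2 / 3))) := by
    refine HasDerivAt.lhopital_zero_nhdsGT (f' := fun t => √(h t) * k t)
      (g' := fun t => (3 / 2 : ℝ) * t ^ (1 / 2 : ℝ)) ?_ ?_ ?_ ?_ ?_ ?_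
    · filter_upwards [hIoo] with t ht
      refine intervalIntegral.integral_hasDerivAt_right (hfi.mono_set ?_) ?_ ?_
      · rw [uIcc_of_le ht.1.le, uIcc_of_le hδ.le]; exact Icc_subset_Icc le_rfl ht.2.le
      · exact (hfc.mono Ioo_subset_Icc_self).stronglyMeasurableAtFilter isOpen_Ioo t ht
      · exact hfc.continuousAt (Icc_mem_nhds ht.1 ht.2)
    · filter_upwards [hIoo] with t ht
      refine (Real.hasDerivAt_rpow_const (Or.inl ht.1.ne')).congr_deriv ?_
      norm_num
    · filter_upwards [hIoo] with t ht
      have := Real.rpow_pos_of_pos ht.1 (1 / 2)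
      positivity
    · have h1 : ContinuousOn (fun t => ∫ s in (0 : ℝ)..t, √(h s) * k s) (Icc 0 δ) := by
        have := intervalIntegral.continuousOn_primitive_interval (f := fun s => √(h s) * k s)
          (μ := volume) (a := 0) (b := δ) (by
            rw [uIcc_of_le hδ.le]; exact hfc.integrableOn_Icc)
        rwa [uIcc_of_le hδ.le] at this
      have h2 := (h1 0 ⟨le_rfl, hδ.le⟩).tendsto
      simp only [intervalIntegral.integral_same] at h2
      exact h2.mono_left (nhdsWithin_le_of_mem (mem_of_superset hIoo Ioo_subset_Icc_self))
    · have h1 : Tendsto (fun t : ℝ => t ^ (3 / 2 : ℝ)) (𝓝 0) (𝓝 (0 ^ (3 / 2 : ℝ))) :=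
        (Real.continuousAt_rpow_const 0 (3 / 2) (Or.inr (by norm_num))).tendsto
      rw [Real.zero_rpow (by norm_num)] at h1
      exact h1.mono_left nhdsWithin_le_nhds
    · have h1 : Tendsto k (𝓝[>] 0) (𝓝 k₀) := by
        rw [← hk]
        exact (hkc 0 ⟨le_rfl, hδ.le⟩).tendsto.mono_left
          (nhdsWithin_le_of_mem (mem_of_superset hIoo Ioo_subset_Icc_self))
      refine (((Real.continuous_sqrt.tendsto d).comp hlim).mul h1 |>.mul_const (2 / 3)).congr' ?_
      filter_upwards [hIoo] with t ht
      have ht0 := Real.sqrt_pos.2 ht.1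
      rw [Function.comp_apply, Real.sqrt_div (hpos t ht).le, ← Real.sqrt_eq_rpow]
      field_simp
  have hne : √d * k₀ ≠ 0 := (mul_pos (Real.sqrt_pos.2 hd) hk₀).ne'
  have h1 : Tendsto (fun t => (3 / 2 * ((∫ s in (0 : ℝ)..t, √(h s) * k s) / t ^ (3 / 2 : ℝ))) ^
      (2 / 3 : ℝ)) (𝓝[>] 0) (𝓝 ((√d * k₀) ^ (2 / 3 : ℝ))) := by
    have := (hJ.const_mul (3 / 2)).rpow_const (p := 2 / 3) (Or.inr (by norm_num))
    rwa [show 3 / 2 * (√d * k₀ * (2 / 3)) = √d * k₀ by ring] at this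
  have h2 : (√d * k₀) ^ (2 / 3 : ℝ) ≠ 0 :=
    (Real.rpow_pos_of_pos (mul_pos (Real.sqrt_pos.2 hd) hk₀) _).ne'
  refine (hlim.div h1 h2).congr' ?_
  have hJpos : ∀ᶠ t in 𝓝[>] (0 : ℝ), 0 < 3 / 2 *
      ((∫ s in (0 : ℝ)..t, √(h s) * k s) / t ^ (3 / 2 : ℝ)) := by
    refine (hJ.const_mul (3 / 2)).eventually_const_lt ?_
    have := Real.sqrt_pos.2 hd
    positivity
  filter_upwards [hIoo, hJpos] with t ht hJt
  have ht0 := Real.rpow_pos_of_pos ht.1 (3 / 2)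
  have e : 3 / 2 * (∫ s in (0 : ℝ)..t, √(h s) * k s) =
      3 / 2 * ((∫ s in (0 : ℝ)..t, √(h s) * k s) / t ^ (3 / 2 : ℝ)) * t ^ (3 / 2 : ℝ) := by
    field_simp
  rw [e, Real.mul_rpow hJt.le ht0.le, ← Real.rpow_mul ht.1.le]
  norm_num
  rw [div_div, mul_comm]

lemma TurningPoints.rPlus_lt_turnTwo (h : TurningPoints l p μ) : rPlus l p < turnTwo l p μ :=
  (h.lt_one.trans h.one_lt).trans h.lt_two

lemma TurningPoints.one_lt_two (h : TurningPoints l p μ) : turnOne l p μ < turnTwo l p μ :=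
  h.one_lt.trans h.lt_two

lemma continuous_potentialMain (hp : p ∈ paramSpace l) (μ : ℝ) :
    Continuous (potentialMain l p μ) := by
  have ha := spin_pos hp
  have hΔ := continuous_Delta_right l p
  have h : ∀ n : ℕ, ∀ s : ℝ, (s ^ 2 + spin l p ^ 2) ^ n ≠ 0 := fun n s => by positivity
  have h1 : ∀ s : ℝ, s ^ 2 + spin l p ^ 2 ≠ 0 := fun s => by positivity
  unfold potentialMain omegaAt
  exact ((hΔ.div (by fun_prop) (h 2)).mul continuous_const).sub
    ((continuous_const.sub (continuous_const.div (by fun_prop) h1)).pow 2)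

lemma continuousOn_tortoiseWeight (hl : 0 < l) (hp : p ∈ paramSpace l) :
    ContinuousOn (tortoiseWeight l p) (Ioi (rPlus l p)) := fun _ hr =>
  (continuousAt_tortoiseWeight hl hp hr).continuousWithinAt

/-- `V_main / ξ₂` has a limit at the turning point. -/
lemma TurningPoints.exists_tendsto (hl : 0 < l) (hp : p ∈ paramSpace l)
    (h : TurningPoints l p μ) : ∃ L, Tendsto (fun s => potentialMain l p μ s / xiTwo l p μ s)
      (𝓝[≠] (turnTwo l p μ)) (𝓝 L) := by
  obtain ⟨d, hd0, hd⟩ := h.simple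
  set b := turnTwo l p μ with hb
  set V := potentialMain l p μ with hV
  set w := tortoiseWeight l p with hw
  set δ := b - turnOne l p μ with hδ
  have hδ0 : 0 < δ := by have := h.one_lt_two; rw [hδ]; linarith
  have hVc : Continuous V := continuous_potentialMain hp μ
  have hwb : 0 < w b := tortoiseWeight_pos hl hp h.rPlus_lt_turnTwo
  have hmem : ∀ t ∈ Icc 0 δ, b - t ∈ Ioi (rPlus l p) ∧ b + t ∈ Ioi (rPlus l p) := by
    rintro t ⟨h0, h1⟩
    have h2 := h.lt_one
    have h3 := h.rPlus_lt_turnTwo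
    rw [hδ] at h1
    constructor <;> rw [mem_Ioi] <;> linarith
  have hslope : Tendsto (slope V b) (𝓝[≠] b) (𝓝 d) := hasDerivAt_iff_tendsto_slope.1 hd
  have hl1 : Tendsto (fun t : ℝ => b - t) (𝓝[>] 0) (𝓝[≠] b) := by
    refine tendsto_nhdsWithin_iff.2 ⟨?_, ?_⟩
    · have : Tendsto (fun t : ℝ => b - t) (𝓝 0) (𝓝 (b - 0)) := by
        exact (continuous_const.sub continuous_id).tendsto 0
      rw [sub_zero] at this
      exact this.mono_left nhdsWithin_le_nhds
    · filter_upwards [self_mem_nhdsWithin] with t ht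
      have : (0 : ℝ) < t := ht
      simp [this.ne']
  have hr1 : Tendsto (fun t : ℝ => b + t) (𝓝[>] 0) (𝓝[≠] b) := by
    refine tendsto_nhdsWithin_iff.2 ⟨?_, ?_⟩
    · have : Tendsto (fun t : ℝ => b + t) (𝓝 0) (𝓝 (b + 0)) := by
        exact (continuous_const.add continuous_id).tendsto 0
      rw [add_zero] at this
      exact this.mono_left nhdsWithin_le_nhds
    · filter_upwards [self_mem_nhdsWithin] with t ht
      have : (0 : ℝ) < t := ht
      simp [this.ne']
  have hzero : V b = 0 := h.zero_two
  have L1 := tendsto_div_integral_sqrt_rpow (h := fun t => V (b - t)) (k := fun t => w (b - t))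
    (d := -d) (k₀ := w b) hδ0 (by linarith) hwb
    (fun t ht => h.pos _ (by have := ht.2; rw [hδ] at this; linarith) (by have := ht.1; linarith))
    (by fun_prop) ((continuousOn_tortoiseWeight hl hp).comp (by fun_prop) fun t ht => (hmem t ht).1)
    (by simp) (by
      refine (hslope.comp hl1).neg.congr' ?_
      filter_upwards [self_mem_nhdsWithin] with t ht
      rw [Function.comp_apply, slope_def_field, hzero, sub_zero, sub_sub_cancel_left, div_neg,
        neg_neg])
  have L2 := tendsto_div_integral_sqrt_rpow (h := fun t => -V (b + t)) (k := fun t => w (b + t))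
    (d := -d) (k₀ := w b) hδ0 (by linarith) hwb
    (fun t ht => by have := h.neg_right (b + t) (by have := ht.1; linarith); linarith)
    (by fun_prop) ((continuousOn_tortoiseWeight hl hp).comp (by fun_prop) fun t ht => (hmem t ht).2)
    (by simp) (by
      refine (hslope.comp hr1).neg.congr' ?_
      filter_upwards [self_mem_nhdsWithin] with t ht
      rw [Function.comp_apply, slope_def_field, hzero, sub_zero, add_sub_cancel_left, neg_div])
  -- In terms of the distance to the turning point both sides have the same limit. To the right
  -- V_main and ξ₂ are both negative and the signs cancel.
  refine ⟨-d / (√(-d) * w b) ^ (2 / 3 : ℝ), ?_⟩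
  rw [← nhdsLT_sup_nhdsGT, tendsto_sup]
  constructor
  · have hs : Tendsto (fun s : ℝ => b - s) (𝓝[<] b) (𝓝[>] 0) := by
      refine tendsto_nhdsWithin_iff.2 ⟨?_, ?_⟩
      · have : Tendsto (fun t : ℝ => b - t) (𝓝 b) (𝓝 (b - b)) := by
          exact (continuous_const.sub continuous_id).tendsto b
        rw [sub_self] at this
        exact this.mono_left nhdsWithin_le_nhds
      · filter_upwards [self_mem_nhdsWithin] with s hs
        exact mem_Ioi.2 (sub_pos.2 (mem_Iio.1 hs))
    refine (L1.comp hs).congr' ?_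
    filter_upwards [self_mem_nhdsWithin] with s hs
    rw [Function.comp_apply, xiTwo, if_pos (mem_Iio.1 hs), sub_sub_cancel,
      intervalIntegral.integral_comp_sub_left (fun t => √(V t) * w t) b, sub_sub_cancel, sub_zero]
    rfl
  · have hs : Tendsto (fun s : ℝ => s - b) (𝓝[>] b) (𝓝[>] 0) := by
      refine tendsto_nhdsWithin_iff.2 ⟨?_, ?_⟩
      · have : Tendsto (fun t : ℝ => t - b) (𝓝 b) (𝓝 (b - b)) := by
          exact (continuous_id.sub continuous_const).tendsto b
        rw [sub_self] at this
        exact this.mono_left nhdsWithin_le_nhds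
      · filter_upwards [self_mem_nhdsWithin] with s hs
        exact mem_Ioi.2 (sub_pos.2 (mem_Ioi.1 hs))
    refine (L2.comp hs).congr' ?_
    filter_upwards [self_mem_nhdsWithin] with s hs
    have hs' : b < s := hs
    rw [Function.comp_apply, xiTwo, if_neg hs'.not_gt, add_sub_cancel,
      intervalIntegral.integral_comp_add_left (fun t => √(-V t) * w t) b, add_sub_cancel, add_zero,
      neg_div, div_neg]
    congr 4
    refine intervalIntegral.integral_congr fun t ht => ?_
    rw [uIcc_of_le hs'.le] at ht
    have : V t ≤ 0 := by
      rcases ht.1.eq_or_lt with h1 | h1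
      · rw [← h1, hzero]
      · exact (h.neg_right t h1).le
    rw [abs_of_nonpos this]
    rfl

end

section
variable {l : ℝ} {p : ℝ × ℝ} {μ : ℝ}

/-! ### The Airy-type approximation -/

/-- `∫ √V_main dr*` from `r` to the turning point. -/
def xiIntegral (l : ℝ) (p : ℝ × ℝ) (μ r : ℝ) : ℝ :=
  ∫ s in Ioi r, (Iic (turnTwo l p μ)).indicator
    (fun s => √(potentialMain l p μ s) * tortoiseWeight l p s) s

lemma xiIntegral_eq {r : ℝ} (hr : r < turnTwo l p μ) : xiIntegral l p μ r =
    ∫ s in r..turnTwo l p μ, √(potentialMain l p μ s) * tortoiseWeight l p s := by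
  rw [xiIntegral, setIntegral_indicator measurableSet_Iic, Ioi_inter_Iic,
    intervalIntegral.integral_of_le hr.le]

lemma xiTwo_eq {r : ℝ} (hr : r < turnTwo l p μ) :
    xiTwo l p μ r = (3 / 2 * xiIntegral l p μ r) ^ (2 / 3 : ℝ) := by
  rw [xiTwo, if_pos hr, xiIntegral_eq hr]
  rfl

/-- The approximation `airyApprox` to the left of the turning point, where `L` stands for the
value of `f̂₂` at the turning point. -/
def airyReal (l : ℝ) (p : ℝ × ℝ) (m : ℤ) (μ L r : ℝ) : ℝ :=
  L ^ (1 / 4 : ℝ) *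
    (potentialMain l p μ r / (3 / 2 * xiIntegral l p μ r) ^ (2 / 3 : ℝ)) ^ (-(1 / 4) : ℝ) *
    airyAi ((m : ℝ) ^ (2 / 3 : ℝ) * (3 / 2 * xiIntegral l p μ r) ^ (2 / 3 : ℝ))

lemma airyApprox_eq (m : ℤ) {r : ℝ} (hr : r < turnTwo l p μ) : airyApprox l p m μ r =
    (airyReal l p m μ (fHatTwo l p μ (turnTwo l p μ)) r : ℝ) := by
  have e : fHatTwo l p μ r =
      potentialMain l p μ r / (3 / 2 * xiIntegral l p μ r) ^ (2 / 3 : ℝ) := by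
    rw [fHatTwo, if_neg hr.ne, xiTwo_eq hr]
  rw [airyApprox, airyReal, e, xiTwo_eq hr]

lemma continuousOn_xi_integrand (hl : 0 < l) (hp : p ∈ paramSpace l) (μ : ℝ) :
    ContinuousOn (fun s => √(potentialMain l p μ s) * tortoiseWeight l p s) (Ioi (rPlus l p)) :=
  (continuous_potentialMain hp μ).sqrt.continuousOn.mul (continuousOn_tortoiseWeight hl hp)

lemma TurningPoints.xiIntegral_pos (hl : 0 < l) (hp : p ∈ paramSpace l) (h : TurningPoints l p μ)
    {r : ℝ} (h1 : turnOne l p μ < r) (h2 : r < turnTwo l p μ) : 0 < xiIntegral l p μ r := by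
  have hr := h.lt_one.trans h1
  rw [xiIntegral_eq h2]
  refine intervalIntegral.intervalIntegral_pos_of_pos_on ?_ (fun s hs => ?_) h2
  · refine ContinuousOn.intervalIntegrable ((continuousOn_xi_integrand hl hp μ).mono ?_)
    rw [uIcc_of_le h2.le]
    exact fun s hs => hr.trans_le hs.1
  · exact mul_pos (Real.sqrt_pos.2 (h.pos s (h1.trans hs.1) hs.2))
      (tortoiseWeight_pos hl hp (hr.trans hs.1))

lemma TurningPoints.differentiableAt_xiIntegral (hl : 0 < l) (hp : p ∈ paramSpace l)
    (h : TurningPoints l p μ) {r : ℝ} (h1 : turnOne l p μ < r) (h2 : r < turnTwo l p μ) :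
    DifferentiableAt ℝ (xiIntegral l p μ) r := by
  obtain ⟨c, hc, hcr⟩ := exists_between h1
  have hcp := h.lt_one.trans hc
  refine (hasDerivAt_integral_Ioi (c := c) ?_ hcr ?_).differentiableAt
  · rw [IntegrableOn, integrable_indicator_iff measurableSet_Iic, IntegrableOn,
      Measure.restrict_restrict measurableSet_Iic, inter_comm, Ioi_inter_Iic]
    refine (ContinuousOn.integrableOn_Icc ?_).mono_set Ioc_subset_Icc_self
    exact (continuousOn_xi_integrand hl hp μ).mono fun s hs => hcp.trans_le hs.1
  · have hc := (continuousOn_xi_integrand hl hp μ).continuousAt (Ioi_mem_nhds (hcp.trans hcr))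
    refine hc.congr ?_
    filter_upwards [Iio_mem_nhds h2] with s hs
    rw [indicator_of_mem (show s ∈ Iic (turnTwo l p μ) from (mem_Iio.1 hs).le)]

lemma differentiable_potentialMain (hp : p ∈ paramSpace l) (μ : ℝ) :
    Differentiable ℝ (potentialMain l p μ) := by
  have ha := spin_pos hp
  have h : ∀ n : ℕ, ∀ s : ℝ, (s ^ 2 + spin l p ^ 2) ^ n ≠ 0 := fun n s => by positivity
  have h1 : ∀ s : ℝ, s ^ 2 + spin l p ^ 2 ≠ 0 := fun s => by positivity
  unfold potentialMain omegaAt Delta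
  intro r
  have e1 : DifferentiableAt ℝ (fun r : ℝ => ((spin l p ^ 2 + r ^ 2) * (1 + r ^ 2 / l ^ 2) -
      2 * mass l p * r) / (r ^ 2 + spin l p ^ 2) ^ 2) r :=
    DifferentiableAt.div (by fun_prop) (by fun_prop) (h 2 r)
  have e2 : DifferentiableAt ℝ (fun r : ℝ => spin l p * Xi l p / (r ^ 2 + spin l p ^ 2)) r :=
    DifferentiableAt.div (by fun_prop) (by fun_prop) (h1 r)
  exact (e1.mul_const _).sub ((e2.const_sub _).pow 2)

lemma TurningPoints.differentiableAt_airyReal (hl : 0 < l) (hp : p ∈ paramSpace l)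
    (h : TurningPoints l p μ) (m : ℤ) (L : ℝ) {r : ℝ} (h1 : turnOne l p μ < r)
    (h2 : r < turnTwo l p μ) : DifferentiableAt ℝ (airyReal l p m μ L) r := by
  have hI := h.xiIntegral_pos hl hp h1 h2
  have hI' : 0 < 3 / 2 * xiIntegral l p μ r := by positivity
  have hV := h.pos r h1 h2
  have hx : DifferentiableAt ℝ (fun r => (3 / 2 * xiIntegral l p μ r) ^ (2 / 3 : ℝ)) r :=
    ((h.differentiableAt_xiIntegral hl hp h1 h2).const_mul (3 / 2)).rpow_const (Or.inl hI'.ne')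
  have hx0 := Real.rpow_pos_of_pos hI' (2 / 3)
  unfold airyReal
  refine DifferentiableAt.mul (DifferentiableAt.const_mul (DifferentiableAt.rpow_const
    ((differentiable_potentialMain hp μ r).div hx hx0.ne') (Or.inl (div_pos hV hx0).ne')) _) ?_
  exact (differentiable_airyAi.differentiableAt).comp r (hx.const_mul ((m : ℝ) ^ (2 / 3 : ℝ)))

lemma TurningPoints.dStar_airyApprox (hl : 0 < l) (hp : p ∈ paramSpace l)
    (h : TurningPoints l p μ) (m : ℤ) {r : ℝ} (h1 : turnOne l p μ < r)
    (h2 : r < turnTwo l p μ) : dStar l p (airyApprox l p m μ) r =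
      ((tortoiseWeight l p r)⁻¹ *
        deriv (airyReal l p m μ (fHatTwo l p μ (turnTwo l p μ))) r : ℝ) := by
  have hd := (h.differentiableAt_airyReal hl hp m (fHatTwo l p μ (turnTwo l p μ)) h1 h2).hasDerivAt
  have : HasDerivAt (airyApprox l p m μ)
      (deriv (airyReal l p m μ (fHatTwo l p μ (turnTwo l p μ))) r : ℝ) r := by
    refine hd.ofReal_comp.congr_of_eventuallyEq ?_
    filter_upwards [Iio_mem_nhds h2] with s hs using airyApprox_eq m hs
  rw [dStar, this.deriv, inv_tortoiseWeight, Complex.ofReal_mul]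

/-! ### Measurable dependence on the parameters -/

/-- Differentiability at the point makes the derivative a limit of difference quotients with step
1/(n+1), each measurable in z. -/
lemma measurable_deriv_at {Z : Type*} [MeasurableSpace Z] {f : Z → ℝ → ℝ}
    (hf : Measurable (Function.uncurry f)) {x : Z → ℝ} (hx : Measurable x)
    (hd : ∀ z, DifferentiableAt ℝ (f z) (x z)) : Measurable fun z => deriv (f z) (x z) := by
  refine measurable_of_tendsto_metrizable (f := fun (n : ℕ) z =>
    (1 / ((n : ℝ) + 1))⁻¹ * (f z (x z + 1 / ((n : ℝ) + 1)) - f z (x z))) (fun n => ?_) ?_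
  · exact ((hf.comp (measurable_id.prodMk (hx.add_const _))).sub
      (hf.comp (measurable_id.prodMk hx))).const_mul _
  · rw [tendsto_pi_nhds]
    intro z
    have h := hasDerivAt_iff_tendsto_slope_zero.1 (hd z).hasDerivAt
    refine h.comp (tendsto_nhdsWithin_iff.2 ⟨tendsto_one_div_add_atTop_nhds_zero_nat, ?_⟩)
    refine Eventually.of_forall fun n => ?_
    have : 1 / ((n : ℝ) + 1) ≠ 0 := by positivity
    simpa using this

variable {Z : Type*} [MeasurableSpace Z] {P : Z → paramSpace l} {M : Z → ℝ}

lemma measurable_comp_graph {f : Z × ℝ → ℝ} (hf : Measurable f) {x : Z → ℝ} (hx : Measurable x) :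
    Measurable fun z => f (z, x z) := hf.comp (measurable_id.prodMk hx)

lemma measurable_comp_param {f : ℝ × ℝ → ℝ} (hf : ContinuousOn f (paramSpace l))
    (hP : Measurable P) : Measurable fun z => f (P z) :=
  (continuousOn_iff_continuous_domRestrict.1 hf).measurable.comp hP

lemma measurable_Delta (hP : Measurable P) : Measurable fun x : Z × ℝ => Delta l (P x.1) x.2 := by
  have hP' : Measurable fun x : Z × ℝ => (P x.1 : ℝ × ℝ) :=
    measurable_subtype_coe.comp (hP.comp measurable_fst)
  have h1 : Measurable fun x : Z × ℝ => spin l (P x.1) := by unfold spin; fun_prop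
  have h2 : Measurable fun x : Z × ℝ => mass l (P x.1) := by unfold mass; fun_prop
  unfold Delta; fun_prop

lemma measurable_potentialMain (hl : 0 < l) (hP : Measurable P) (hM : Measurable M) :
    Measurable fun x : Z × ℝ => potentialMain l (P x.1) (M x.1) x.2 := by
  have hP' : Measurable fun x : Z × ℝ => (P x.1 : ℝ × ℝ) :=
    measurable_subtype_coe.comp (hP.comp measurable_fst)
  have hΔ : Measurable fun x : Z × ℝ => Delta l (P x.1) x.2 := measurable_Delta hP
  have hs : Measurable fun x : Z × ℝ => spin l (P x.1) := (continuous_spin l).measurable.comp hP'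
  have hX : Measurable fun x : Z × ℝ => Xi l (P x.1) := (continuous_Xi l).measurable.comp hP'
  have hω : Measurable fun x : Z × ℝ => omegaMinus l (P x.1) :=
    measurable_comp_param (continuousOn_omegaMinus hl) (hP.comp measurable_fst)
  have hM' : Measurable fun x : Z × ℝ => M x.1 := hM.comp measurable_fst
  have hd : Measurable fun x : Z × ℝ => x.2 ^ 2 + spin l (P x.1) ^ 2 :=
    (measurable_snd.pow_const 2).add (hs.pow_const 2)
  have e1 : Measurable fun x : Z × ℝ => Delta l (P x.1) x.2 / (x.2 ^ 2 + spin l (P x.1) ^ 2) ^ 2 :=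
    hΔ.div (hd.pow_const 2)
  have e2 : Measurable fun x : Z × ℝ => M x.1 + omegaMinus l (P x.1) ^ 2 * spin l (P x.1) ^ 2 :=
    hM'.add ((hω.pow_const 2).mul (hs.pow_const 2))
  have e3 : Measurable fun x : Z × ℝ => 2 * spin l (P x.1) * omegaMinus l (P x.1) * Xi l (P x.1) :=
    ((hs.const_mul 2).mul hω).mul hX
  have e4 : Measurable fun x : Z × ℝ => omegaAt l (P x.1) x.2 := (hs.mul hX).div hd
  have e5 : Measurable fun x : Z × ℝ => (omegaMinus l (P x.1) - omegaAt l (P x.1) x.2) ^ 2 :=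
    (hω.sub e4).pow_const 2
  exact (e1.mul (e2.sub e3)).sub e5

lemma measurable_turnTwo (hl : 0 < l) (hP : Measurable P) (hM : Measurable M)
    (hT : ∀ z, TurningPoints l (P z) (M z)) : Measurable fun z => turnTwo l (P z) (M z) := by
  refine measurable_of_Iic fun x => ?_
  have e : (fun z => turnTwo l (P z) (M z)) ⁻¹' Iic x =
      {z | rTop l (P z) ≤ x} ∩ {z | potentialMain l (P z) (M z) x ≤ 0} := by
    ext z; exact (hT z).turnTwo_le_iff x
  rw [e]
  exact (measurableSet_le (measurable_comp_param continuousOn_rTop hP) measurable_const).inter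
    (measurableSet_le (measurable_comp_graph (measurable_potentialMain hl hP hM) measurable_const)
      measurable_const)

lemma measurable_turnOne (hl : 0 < l) (hP : Measurable P) (hM : Measurable M)
    (hT : ∀ z, TurningPoints l (P z) (M z)) : Measurable fun z => turnOne l (P z) (M z) := by
  refine measurable_of_Iic fun x => ?_
  have e : (fun z => turnOne l (P z) (M z)) ⁻¹' Iic x =
      {z | rPlus l (P z) < x} ∩
        ({z | rTop l (P z) ≤ x} ∪ {z | 0 ≤ potentialMain l (P z) (M z) x}) := by
    ext z; exact (hT z).turnOne_le_iff x
  rw [e]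
  exact (measurableSet_lt (measurable_comp_param (continuousOn_rPlus hl) hP)
    measurable_const).inter ((measurableSet_le (measurable_comp_param continuousOn_rTop hP)
    measurable_const).union (measurableSet_le measurable_const
    (measurable_comp_graph (measurable_potentialMain hl hP hM) measurable_const)))

lemma measurable_tortoiseWeight_comp (hP : Measurable P) :
    Measurable fun x : Z × ℝ => tortoiseWeight l (P x.1) x.2 :=
  (measurable_tortoiseWeight l).comp
    ((measurable_subtype_coe.comp (hP.comp measurable_fst)).prodMk measurable_snd)

lemma measurable_rStar_comp (hP : Measurable P) :
    Measurable fun x : Z × ℝ => rStar l (P x.1) x.2 :=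
  (measurable_rStar l).comp
    ((measurable_subtype_coe.comp (hP.comp measurable_fst)).prodMk measurable_snd)

lemma measurable_xiIntegral (hl : 0 < l) (hP : Measurable P) (hM : Measurable M)
    (hT : ∀ z, TurningPoints l (P z) (M z)) :
    Measurable fun x : Z × ℝ => xiIntegral l (P x.1) (M x.1) x.2 := by
  refine measurable_integral_Ioi (f := fun z => (Iic (turnTwo l (P z) (M z))).indicator
    (fun s => √(potentialMain l (P z) (M z) s) * tortoiseWeight l (P z) s)) ?_
  have hs : MeasurableSet {x : Z × ℝ | x.2 ≤ turnTwo l (P x.1) (M x.1)} :=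
    measurableSet_le measurable_snd ((measurable_turnTwo hl hP hM hT).comp measurable_fst)
  exact ((measurable_potentialMain hl hP hM).sqrt.mul (measurable_tortoiseWeight_comp hP)).indicator
    hs

/-- As the two-sided limit exists, it can be taken along a sequence from the left, where ξ₂ is given
by `xiIntegral`. -/
lemma measurable_fHatTwo (hl : 0 < l) (hP : Measurable P) (hM : Measurable M)
    (hT : ∀ z, TurningPoints l (P z) (M z)) :
    Measurable fun z => fHatTwo l (P z) (M z) (turnTwo l (P z) (M z)) := by
  refine measurable_of_tendsto_metrizable (f := fun (n : ℕ) z =>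
    potentialMain l (P z) (M z) (turnTwo l (P z) (M z) - 1 / ((n : ℝ) + 1)) /
    (3 / 2 * xiIntegral l (P z) (M z) (turnTwo l (P z) (M z) - 1 / ((n : ℝ) + 1))) ^
      (2 / 3 : ℝ)) (fun n => ?_) ?_
  · have h := (measurable_turnTwo hl hP hM hT).sub_const (1 / ((n : ℝ) + 1))
    exact (measurable_comp_graph (measurable_potentialMain hl hP hM) h).div
      (((measurable_comp_graph (measurable_xiIntegral hl hP hM hT) h).const_mul
        (3 / 2)).pow_const (2 / 3 : ℝ))
  · rw [tendsto_pi_nhds]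
    intro z
    obtain ⟨L, hL⟩ := (hT z).exists_tendsto hl (P z).2
    rw [fHatTwo, if_pos rfl, hL.limUnder_eq]
    have hn : Tendsto (fun n : ℕ => turnTwo l (P z) (M z) - 1 / ((n : ℝ) + 1)) atTop
        (𝓝[≠] (turnTwo l (P z) (M z))) := by
      refine tendsto_nhdsWithin_iff.2 ⟨?_, Eventually.of_forall fun n => ?_⟩
      · simpa using tendsto_one_div_add_atTop_nhds_zero_nat.const_sub (turnTwo l (P z) (M z))
      · have : 0 < 1 / ((n : ℝ) + 1) := by positivity
        exact (sub_lt_self _ this).ne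
    refine (hL.comp hn).congr fun n => ?_
    have : 0 < 1 / ((n : ℝ) + 1) := by positivity
    rw [Function.comp_apply, xiTwo_eq (sub_lt_self _ this)]

lemma measurable_airyReal (hl : 0 < l) (hP : Measurable P) (hM : Measurable M)
    (hT : ∀ z, TurningPoints l (P z) (M z)) (m : ℤ) : Measurable fun x : Z × ℝ =>
      airyReal l (P x.1) m (M x.1) (fHatTwo l (P x.1) (M x.1) (turnTwo l (P x.1) (M x.1))) x.2 := by
  have hI := ((measurable_xiIntegral hl hP hM hT).const_mul (3 / 2)).pow_const (2 / 3 : ℝ)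
  exact ((((measurable_fHatTwo hl hP hM hT).comp measurable_fst).pow_const (1 / 4 : ℝ)).mul
    (((measurable_potentialMain hl hP hM).div hI).pow_const (-(1 / 4) : ℝ))).mul
    (differentiable_airyAi.continuous.measurable.comp (hI.const_mul ((m : ℝ) ^ (2 / 3 : ℝ))))

/-- The point where the Airy-type solution is initialized. -/
lemma exists_measurable_initial (hl : 0 < l) (hP : Measurable P) (hM : Measurable M)
    (hT : ∀ z, TurningPoints l (P z) (M z)) {e : Z → ℝ} (he : Measurable e) (he0 : ∀ z, 0 < e z)
    (he' : ∀ z, rStar l (P z) (turnOne l (P z) (M z)) + e z <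
      rStar l (P z) (turnTwo l (P z) (M z))) :
    ∃ r₀ : Z → ℝ, Measurable r₀ ∧ ∀ z, turnOne l (P z) (M z) < r₀ z ∧
      r₀ z < turnTwo l (P z) (M z) ∧
      rStar l (P z) (r₀ z) = rStar l (P z) (turnOne l (P z) (M z)) + e z := by
  have hex : ∀ z, ∃ r, turnOne l (P z) (M z) < r ∧ r < turnTwo l (P z) (M z) ∧
      rStar l (P z) r = rStar l (P z) (turnOne l (P z) (M z)) + e z := by
    intro z
    have hc : ContinuousOn (rStar l (P z)) (Icc (turnOne l (P z) (M z)) (turnTwo l (P z) (M z))) :=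
      fun r hr => (hasDerivAt_rStar hl (P z).2
        ((hT z).lt_one.trans_le hr.1)).continuousAt.continuousWithinAt
    obtain ⟨r, hr, hr'⟩ := intermediate_value_Ioo (hT z).one_lt_two.le hc
      ⟨lt_add_of_pos_right _ (he0 z), he' z⟩
    exact ⟨r, hr.1, hr.2, hr'⟩
  choose r₀ h1 h2 h3 using hex
  refine ⟨r₀, measurable_of_Iic fun x => ?_, fun z => ⟨h1 z, h2 z, h3 z⟩⟩
  -- Monotonicity of r* turns r₀ ≤ x into a comparison of r* values. The condition r₁ < x keeps x in
  -- the exterior, where r* is monotone.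
  have e : r₀ ⁻¹' Iic x = {z | turnOne l (P z) (M z) < x} ∩
      {z | rStar l (P z) (turnOne l (P z) (M z)) + e z ≤ rStar l (P z) x} := by
    ext z
    have hr₀ : r₀ z ∈ Ioi (rPlus l (P z)) := (hT z).lt_one.trans (h1 z)
    have hmono := strictMonoOn_rStar hl (P z).2
    constructor
    · intro hz
      have hz' : r₀ z ≤ x := hz
      refine ⟨(h1 z).trans_le hz', ?_⟩
      rw [mem_ofPred_eq, ← h3 z]
      exact (hmono.le_iff_le hr₀ (mem_Ioi.2 ((mem_Ioi.1 hr₀).trans_le hz'))).2 hz'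
    · rintro ⟨hz, hz'⟩
      rw [mem_ofPred_eq, ← h3 z] at hz'
      exact (hmono.le_iff_le hr₀ (mem_Ioi.2 ((hT z).lt_one.trans hz))).1 hz'
  rw [e]
  have ht := measurable_turnOne hl hP hM hT
  exact (measurableSet_lt ht measurable_const).inter (measurableSet_le
    ((measurable_comp_graph (measurable_rStar_comp hP) ht).add he)
    (measurable_comp_graph (measurable_rStar_comp hP) measurable_const))

lemma measurable_radial_at (hl : 0 < l) (hP : Measurable P) {W lam : Z → ℝ} (hW : Measurable W)
    (hlam : Measurable lam) (m : ℤ) {r₀ : Z → ℝ} (hr : Measurable r₀)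
    (hr' : ∀ z, rPlus l (P z) < r₀ z) :
    (Measurable fun z => infSol l (P z) (W z) m (lam z) (r₀ z)) ∧
      Measurable fun z => infFlux l (P z) (W z) m (lam z) (r₀ z) := by
  have hα : Measurable (Function.uncurry fun z => tortoiseWeight l (P z)) :=
    measurable_tortoiseWeight_comp hP
  have hβ : Measurable (Function.uncurry fun z => radialInner l (P z) (W z) m (lam z)) := by
    have h : Measurable fun x : Z × ℝ => (((P x.1 : ℝ × ℝ), W x.1, lam x.1), x.2) :=
      ((measurable_subtype_coe.comp (hP.comp measurable_fst)).prodMk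
        ((hW.comp measurable_fst).prodMk (hlam.comp measurable_fst))).prodMk measurable_snd
    exact (measurable_radialInner l m).comp h
  have hg : Measurable (Function.uncurry fun z r => rStar l (P z) r - Real.pi / 2 * l) :=
    (measurable_rStar_comp hP).sub_const _
  have hV : ∀ z, ∃ c b γ G A D, VolterraBound c (tortoiseWeight l (P z))
      (radialInner l (P z) (W z) m (lam z)) b γ G A ∧ c < r₀ z ∧ 0 ≤ D ∧
      ∀ y, c < y → |rStar l (P z) y - Real.pi / 2 * l| ≤ D := by
    intro z
    obtain ⟨c, hc, hcr⟩ := exists_between (hr' z)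
    obtain ⟨B, C, A, N, -, -, -, h⟩ := exists_radial_volterraBound hl (P z).2 (W z) m (lam z) hc
    obtain ⟨D, hD0, hD⟩ := (isRadialSeed_rStar hl (P z).2).bound c hc
    exact ⟨c, _, _, _, A, D, h, hcr, hD0, hD⟩
  exact ⟨measurable_volterraSol_at hα hβ hg hr hV,
    (measurable_inner_volterraSol_at hα hβ hg hr hV).const_sub 1⟩

lemma measurable_wTwo (hl : 0 < l) (hP : Measurable P) (m : ℤ) (ℓ : ℕ)
    (hlam : Measurable fun z => lamMinus l (P z) m ℓ)
    (hT : ∀ z, TurningPoints l (P z) (lamMinus l (P z) m ℓ / (m : ℝ) ^ 2)) {ε : ℝ × ℝ → ℝ}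
    (hε : Measurable fun z => ε (P z)) (hε0 : ∀ z, 0 < ε (P z))
    (hε' : ∀ z, rStar l (P z) (turnOne l (P z) (lamMinus l (P z) m ℓ / (m : ℝ) ^ 2)) + ε (P z) <
      rStar l (P z) (turnTwo l (P z) (lamMinus l (P z) m ℓ / (m : ℝ) ^ 2))) :
    Measurable fun z => wTwo l ε m ℓ (P z) := by
  have hM := hlam.div_const ((m : ℝ) ^ 2)
  obtain ⟨r₀, hr, h⟩ := exists_measurable_initial hl hP hM hT hε hε0 hε'
  have hr' : ∀ z, rPlus l (P z) < r₀ z := fun z => (hT z).lt_one.trans (h z).1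
  have hω := (measurable_comp_param (continuousOn_omegaMinus hl) hP).mul_const (m : ℝ)
  obtain ⟨h1, h2⟩ := measurable_radial_at hl hP hω hlam m hr hr'
  have h3 := measurable_airyReal hl hP hM hT m
  have h4 := measurable_comp_graph h3 hr
  have h5 := measurable_deriv_at (f := fun z => airyReal l (P z) m (lamMinus l (P z) m ℓ / m ^ 2)
    (fHatTwo l (P z) (lamMinus l (P z) m ℓ / m ^ 2)
      (turnTwo l (P z) (lamMinus l (P z) m ℓ / m ^ 2)))) h3 hr fun z =>
    (hT z).differentiableAt_airyReal hl (P z).2 m _ (h z).1 (h z).2.1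
  have h6 := (measurable_comp_graph (measurable_tortoiseWeight_comp hP) hr).inv
  convert Complex.measurable_ofReal.comp ((h4.mul h2).sub ((h6.mul h5).mul h1)) using 1
  funext z
  rw [wTwo_eq hl (P z).2 (hT z).lt_one (h z).1 (h z).2.2, airyApprox_eq m (h z).2.1,
    (hT z).dStar_airyApprox hl (P z).2 m (h z).1 (h z).2.1, ← Complex.ofReal_mul,
    ← Complex.ofReal_mul, ← Complex.ofReal_sub]
  rfl

/-- On the measurable set S of parameters with σ₁ < λ/m² < σ₂ the turning points exist, so 𝔚₂ is
given by the explicit formula and is measurable there. The result is carried back through the two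
subtype inclusions, both with measurable range. -/
lemma measurableSet_smallSet (hl : 0 < l) {ε : ℝ × ℝ → ℝ} (hεc : ContinuousOn ε (paramSpace l))
    (hε : AdmissibleOffset l ε) (m ℓ : ℕ) (hm : 1 ≤ m) : MeasurableSet (smallSet l ε m ℓ) := by
  have hlam := measurable_lamMinus hl hm ℓ
  have hM := hlam.div_const ((m : ℝ) ^ 2)
  set S : Set (paramSpace l) := {z | sigmaOne l z < lamMinus l z m ℓ / (m : ℝ) ^ 2} ∩
    {z | lamMinus l z m ℓ / (m : ℝ) ^ 2 < sigmaTwo l z} with hS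
  have hSm : MeasurableSet S := (measurableSet_lt (measurable_sigmaOne hl) hM).inter
    (measurableSet_lt hM (measurable_sigmaTwo hl))
  have hP : Measurable fun z : S => (z : paramSpace l) := measurable_subtype_coe
  have h1 : ∀ z : S, sigmaOne l z < lamMinus l z m ℓ / (m : ℝ) ^ 2 := fun z => z.2.1
  have h2 : ∀ z : S, lamMinus l z m ℓ / (m : ℝ) ^ 2 < sigmaTwo l z := fun z => z.2.2
  have hW := measurable_wTwo hl hP m ℓ (hlam.comp hP) (fun z => by
      rw [Int.cast_natCast]; exact turningPoints_of_sigma hl z.1.2 (h1 z) (h2 z))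
    (measurable_comp_param hεc hP) (fun z => (hε z z.1.2).1) (fun z => by
      rw [Int.cast_natCast]; exact (hε z z.1.2).2 _ ⟨(h1 z).le, (h2 z).le⟩)
  have hB := measurableSet_lt hW.norm
    (measurable_const (a := Real.exp (-(ℓ : ℝ)) * Real.exp (-(m : ℝ))))
  have e : smallSet l ε m ℓ = Subtype.val '' (Subtype.val '' {z : S | ‖wTwo l ε m ℓ z‖ <
      Real.exp (-(ℓ : ℝ)) * Real.exp (-(m : ℝ))}) := by
    ext p
    constructor
    · rintro ⟨h1, h2, h3, h4⟩
      exact ⟨⟨p, h1⟩, ⟨⟨⟨p, h1⟩, h2, h3⟩, h4, rfl⟩, rfl⟩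
    · rintro ⟨-, ⟨z, h, rfl⟩, rfl⟩
      exact ⟨z.1.2, z.2.1, z.2.2, h⟩
  rw [e]
  exact (isOpen_paramSpace hl).measurableSet.subtype_image (hSm.subtype_image hB)

end

end KerrAdS

end

/-! ### The theorem on slices, area and measure zero -/

theorem mainTheorem3 (Λ : ℝ) (hΛ : Λ < 0) (ε : ℝ × ℝ → ℝ)
    (hεc : ContinuousOn ε (KerrAdS.paramSpace (KerrAdS.adsRadius Λ)))
    (hε : KerrAdS.AdmissibleOffset (KerrAdS.adsRadius Λ) ε) :
    volume (KerrAdS.blowUpSet (KerrAdS.adsRadius Λ) ε) = 0 ∧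
    ∀ 𝔪₁ 𝔞₁ s : ℝ, 0 < s →
      Icc 𝔪₁ (𝔪₁ + s) ×ˢ Icc 𝔞₁ (𝔞₁ + s) ⊆ KerrAdS.paramSpace (KerrAdS.adsRadius Λ) →
      ∃ K : ℝ, 0 < K ∧ ∀ m ℓ : ℕ, 1 ≤ m → m ≤ ℓ →
        (∀ 𝔞 : ℝ, ∃ 𝒮 : Finset (Set (ℝ × ℝ)),
          (𝒮.card : ℝ) ≤ K * (m : ℝ) ^ 2 ∧
          (∀ S ∈ 𝒮, Bornology.IsBounded S ∧
            Metric.diam S ≤ K * Real.exp (-(ℓ : ℝ) - (m : ℝ))) ∧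
          KerrAdS.resonantSet (KerrAdS.adsRadius Λ) ε m ℓ
              ∩ Icc 𝔪₁ (𝔪₁ + s) ×ˢ Icc 𝔞₁ (𝔞₁ + s) ∩ {p : ℝ × ℝ | p.2 = 𝔞}
            = ⋃ S ∈ 𝒮, S) ∧
        volume (KerrAdS.resonantSet (KerrAdS.adsRadius Λ) ε m ℓ
              ∩ Icc 𝔪₁ (𝔪₁ + s) ×ˢ Icc 𝔞₁ (𝔞₁ + s))
          ≤ ENNReal.ofReal (K * (m : ℝ) ^ 2 * Real.exp (-(ℓ : ℝ) - (m : ℝ))) := by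
  have hl : 0 < KerrAdS.adsRadius Λ := KerrAdS.adsRadius_pos hΛ
  refine ⟨KerrAdS.volume_blowUpSet hl (KerrAdS.measurableSet_smallSet hl hεc hε),
    fun 𝔪₁ 𝔞₁ s hs hC => ?_⟩
  obtain ⟨K, hK, hLip⟩ := KerrAdS.exists_inverse_lipschitz hl hs hC
  -- One constant serves three bounds: 1 for the number of pieces, K for their diameter, 2Ks for the
  -- area.
  refine ⟨1 + K + s * (2 * K), by positivity, fun m ℓ hm _ => ⟨fun 𝔞 => ?_, ?_⟩⟩
  · obtain ⟨𝒮, hcard, hdiam, hunion⟩ := KerrAdS.resonant_slices hl hK hLip hm 𝔞 (ε := ε) (ℓ := ℓ)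
    refine ⟨𝒮, ?_, fun S hS => ⟨(hdiam S hS).1, (hdiam S hS).2.trans ?_⟩, hunion⟩
    · have h1 : (𝒮.card : ℝ) ≤ (m : ℝ) ^ 2 := by exact_mod_cast hcard
      refine h1.trans (le_mul_of_one_le_left (by positivity) ?_)
      have : 0 < s * (2 * K) := by positivity
      linarith
    · refine mul_le_mul_of_nonneg_right ?_ (Real.exp_pos _).le
      have : 0 < s * (2 * K) := by positivity
      linarith
  · refine (KerrAdS.volume_resonant_le hl hK hLip hm
      (KerrAdS.measurableSet_smallSet hl hεc hε m ℓ hm)).trans (ENNReal.ofReal_le_ofReal ?_)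
    gcongr
    linarith
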